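/- **Setting.** Let $Q$ be a smooth $N$-manifold, $\vartheta=p_i\,dq^i$ the canonical one-form of $T^*Q$, $\omega=-d\vartheta$, $X_f$ the Hamiltonian vector field with $\omega(X_f,\cdot)=df$, $\{f,g\}=df(X_g)$ and $\ell_f=\vartheta(X_f)-f$. Let $\mathcal L$ be a connected smooth $N$-manifold with a distinguished point $p$, let $\epsilon>0$, and let $a\in H^1(\mathcal L,\mathbb R)$ be an integral class. Let $I$ be the component of a given embedding $\iota_0$ in the space of Lagrangian embeddings $\iota:\mathcal L\to T^*Q$ satisfying the corrected Bohr–Sommerfeld condition $\frac{\epsilon\pi}{2}\mu_\iota+[\iota^*\vartheta]=2\pi\epsilon\,a$, where $\mu_\iota$ is the Maslov class. Put $\mathcal P_o=I\times(\mathbb R\bmod\frac{\epsilon\pi}{2})\times\mathrm{den}(\mathcal L)$, with $\mathrm{den}(\mathcal L)$ the positive smooth densities of finite mass. Let $\mathcal P=\mathcal P_o/\mathrm{Diff}(\mathcal L)_o$, where the diffeomorphisms $\eta$ isotopic to the identity act by $(\iota,\phi,\mu)\mapsto(\iota\circ\eta^{-1},\ \phi+\int_p^{\eta^{-1}(p)}\iota^*\vartheta,\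 \eta_*\mu)$. A point of $\mathcal P$ represented by $(\iota,\phi,\mu)$ determines the Lagrangian submanifold $\Lambda=\iota(\mathcal L)$, with inclusion $\iota_\Lambda$ into $T^*Q$; densities on $\mathcal L$ and on $\Lambda$ are identified by means of $\iota$. A tangent vector of $\mathcal P$ is a class $(\delta g,\delta\mu)+W$, with $\delta g\in C^\infty(T^*Q)$ and $\delta\mu$ a smooth density on $\Lambda$. It is represented by the velocity $(X_{\delta g}\circ\iota,\ \ell_{\delta g}(\iota(p)),\ \delta\mu)$ in $\mathcal P_o$, and $W$ consists of the pairs $(f,L_{X_f}\mu)$ with $f|_\Lambda=0$. The differential of a functional $F$ is written $dF=(\frac{\delta F}{\delta g},\frac{\delta F}{\delta\mu})$, with $\frac{\delta F}{\delta g}$ a smooth density on $\Lambda$ and $\frac{\delta F}{\delta\mu}\in C^\infty(T^*Q)$, if $$dF\big((\delta g,\delta\mu)+W\big)=\int_\Lambda\iota_\Lambda^*\delta g\,\tfrac{\delta F}{\delta g}+\int_\Lambda\iota_\Lambda^*\{\tfrac{\delta F}{\delta\mu},\delta g\}\,\mu+\int_\Lambda\iota_\Lambda^*\tfrac{\delta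 F}{\delta\mu}\,\delta\mu .$$ Let $D(z,t,U)$ be a smooth function on $T^*Q\times\mathbb R\times\mathbb R$ and $E_t(z)$ a smooth function with $D(z,t,-E_t(z))=0$. Assume that $\rho_t(z)=\frac{\partial D}{\partial U}(z,t,-E_t(z))$ vanishes nowhere. Let $\theta_t$ be the one-form on $\mathcal P$ whose pull-back to $\mathcal P_o$ is $$\Theta_t(X_{\delta g}\circ\iota,\delta\phi,\delta\mu)=-\int_{\mathcal L}\iota^*(\delta g\,\rho_t)\,\mu-\Big(\int_{\mathcal L}\iota^*\rho_t\,\mu\Big)\big(\ell_{\delta g}(\iota(p))-\delta\phi\big).$$ The time-dependent Hamiltonian vector field $X_{\mathcal H_t}$ of a time-dependent functional $\mathcal H_t:\mathcal P\to\mathbb R$ is defined by $\mathrm i_{X_{\mathcal H_t}}d\theta_t=-d\mathcal H_t-\dot\theta_t$. (If $\mathcal L$ is not compact, differentials are taken and one-forms are compared on variations of compact support.) **Theorem.** At every $t$ and every point of $\mathcal P$ at which $\mathcal H_t$ has a differential of the above form, a tangent vector satisfies the defining equation of $X_{\mathcal H_t}$ if and only if it equals $(\delta g_{\mathcal H_t},\delta\mu_{\mathcal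 H_t})+W$, where $$\delta g_{\mathcal H_t}=-\frac1{\rho_t}\frac{\delta\mathcal H_t}{\delta\mu},\qquad \delta\mu_{\mathcal H_t}=\frac1{\iota_\Lambda^*\rho_t}\Big(\frac{\delta\mathcal H_t}{\delta g}-\iota_\Lambda^*\dot\rho_t\,\mu+\iota_\Lambda^*\Big\{\rho_t,\frac1{\rho_t}\frac{\delta\mathcal H_t}{\delta\mu}\Big\}\,\mu\Big).$$ In particular, let $e_t$ be the energy functional induced on $\mathcal P$ by $-\int_{\mathcal L}\iota^*(E_t\rho_t)\,\mu$. At every point where this integral converges, $de_t$ is given by $\frac{\delta e_t}{\delta g}=0$, $\frac{\delta e_t}{\delta\mu}=-E_t\rho_t$, and the time-dependent Hamiltonian vector field of $e_t$ is $$\delta g_{e_t}=E_t,\qquad \delta\mu_{e_t}=-\iota_\Lambda^*\Big(\frac{\dot\rho_t}{\rho_t}+\frac1{\rho_t}\{\rho_t,E_t\}\Big)\mu .$$ This is the KMW dynamics: it is the velocity in $\mathcal P$ of every solution of $\dot\iota_t=X_{E_t}\circ\iota_t$, $\dot\phi_t=\ell_{E_t}(\iota_t(p))$, $\frac{d}{dt}(\iota_t^*(\rho_t)\mu_t)=0$.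 -/

import Mathlib

open Set MeasureTheory
open scoped Manifold ContDiff Topology

noncomputable section

namespace KMW

/-! ### The cotangent bundle and its canonical forms -/

/-- The model vector space `ℝᴺ`. -/
abbrev Rn (N : ℕ) : Type := EuclideanSpace ℝ (Fin N)

/-- The model vector space `ℝᴺ × (ℝᴺ)*` of the cotangent bundle: coordinates `(q, p)`. -/
abbrev PhaseModel (N : ℕ) : Type := Rn N × (Rn N →L[ℝ] ℝ)

/-- The total space `T*Q` of the cotangent bundle of an `N`-manifold `Q`. -/
abbrev Cotangent (N : ℕ) (Q : Type*) [TopologicalSpace Q] [ChartedSpace (Rn N) Q] :=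
  Bundle.TotalSpace (Rn N →L[ℝ] ℝ)
    (fun q : Q => TangentSpace (𝓡 N) q →L[ℝ] Bundle.Trivial Q ℝ q)

/-- The model with corners (without boundary) of `T*Q`. -/
abbrev cot (N : ℕ) := (𝓡 N).prod 𝓘(ℝ, Rn N →L[ℝ] ℝ)

section Canonical

variable {N : ℕ} {Q : Type*} [TopologicalSpace Q] [ChartedSpace (Rn N) Q] [IsManifold (𝓡 N) ∞ Q]

/-- The canonical `1`-form `ϑ` on `T*Q`: `ϑ_z(w) = z(dπ(w))`, in coordinates `p_i dq^i`. -/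
def liouville (z : Cotangent N Q) : TangentSpace (cot N) z →L[ℝ] ℝ :=
  ContinuousLinearMap.comp (σ₁₂ := RingHom.id ℝ) (σ₂₃ := RingHom.id ℝ)
    (M₂ := Rn N) (M₃ := ℝ) z.2
    (mfderiv (cot N) (𝓡 N) (fun z' : Cotangent N Q => z'.1) z)

/-- The canonical `1`-form in the coordinates of the preferred chart at `z`. -/
def liouvilleInChart (z : Cotangent N Q) (y : PhaseModel N) : PhaseModel N →L[ℝ] ℝ :=
  ContinuousLinearMap.comp (σ₁₂ := RingHom.id ℝ) (σ₂₃ := RingHom.id ℝ)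
    (M₂ := PhaseModel N) (M₃ := ℝ)
    (liouville ((extChartAt (cot N) z).symm y))
    (mfderiv 𝓘(ℝ, PhaseModel N) (cot N) (extChartAt (cot N) z).symm y)

/-- The canonical symplectic form `ω = -dϑ` on `T*Q`, in coordinates `dq^i ∧ dp_i`. The exterior
derivative is computed in the preferred chart at `z`; in Mathlib a tangent vector at `z` is the
vector of its components in that chart. -/
def symplecticForm (z : Cotangent N Q) (v w : TangentSpace (cot N) z) : ℝ :=
  -(fderiv ℝ (liouvilleInChart z) (extChartAt (cot N) z z) (v : PhaseModel N) (w : PhaseModel N)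
    - fderiv ℝ (liouvilleInChart z) (extChartAt (cot N) z z) (w : PhaseModel N) (v : PhaseModel N))

/-- The differential `df_z(w)` of a function on `T*Q`. -/
def dfun (f : Cotangent N Q → ℝ) (z : Cotangent N Q) (w : TangentSpace (cot N) z) : ℝ :=
  mfderiv (cot N) 𝓘(ℝ, ℝ) f z w

/-- The Hamiltonian vector field `X_f`: the vector with `ω(X_f, w) = df(w)` for all `w`;
in coordinates `(∂f/∂p, -∂f/∂q)`. -/
def hamField (f : Cotangent N Q → ℝ) (z : Cotangent N Q) : TangentSpace (cot N) z :=
  Classical.epsilon fun v : TangentSpace (cot N) z => ∀ w, symplecticForm z v w = dfun f z w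

/-- The Poisson bracket `{f, g} = df(X_g)`; in coordinates `∂_q f ∂_p g - ∂_p f ∂_q g`. -/
def poisson (f g : Cotangent N Q → ℝ) (z : Cotangent N Q) : ℝ :=
  dfun f z (hamField g z)

/-- Smooth functions on `T*Q`. -/
abbrev Smooth (f : Cotangent N Q → ℝ) : Prop := ContMDiff (cot N) 𝓘(ℝ, ℝ) ∞ f

end Canonical

/-! ### Lagrangian embeddings, Maslov index, corrected Bohr-Sommerfeld condition -/

section Lagrangian

variable {N : ℕ} {Q : Type*} [TopologicalSpace Q] [ChartedSpace (Rn N) Q] [IsManifold (𝓡 N) ∞ Q]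
  {L : Type*} [TopologicalSpace L] [ChartedSpace (Rn N) L] [IsManifold (𝓡 N) ∞ L]

/-- The differential of `ι : L → T*Q`. -/
abbrev dEmb (ι : L → Cotangent N Q) (x : L) :
    TangentSpace (𝓡 N) x →L[ℝ] TangentSpace (cot N) (ι x) :=
  mfderiv (𝓡 N) (cot N) ι x

/-- `ι : L → T*Q` is a Lagrangian embedding (`dim L = dim Q = N`): a smooth immersion that is a
homeomorphism onto its image, with `ι^*ω = 0`. -/
structure IsLagrangianEmbedding (ι : L → Cotangent N Q) : Prop where
  smooth : ContMDiff (𝓡 N) (cot N) ∞ ι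
  immersion : ∀ x, Function.Injective (dEmb ι x)
  embedding : Topology.IsEmbedding ι
  isotropic : ∀ x (v w : TangentSpace (𝓡 N) x),
    symplecticForm (ι x) (dEmb ι x v) (dEmb ι x w) = 0

/-- The line integral `∫_c ι^*ϑ` along a curve `c : [0,1] → L`. -/
def lineIntegral (ι : L → Cotangent N Q) (c : ℝ → L) : ℝ :=
  ∫ t in (0 : ℝ)..1,
    liouville (ι (c t)) (dEmb ι (c t) (mfderivWithin 𝓘(ℝ, ℝ) (𝓡 N) c (Icc 0 1) t (1 : ℝ)))

/-- `J` is a continuous almost complex structure on `T*Q` compatible with `ω`. -/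
structure IsCompatible
    (J : ∀ z : Cotangent N Q, TangentSpace (cot N) z →L[ℝ] TangentSpace (cot N) z) : Prop where
  sq : ∀ z v, J z (J z v) = -v
  symplectic : ∀ z v w, symplecticForm z (J z v) (J z w) = symplecticForm z v w
  positive : ∀ z v, v ≠ 0 → 0 < symplecticForm z v (J z v)
  continuous : ∀ z₀ : Cotangent N Q,
    ContinuousAt (inTangentCoordinates (cot N) (cot N) (fun z : Cotangent N Q => z) (fun z => z)
      (fun z => J z) z₀) z₀

/-- `c = det(U)² / |det(U)|²`, where the complex matrix `U` expresses a basis of the tangent space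
`dι(T_x L)` through a basis `v` of the vertical space `ker dπ`, complex scalars acting via `J`.
This `c` depends on neither basis. -/
def IsMaslovPhase
    (J : ∀ z : Cotangent N Q, TangentSpace (cot N) z →L[ℝ] TangentSpace (cot N) z)
    (ι : L → Cotangent N Q) (x : L) (c : ℂ) : Prop :=
  ∃ (v : Fin N → TangentSpace (cot N) (ι x)) (l : Fin N → TangentSpace (𝓡 N) x)
    (U : Matrix (Fin N) (Fin N) ℂ),
    LinearIndependent ℝ v ∧ LinearIndependent ℝ l ∧
    (∀ i, mfderiv (cot N) (𝓡 N) (fun z : Cotangent N Q => z.1) (ι x) (v i) = 0) ∧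
    (∀ j, dEmb ι x (l j) = ∑ i, ((U i j).re • v i + (U i j).im • J (ι x) (v i))) ∧
    c * (‖U.det‖ ^ 2 : ℝ) = U.det ^ 2 ∧ ‖c‖ = 1

/-- `k` is the Maslov index of the embedding `ι` along the loop `γ : [0,1] → L`: the degree of the
map `t ↦ det(U)² / |det(U)|²` into the unit circle. -/
def HasMaslovIndex (ι : L → Cotangent N Q) (γ : ℝ → L) (k : ℤ) : Prop :=
  ∃ J : (∀ z : Cotangent N Q, TangentSpace (cot N) z →L[ℝ] TangentSpace (cot N) z),
    IsCompatible J ∧ ∃ α : ℝ → ℝ, ContinuousOn α (Icc 0 1) ∧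
      (∀ t ∈ Icc (0 : ℝ) 1, IsMaslovPhase J ι (γ t) (Complex.exp (α t * Complex.I))) ∧
      α 1 - α 0 = 2 * Real.pi * k

/-- The corrected Bohr-Sommerfeld condition `(επ/2) μ_ι + [ι^*ϑ] = 2πε a` in `H¹(L, ℝ)`, with
`μ_ι` the Maslov class and `a` an integral class, `H¹(L, ℝ) = Hom(π₁(L, p), ℝ)` being evaluated
on smooth loops. -/
def CorrectedBohrSommerfeld (ε : ℝ) (p : L) (a : FundamentalGroup L p →* Multiplicative ℤ)
    (ι : L → Cotangent N Q) : Prop :=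
  ∀ γ : Path p p, ContMDiffOn 𝓘(ℝ, ℝ) (𝓡 N) ∞ γ.extend (Icc 0 1) →
    ∃ k : ℤ, HasMaslovIndex ι γ.extend k ∧
      ε * Real.pi / 2 * k + lineIntegral ι γ.extend =
        2 * Real.pi * ε *
          (Multiplicative.toAdd (a (FundamentalGroup.fromPath (Path.Homotopic.Quotient.mk γ))) : ℤ)

/-- Equality of the de Rham classes `[ι'^*ϑ] = [ι^*ϑ]` in `H¹(L, ℝ)`. -/
def SameLiouvilleClass (ι ι' : L → Cotangent N Q) : Prop :=
  ∃ S : L → ℝ, ContMDiff (𝓡 N) 𝓘(ℝ, ℝ) ∞ S ∧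
    ∀ x (w : TangentSpace (𝓡 N) x),
      liouville (ι' x) (dEmb ι' x w) - liouville (ι x) (dEmb ι x w) =
        mfderiv (𝓡 N) 𝓘(ℝ, ℝ) S x w

/-- `ι` and `ι'` are joined by a smooth path of Lagrangian embeddings along which the class
`[ι_s^*ϑ]` is constant. -/
def SmoothlyJoined (ι ι' : L → Cotangent N Q) : Prop :=
  ∃ j : ℝ → L → Cotangent N Q,
    ContMDiff (𝓘(ℝ, ℝ).prod (𝓡 N)) (cot N) ∞ (fun q : ℝ × L => j q.1 q.2) ∧
    (∀ s, IsLagrangianEmbedding (j s)) ∧ (∀ s, SameLiouvilleClass ι (j s)) ∧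
    j 0 = ι ∧ j 1 = ι'

/-- The set `I`: the (piecewise smooth path) component of `ι₀` in the space of Lagrangian
embeddings with the same class `[ι^*ϑ]`. The Maslov class is constant on it, so that for an `ι₀`
satisfying the corrected Bohr-Sommerfeld condition it is the component of `ι₀` in the space of
Lagrangian embeddings that satisfy this condition. -/
def InComponent (ι₀ ι : L → Cotangent N Q) : Prop :=
  Relation.ReflTransGen SmoothlyJoined ι₀ ι

end Lagrangian

/-! ### Densities -/

section Density

variable (N : ℕ) {L : Type*} [TopologicalSpace L] [ChartedSpace (Rn N) L] [MeasurableSpace L]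

/-- A positive smooth density on `L`, viewed as the measure it defines: in every chart the measure
has a smooth positive density with respect to Lebesgue measure. -/
def IsPositiveDensity (μ : Measure L) : Prop :=
  ∀ c : L, ∃ m : Rn N → ℝ, ContDiffOn ℝ ∞ m (extChartAt (𝓡 N) c).target ∧
    (∀ y ∈ (extChartAt (𝓡 N) c).target, 0 < m y) ∧
    (μ.restrict (extChartAt (𝓡 N) c).source).map (extChartAt (𝓡 N) c) =
      (volume.restrict (extChartAt (𝓡 N) c).target).withDensity (fun y => ENNReal.ofReal (m y))

variable {N}

/-- For a positive density `μ` every smooth density on `L` is `r μ` for a unique smooth function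
`r`. The density `r μ` is the Lie derivative `L_Y μ`: this is expressed by
`∫ χ r μ = - ∫ (L_Y χ) μ` for all test functions `χ`. -/
def IsLieDerivative (μ : Measure L) (Y : ∀ x : L, TangentSpace (𝓡 N) x) (r : L → ℝ) : Prop :=
  ∀ χ : L → ℝ, ContMDiff (𝓡 N) 𝓘(ℝ, ℝ) ∞ χ → HasCompactSupport χ →
    ∫ x, χ x * r x ∂μ = -∫ x, (mfderiv (𝓡 N) 𝓘(ℝ, ℝ) χ x (Y x) : ℝ) ∂μ

end Density

/-! ### The phase space -/

section PhaseSpace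

variable {N : ℕ} {Q : Type*} [TopologicalSpace Q] [ChartedSpace (Rn N) Q] [IsManifold (𝓡 N) ∞ Q]
  {L : Type*} [TopologicalSpace L] [ChartedSpace (Rn N) L] [IsManifold (𝓡 N) ∞ L]
  [MeasurableSpace L] [BorelSpace L]

/-- The space `𝒫ₒ = I × (ℝ mod επ/2) × den(L)` of potentials `(ι, φ, μ)`, where `I` is the component
of `ι₀`. Densities are of finite total mass (which is automatic for compact `L`). -/
structure Potentials (ε : ℝ) (ι₀ : L → Cotangent N Q) where
  ι : L → Cotangent N Q
  φ : AddCircle (ε * Real.pi / 2)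
  μ : Measure L
  mem_component : InComponent ι₀ ι
  density : IsPositiveDensity N μ
  finite : IsFiniteMeasure μ

/-- `η` is isotopic to the identity. -/
def IsotopicToId (η : L ≃ₘ⟮𝓡 N, 𝓡 N⟯ L) : Prop :=
  ∃ h : ℝ → (L ≃ₘ⟮𝓡 N, 𝓡 N⟯ L),
    ContMDiff (𝓘(ℝ, ℝ).prod (𝓡 N)) (𝓡 N) ∞ (fun q : ℝ × L => h q.1 q.2) ∧
    (∀ x, h 0 x = x) ∧ (∀ x, h 1 x = η x)

variable {ε : ℝ} {ι₀ : L → Cotangent N Q}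

/-- `Z'` is the image of `Z` under a gauge transformation `η ∈ Diff(L)ₒ`:
`(ι', φ', μ') = (ι ∘ η⁻¹, φ + ∫_p^{η⁻¹(p)} ι^*ϑ, η_* μ)`. -/
def GaugeRel (p : L) (Z Z' : Potentials ε ι₀) : Prop :=
  ∃ η : L ≃ₘ⟮𝓡 N, 𝓡 N⟯ L, IsotopicToId η ∧
    (∀ x, Z'.ι x = Z.ι (η.symm x)) ∧
    (∃ c : ℝ → L, ContMDiffOn 𝓘(ℝ, ℝ) (𝓡 N) ∞ c (Icc 0 1) ∧ c 0 = p ∧ c 1 = η.symm p ∧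
      Z'.φ = Z.φ + (lineIntegral Z.ι c : ℝ)) ∧
    Z'.μ = Z.μ.map η

/-- The phase space `𝒫 = 𝒫ₒ / Diff(L)ₒ`. -/
def PhaseSpace (ε : ℝ) (ι₀ : L → Cotangent N Q) (p : L) := Quot (GaugeRel (ε := ε) (ι₀ := ι₀) p)

/-- The projection `Π : 𝒫ₒ → 𝒫`. -/
def proj (p : L) (Z : Potentials ε ι₀) : PhaseSpace ε ι₀ p := Quot.mk _ Z

/-- The integral of a function on `T*Q` against `ι_* μ` is gauge invariant. -/
theorem integral_gauge_invariant (p : L) (f : Cotangent N Q → ℝ) (Z Z' : Potentials ε ι₀)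
    (h : GaugeRel p Z Z') : ∫ x, f (Z.ι x) ∂Z.μ = ∫ x, f (Z'.ι x) ∂Z'.μ := by
  obtain ⟨η, -, h1, -, h3⟩ := h
  rw [h3]
  have e : MeasurableEmbedding η := η.toHomeomorph.measurableEmbedding
  rw [e.integral_map]
  simp [h1]

/-! ### Smooth families in the phase space and their velocities -/

/-- A smooth family of potentials, parametrized by a normed space `S` (`ℝ` for curves, `ℝ × ℝ` for
two-parameter families). `phase` is a smooth lift of the phases to `ℝ`, and `dens s` is the ratio
of the density `μ_s` to `μ_0`. -/
structure SmoothFamily (S : Type) [NormedAddCommGroup S] [NormedSpace ℝ S] (ε : ℝ)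
    (ι₀ : L → Cotangent N Q) where
  pt : S → Potentials ε ι₀
  phase : S → ℝ
  dens : S → L → ℝ
  phase_spec : ∀ s, (pt s).φ = (phase s : ℝ)
  dens_pos : ∀ s x, 0 < dens s x
  dens_spec : ∀ s, (pt s).μ = (pt 0).μ.withDensity (fun x => ENNReal.ofReal (dens s x))
  smooth_emb : ContMDiff (𝓘(ℝ, S).prod (𝓡 N)) (cot N) ∞ (fun q : S × L => (pt q.1).ι q.2)
  smooth_phase : ContDiff ℝ ∞ phase
  smooth_dens : ContMDiff (𝓘(ℝ, S).prod (𝓡 N)) 𝓘(ℝ, ℝ) ∞ (fun q : S × L => dens q.1 q.2)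

namespace SmoothFamily

variable {S : Type} [NormedAddCommGroup S] [NormedSpace ℝ S]

/-- The velocity `δι` at the parameter `s` in the direction `e`. -/
def deltaEmb (F : SmoothFamily S ε ι₀) (s e : S) (x : L) : TangentSpace (cot N) ((F.pt s).ι x) :=
  mfderiv 𝓘(ℝ, S) (cot N) (fun s' => (F.pt s').ι x) s e

/-- The velocity `δφ` at the parameter `s` in the direction `e`. -/
def deltaPhase (F : SmoothFamily S ε ι₀) (s e : S) : ℝ := fderiv ℝ F.phase s e

/-- The velocity of the family at `s` in the direction `e` is the tangent vector `(g, r μ_s) + W` of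
`𝒫`, in the form `δι = X_g ∘ ι`, `δφ = (ϑ(X_g) - g)(ι(p))`, `δμ = r μ_s` (densities on
`Λ = ι(L)` are identified with densities on `L` by means of `ι`). -/
structure Represents (p : L) (F : SmoothFamily S ε ι₀) (s e : S) (g : Cotangent N Q → ℝ)
    (r : L → ℝ) : Prop where
  smooth : Smooth g
  emb : ∀ x, F.deltaEmb s e x = hamField g ((F.pt s).ι x)
  phase : F.deltaPhase s e = liouville ((F.pt s).ι p) (hamField g ((F.pt s).ι p)) - g ((F.pt s).ι p)
  dens : ∀ x, fderiv ℝ (fun s' => F.dens s' x) s e = r x * F.dens s x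

/-- The embedding and the density do not vary outside of `K`. -/
def ConstantOff (F : SmoothFamily S ε ι₀) (K : Set L) : Prop :=
  ∀ s, ∀ x ∉ K, (F.pt s).ι x = (F.pt 0).ι x ∧ F.dens s x = 1

/-- `g s` generates the velocity of the family at `s` in the direction `e`, for all `s`, with the
restriction of `g s` to the Lagrangian submanifold smooth in `s` and supported in `K`. -/
structure Generates (p : L) (F : SmoothFamily S ε ι₀) (K : Set L) (e : S)
    (g : S → Cotangent N Q → ℝ) (r : S → L → ℝ) : Prop where
  represents : ∀ s, F.Represents p s e (g s) (r s)
  smooth : ContMDiff (𝓘(ℝ, S).prod (𝓡 N)) 𝓘(ℝ, ℝ) ∞ (fun q : S × L => g q.1 ((F.pt q.1).ι q.2))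
  supported : ∀ s, ∀ x ∉ K, g s ((F.pt s).ι x) = 0

end SmoothFamily

/-! ### One-forms, differentials and Hamiltonian vector fields on the phase space -/

/-- The total action `p_{φ,t}(ι, μ) = ∫ (ι^*ρ_t) μ`. -/
def totalAction (ρ : ℝ → Cotangent N Q → ℝ) (t : ℝ) (Z : Potentials ε ι₀) : ℝ :=
  ∫ x, ρ t (Z.ι x) ∂Z.μ

/-- The one-form `Θ_t` on `𝒫ₒ`, the pull-back of the one-form `θ_t` on `𝒫`, on a tangent vector
with `δι = X_g ∘ ι`:
`Θ_t(δι, δφ, δμ) = -∫ ι^*(g ρ_t) μ - p_{φ,t} (ϑ_{ι(p)}(δι(p)) - g(ι(p)) - δφ)`. -/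
def Theta (ρ : ℝ → Cotangent N Q → ℝ) (p : L) (t : ℝ) (Z : Potentials ε ι₀)
    (δι : ∀ x, TangentSpace (cot N) (Z.ι x)) (δφ : ℝ) (g : Cotangent N Q → ℝ) : ℝ :=
  -(∫ x, g (Z.ι x) * ρ t (Z.ι x) ∂Z.μ)
    - totalAction ρ t Z * (liouville (Z.ι p) (δι p) - g (Z.ι p) - δφ)

/-- `Θ_t` on the velocity of a family. -/
def SmoothFamily.theta {S : Type} [NormedAddCommGroup S] [NormedSpace ℝ S]
    (F : SmoothFamily S ε ι₀) (ρ : ℝ → Cotangent N Q → ℝ) (p : L) (t : ℝ) (s e : S)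
    (g : Cotangent N Q → ℝ) : ℝ :=
  Theta ρ p t (F.pt s) (F.deltaEmb s e) (F.deltaPhase s e) g

/-- The functional `H` on `𝒫` has at `Z` the differential `dH(Z) = (k μ, P) + V`, i.e.
`δH/δg = k μ` and `δH/δμ = P`: its derivative along every curve with velocity `(g, r μ) + W` is
`∫ ι^*g k μ + ∫ ι^*{P, g} μ + ∫ ι^*P r μ`. For non-compact `L` variations of compact support
are used. -/
def HasDifferential (p : L) (H : PhaseSpace ε ι₀ p → ℝ) (Z : Potentials ε ι₀)
    (k : L → ℝ) (P : Cotangent N Q → ℝ) : Prop :=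
  ∀ (F : SmoothFamily ℝ ε ι₀) (K : Set L) (g : ℝ → Cotangent N Q → ℝ) (r : ℝ → L → ℝ),
    F.pt 0 = Z → IsCompact K → F.ConstantOff K → F.Generates p K 1 g r →
    HasDerivAt (fun u => H (proj p (F.pt u)))
      ((∫ x, g 0 (Z.ι x) * k x ∂Z.μ) + (∫ x, poisson P (g 0) (Z.ι x) ∂Z.μ)
        + ∫ x, P (Z.ι x) * r 0 x ∂Z.μ) 0

/-- The subspace `W` of trivial pairs `(f, L_{X_f} μ)` with `f` zero along `Λ = ι(L)`. (`X_f` is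
then tangent to `Λ`; `Y` is the corresponding vector field on `L`.) -/
def TrivialPair (Z : Potentials ε ι₀) (f : Cotangent N Q → ℝ) (r : L → ℝ) : Prop :=
  Smooth f ∧ (∀ x, f (Z.ι x) = 0) ∧
    ∃ Y : ∀ x : L, TangentSpace (𝓡 N) x, (∀ x, dEmb Z.ι x (Y x) = hamField f (Z.ι x)) ∧
      IsLieDerivative Z.μ Y r

/-- The tangent vectors `(g, r μ) + W` and `(g', r' μ) + W` of `𝒫` are equal. -/
def SameTangent (Z : Potentials ε ι₀) (g : Cotangent N Q → ℝ) (r : L → ℝ)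
    (g' : Cotangent N Q → ℝ) (r' : L → ℝ) : Prop :=
  TrivialPair Z (fun z => g z - g' z) (fun x => r x - r' x)

/-- The tangent vector `X = (g, r μ) + W` at `Z` is the value at `Z` of the time-dependent
Hamiltonian vector field of `H` at time `t`: `i_X dθ_t = -dH_t - θ̇_t`.

The exterior derivative is evaluated through two-parameter families `F(s, u)` with `F(0, 0) = Z`:
`dθ_t(∂_s F, ∂_u F) = ∂_s (θ_t(∂_u F)) - ∂_u (θ_t(∂_s F))`. The variations have compact support
(so that all integrals converge, also when `L` is not compact), `∂_u F` is the vector on which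
the two sides are compared, and `∂_s F` is, at the origin, equal to `X` at least where `∂_u F`
does not vanish; this suffices as the two-form is local. -/
def IsHamiltonianVector (ρ : ℝ → Cotangent N Q → ℝ) (p : L) (H : ℝ → PhaseSpace ε ι₀ p → ℝ)
    (t : ℝ) (Z : Potentials ε ι₀) (g : Cotangent N Q → ℝ) (r : L → ℝ) : Prop :=
  ∀ (F : SmoothFamily (ℝ × ℝ) ε ι₀) (K : Set L)
    (a b : ℝ × ℝ → Cotangent N Q → ℝ) (ra rb : ℝ × ℝ → L → ℝ),
    F.pt 0 = Z → IsCompact K → F.ConstantOff K →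
    F.Generates p K (1, 0) a ra → F.Generates p K (0, 1) b rb →
    (∀ x, (a 0 (Z.ι x) = g (Z.ι x) ∧ hamField (a 0) (Z.ι x) = hamField g (Z.ι x) ∧ ra 0 x = r x) ∨
      (b 0 (Z.ι x) = 0 ∧ hamField (b 0) (Z.ι x) = 0 ∧ rb 0 x = 0)) →
    ∃ dsθ duθ dH dtθ : ℝ,
      HasDerivAt (fun s : ℝ => F.theta ρ p t (s, 0) (0, 1) (b (s, 0))) dsθ 0 ∧
      HasDerivAt (fun u : ℝ => F.theta ρ p t (0, u) (1, 0) (a (0, u))) duθ 0 ∧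
      HasDerivAt (fun u : ℝ => H t (proj p (F.pt (0, u)))) dH 0 ∧
      HasDerivAt (fun τ : ℝ => F.theta ρ p τ 0 (0, 1) (b 0)) dtθ t ∧
      dsθ - duθ = -dH - dtθ

/-! ### The wave equation -/

/-- `ρ_t(z) = ∂D/∂U (z, t, -E_t(z))`, for a symbol `D(z, t, U)`. -/
def rho (D : Cotangent N Q → ℝ → ℝ → ℝ) (E : ℝ → Cotangent N Q → ℝ) (t : ℝ)
    (z : Cotangent N Q) : ℝ :=
  deriv (fun U => D z t U) (-E t z)

/-- The time derivative of a time-dependent function. -/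
def timeDeriv (f : ℝ → Cotangent N Q → ℝ) (t : ℝ) (z : Cotangent N Q) : ℝ :=
  deriv (fun τ => f τ z) t

/-- The energy functional `e_t` on `𝒫`, induced by `ℰ_t(ι, φ, μ) = -∫ ι^*(E_t ρ_t) μ` on `𝒫ₒ`. -/
def energy (E ρ : ℝ → Cotangent N Q → ℝ) (p : L) (t : ℝ) : PhaseSpace ε ι₀ p → ℝ :=
  Quot.lift (fun Z => -∫ x, E t (Z.ι x) * ρ t (Z.ι x) ∂Z.μ) (fun Z Z' h => by
    exact congrArg Neg.neg (integral_gauge_invariant p (fun z => E t z * ρ t z) Z Z' h))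

/-- The curve `F` satisfies the equations of motion for the potentials at the time `t`:
`ι̇ = X_{E_t} ∘ ι`, `φ̇ = (ϑ(X_{E_t}) - E_t)(ι(p))`, `d/dt (ι^*(ρ_t) μ) = 0`. -/
def SatisfiesEquationsAt (E ρ : ℝ → Cotangent N Q → ℝ) (p : L) (F : SmoothFamily ℝ ε ι₀)
    (t : ℝ) : Prop :=
  (∀ x, F.deltaEmb t 1 x = hamField (E t) ((F.pt t).ι x)) ∧
  F.deltaPhase t 1 =
    liouville ((F.pt t).ι p) (hamField (E t) ((F.pt t).ι p)) - E t ((F.pt t).ι p) ∧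
  (∀ x, HasDerivAt (fun τ => ρ τ ((F.pt τ).ι x) * F.dens τ x) 0 t)

end PhaseSpace

end KMW

end

/-!
The tangent vector `X = (g, r μ) + W` is inserted into the defining equation `i_X dθ = -dH - θ̇`,
evaluated on two-parameter families. The first step (`generator_commutation`) is that along such a
family with generators `a` and `b` the restrictions to `Λ` satisfy `∂₁(ι^*b) - ∂₂(ι^*a) = -ι^*{a, b}`:
in charts `ω` is constant, so by closedness of the pulled back form the difference of the two sides is
constant on the connected manifold `L`, and the phases show that it vanishes at the base point `p`.
With this the derivatives of `θ` become integrals over `L` without boundary terms, and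
`hamiltonian_equation_iff` reduces the equation, for a family with `∂₂F = (b, r_b μ) + W`, to the
vanishing of the integral of
`b {ρ, f} - ρ {f, b} - f {ρ, b} + ρ (b d - f r_b)`, where `(f, d μ)` is the difference of `X` and the
asserted solution.

If `(f, d μ)` is a trivial pair, `f` vanishes along `Λ`, its Hamiltonian vector field is tangent to `Λ`
there, and the integrand is `L_Y χ + χ d` with `χ = ι^*(b ρ)`; the integral vanishes by definition of
the Lie derivative of a density. Conversely, variations of the density alone give `f = 0` along `Λ`,
and since `χ` can be any function of small support (`IsLagrangianEmbedding.exists_extension`), a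
partition of unity gives `d μ = L_Y μ`.

The converse needs enough two-parameter families: `g` and `b`, cut off near a point, must be the
generators at the origin of a family of exact symplectic diffeomorphisms. No integration of vector
fields is used. In a chart, `exists_symplecticFamily` takes the canonical transformations with
generating function `S = δ (sin (l₁ / δ) G₁ + sin (l₂ / δ) G₂)` of the old positions and new momenta,
where a small `δ` makes the implicit equations solvable for all parameters `l`. Generators and action
of the family are explicit. Extended by the identity to `T*Q` it preserves the class `[ι^*ϑ]`, so that
it acts on the component `I`.

The statements about the energy follow from differentiation under the integral sign and the product
rule for the conserved action density `ι^*(ρ) μ`.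
-/

noncomputable section

set_option linter.unusedSectionVars false

namespace KMW

/-! ### Canonical coordinates of the cotangent bundle -/

section Canonical
variable {N : ℕ} {Q : Type*} [TopologicalSpace Q] [ChartedSpace (Rn N) Q] [IsManifold (𝓡 N) ∞ Q]

instance instIsManifoldCotangent : IsManifold (cot N) ∞ (Cotangent N Q) := by
  have h0 : IsManifold (𝓡 N) (∞ + 1) Q := by
    simpa using (inferInstance : IsManifold (𝓡 N) ∞ Q)
  have := TangentBundle.contMDiffVectorBundle (n := ∞) (I := 𝓡 N) (M := Q)
  infer_instance

instance instIsManifoldCotangentOne : IsManifold (cot N) 1 (Cotangent N Q) :=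
  IsManifold.of_le (n := ∞) (by exact_mod_cast le_top)

lemma mem_source_cotangent {z₀ z : Cotangent N Q} :
    z ∈ (extChartAt (cot N) z₀).source ↔ z.1 ∈ (extChartAt (𝓡 N) z₀.1).source := by
  simp only [FiberBundle.extChartAt, PartialEquiv.trans_source, PartialEquiv.prod_source,
    mem_inter_iff, mem_preimage, mem_prod]
  rw [hom_trivializationAt_source]
  simp [hom_trivializationAt_apply]

lemma extChartAt_cotangent_fst (z₀ z : Cotangent N Q) :
    (extChartAt (cot N) z₀ z).1 = extChartAt (𝓡 N) z₀.1 z.1 := by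
  rw [FiberBundle.extChartAt]
  simp [hom_trivializationAt_apply]

lemma extChartAt_cotangent_snd_apply {z₀ z : Cotangent N Q}
    (hz : z ∈ (extChartAt (cot N) z₀).source) (w : TangentSpace (𝓡 N) z.1) :
    (extChartAt (cot N) z₀ z).2 (mfderiv (𝓡 N) 𝓘(ℝ, Rn N) (extChartAt (𝓡 N) z₀.1) z.1 w)
      = (z.2 : Rn N →L[ℝ] ℝ) w := by
  have hz1 : z.1 ∈ (chartAt (Rn N) z₀.1).source := by
    simpa using mem_source_cotangent.1 hz
  have : (extChartAt (cot N) z₀ z).2 = ContinuousLinearMap.inCoordinates (Rn N)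
      (fun q : Q => TangentSpace (𝓡 N) q) ℝ (Bundle.Trivial Q ℝ) z₀.1 z.1 z₀.1 z.1 z.2 := by
    rw [FiberBundle.extChartAt]
    simp [hom_trivializationAt_apply]
  have hb : z.1 ∈ (trivializationAt (Rn N) (fun q : Q => TangentSpace (𝓡 N) q) z₀.1).baseSet := by
    simpa using hz1
  have hb' : z.1 ∈ (trivializationAt ℝ (Bundle.Trivial Q ℝ) z₀.1).baseSet := by simp
  rw [this, ContinuousLinearMap.inCoordinates_eq hb hb']
  rw [← TangentBundle.continuousLinearMapAt_trivializationAt hz1]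
  have h2 := ((trivializationAt (Rn N) (TangentSpace (𝓡 N)) z₀.1).continuousLinearEquivAt
    ℝ z.1 hb).symm_apply_apply w
  rw [Bundle.Trivialization.coe_continuousLinearEquivAt_eq] at h2
  exact congrArg (z.2 : Rn N →L[ℝ] ℝ) h2

lemma mfderiv_proj_coord {z₀ z : Cotangent N Q}
    (hz : z ∈ (extChartAt (cot N) z₀).source) (v : TangentSpace (cot N) z) :
    mfderiv (𝓡 N) 𝓘(ℝ, Rn N) (extChartAt (𝓡 N) z₀.1) z.1
      (mfderiv (cot N) (𝓡 N) (fun z' : Cotangent N Q => z'.1) z v)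
      = (mfderiv (cot N) 𝓘(ℝ, PhaseModel N) (extChartAt (cot N) z₀) z v : PhaseModel N).1 := by
  have hz1 : z.1 ∈ (chartAt (Rn N) z₀.1).source := by
    simpa using mem_source_cotangent.1 hz
  have h1 : MDifferentiableAt (cot N) (𝓡 N) (fun z' : Cotangent N Q => z'.1) z :=
    (Bundle.contMDiffAt_proj (n := 1)
      (fun q : Q => TangentSpace (𝓡 N) q →L[ℝ] Bundle.Trivial Q ℝ q)).mdifferentiableAt one_ne_zero
  have h2 : MDifferentiableAt (𝓡 N) 𝓘(ℝ, Rn N) (extChartAt (𝓡 N) z₀.1) z.1 :=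
    mdifferentiableAt_extChartAt hz1
  have h3 : MDifferentiableAt (cot N) 𝓘(ℝ, PhaseModel N) (extChartAt (cot N) z₀) z :=
    mdifferentiableAt_extChartAt (by simpa using hz)
  have h4 : MDifferentiableAt 𝓘(ℝ, PhaseModel N) 𝓘(ℝ, Rn N) (Prod.fst : PhaseModel N → Rn N)
      (extChartAt (cot N) z₀ z) :=
    differentiableAt_fst.mdifferentiableAt
  have e1 := mfderiv_comp_apply z h2 h1 v
  have e2 := mfderiv_comp_apply z h4 h3 v
  have : (extChartAt (𝓡 N) z₀.1) ∘ (fun z' : Cotangent N Q => z'.1)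
      = (Prod.fst : PhaseModel N → Rn N) ∘ (extChartAt (cot N) z₀) := by
    funext z'; exact (extChartAt_cotangent_fst z₀ z').symm
  rw [← e1, this, e2, mfderiv_eq_fderiv, fderiv_fst]
  rfl

/-- The canonical one-form in an arbitrary bundle chart is `p dq`. -/
lemma liouville_eq_coord {z₀ z : Cotangent N Q}
    (hz : z ∈ (extChartAt (cot N) z₀).source) (v : TangentSpace (cot N) z) :
    liouville z v = (extChartAt (cot N) z₀ z).2
      (mfderiv (cot N) 𝓘(ℝ, PhaseModel N) (extChartAt (cot N) z₀) z v : PhaseModel N).1 := by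
  rw [← mfderiv_proj_coord hz, extChartAt_cotangent_snd_apply hz]
  rfl

/-- The standard symplectic form on `ℝᴺ × (ℝᴺ)*`. -/
def stdForm (v w : PhaseModel N) : ℝ := w.2 v.1 - v.2 w.1

lemma liouvilleInChart_eq {z₀ : Cotangent N Q} {y : PhaseModel N}
    (hy : y ∈ (extChartAt (cot N) z₀).target) (w : PhaseModel N) :
    liouvilleInChart z₀ y w = y.2 w.1 := by
  have hs := (extChartAt (cot N) z₀).map_target hy
  have h := liouville_eq_coord hs
    (mfderiv 𝓘(ℝ, PhaseModel N) (cot N) (extChartAt (cot N) z₀).symm y w)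
  have e := mfderiv_extChartAt_comp_mfderivWithin_extChartAt_symm (I := cot N) hy
  rw [ModelWithCorners.Boundaryless.range_eq_univ, mfderivWithin_univ] at e
  have e' := congrArg (fun T => T w) e
  have e'' : mfderiv (cot N) 𝓘(ℝ, PhaseModel N) (extChartAt (cot N) z₀)
      ((extChartAt (cot N) z₀).symm y)
      (mfderiv 𝓘(ℝ, PhaseModel N) (cot N) (extChartAt (cot N) z₀).symm y w) = w := e'
  rw [e'', (extChartAt (cot N) z₀).right_inv hy] at h
  exact h

/-- In the preferred chart at `z` the symplectic form is the standard one. -/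
lemma symplecticForm_self (z : Cotangent N Q) (v w : TangentSpace (cot N) z) :
    symplecticForm z v w = stdForm (v : PhaseModel N) (w : PhaseModel N) := by
  have hev : liouvilleInChart z =ᶠ[𝓝 (extChartAt (cot N) z z)]
      (fun y => ((ContinuousLinearMap.compL ℝ (PhaseModel N) (Rn N) ℝ).flip
        (ContinuousLinearMap.fst ℝ (Rn N) (Rn N →L[ℝ] ℝ))).comp
        (ContinuousLinearMap.snd ℝ (Rn N) (Rn N →L[ℝ] ℝ)) y) := by
    filter_upwards [extChartAt_target_mem_nhds (I := cot N) z] with y hy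
    ext w
    · simp [liouvilleInChart_eq hy]
    · simp [liouvilleInChart_eq hy]
  unfold symplecticForm
  rw [hev.fderiv_eq, ContinuousLinearMap.fderiv]
  exact neg_sub _ _

lemma two_le_infty : (2 : WithTop ℕ∞) ≤ ∞ := 
  WithTop.coe_le_coe.2 (le_top (a := (2 : ℕ∞)))

/-- The pull-back of `ω = -d(p dq)` by `f` is minus the exterior derivative of the pull-back
of `p dq`: the second derivatives of `f` cancel by symmetry. -/
lemma fderiv_pullback_liouville_antisymm {X : Type*} [NormedAddCommGroup X] [NormedSpace ℝ X]
    {f : X → PhaseModel N} {x : X} (hf : ContDiffAt ℝ ∞ f x) (v w : X) :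
    fderiv ℝ (fun x => (f x).2 (fderiv ℝ f x w).1) x v
      - fderiv ℝ (fun x => (f x).2 (fderiv ℝ f x v).1) x w
      = -stdForm (fderiv ℝ f x v) (fderiv ℝ f x w) := by
  have hd : HasFDerivAt f (fderiv ℝ f x) x := (hf.differentiableAt (by simp)).hasFDerivAt
  have hdd : HasFDerivAt (fderiv ℝ f) (fderiv ℝ (fderiv ℝ f) x) x :=
    ((hf.fderiv_right (m := 1) (by norm_num; exact two_le_infty)).differentiableAt
      (by simp)).hasFDerivAt
  have key : ∀ u : X, HasFDerivAt (fun x => (f x).2 (fderiv ℝ f x u).1) _ x := fun u =>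
    hd.snd.clm_apply ((hdd.clm_apply (hasFDerivAt_const u x)).fst)
  rw [(key v).fderiv, (key w).fderiv]
  have hs : IsSymmSndFDerivAt ℝ f x := hf.isSymmSndFDerivAt (by simpa using two_le_infty)
  have := hs v w
  simp [stdForm, this]

/-- Changes of bundle charts are symplectic. -/
lemma symplecticForm_eq_coord {z₀ z : Cotangent N Q}
    (hz : z ∈ (extChartAt (cot N) z₀).source) (v w : TangentSpace (cot N) z) :
    symplecticForm z v w = stdForm
      (mfderiv (cot N) 𝓘(ℝ, PhaseModel N) (extChartAt (cot N) z₀) z v : PhaseModel N)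
      (mfderiv (cot N) 𝓘(ℝ, PhaseModel N) (extChartAt (cot N) z₀) z w : PhaseModel N) := by
  set τ : PhaseModel N → PhaseModel N := extChartAt (cot N) z₀ ∘ (extChartAt (cot N) z).symm
  set y₀ : PhaseModel N := extChartAt (cot N) z z
  have hsm : ContDiffAt ℝ ∞ τ y₀ := by
    have h1 : ContMDiffAt (cot N) 𝓘(ℝ, PhaseModel N) ∞ (extChartAt (cot N) z₀)
        ((extChartAt (cot N) z).symm y₀) := by
      rw [extChartAt_to_inv]
      exact contMDiffAt_extChartAt' (by simpa using hz)
    have h2 : ContMDiffAt 𝓘(ℝ, PhaseModel N) (cot N) ∞ (extChartAt (cot N) z).symm y₀ :=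
      (contMDiffOn_extChartAt_symm z).contMDiffAt (extChartAt_target_mem_nhds z)
    exact (h1.comp y₀ h2).contDiffAt
  have hκ : mfderiv (cot N) 𝓘(ℝ, PhaseModel N) (extChartAt (cot N) z₀) z = fderiv ℝ τ y₀ := by
    have h3 : MDifferentiableAt (cot N) 𝓘(ℝ, PhaseModel N) (extChartAt (cot N) z₀) z :=
      mdifferentiableAt_extChartAt (by simpa using hz)
    refine h3.mfderiv.trans ?_
    rw [ModelWithCorners.Boundaryless.range_eq_univ, fderivWithin_univ]
    rfl
  have hev : ∀ u : PhaseModel N,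
      (fun y => (τ y).2 (fderiv ℝ τ y u).1) =ᶠ[𝓝 y₀] (fun y => y.2 u.1) := by
    intro u
    have hc : ∀ᶠ y in 𝓝 y₀, (extChartAt (cot N) z).symm y ∈ (extChartAt (cot N) z₀).source := by
      apply (continuousAt_extChartAt_symm z).preimage_mem_nhds
      rw [extChartAt_to_inv]
      exact (isOpen_extChartAt_source z₀).mem_nhds hz
    filter_upwards [hc, extChartAt_target_mem_nhds (I := cot N) z] with y hy1 hy2
    rw [← liouvilleInChart_eq hy2 u]
    have h1 : MDifferentiableAt (cot N) 𝓘(ℝ, PhaseModel N) (extChartAt (cot N) z₀)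
        ((extChartAt (cot N) z).symm y) := mdifferentiableAt_extChartAt (by simpa using hy1)
    have h2 : MDifferentiableAt 𝓘(ℝ, PhaseModel N) (cot N) (extChartAt (cot N) z).symm y :=
      ((contMDiffOn_extChartAt_symm (n := 1) z).contMDiffAt
        ((isOpen_extChartAt_target z).mem_nhds hy2)).mdifferentiableAt one_ne_zero
    have e := mfderiv_comp_apply y h1 h2 u
    have e2 : fderiv ℝ τ y u = (mfderiv (cot N) 𝓘(ℝ, PhaseModel N) (extChartAt (cot N) z₀)
        ((extChartAt (cot N) z).symm y)
        (mfderiv 𝓘(ℝ, PhaseModel N) (cot N) (extChartAt (cot N) z).symm y u) : PhaseModel N) := by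
      rw [← mfderiv_eq_fderiv]; exact e
    rw [e2]
    exact (liouville_eq_coord hy1 _).symm
  have main : ∀ v w : PhaseModel N, stdForm v w = stdForm (fderiv ℝ τ y₀ v) (fderiv ℝ τ y₀ w) := by
    intro v w
    have e1 := fderiv_pullback_liouville_antisymm hsm v w
    rw [(hev w).fderiv_eq, (hev v).fderiv_eq] at e1
    have e2 := fderiv_pullback_liouville_antisymm (f := id) (contDiffAt_id (x := y₀)) v w
    simp only [fderiv_id] at e2
    exact neg_injective (e2.symm.trans e1)
  rw [symplecticForm_self, hκ]
  exact main v w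

end Canonical

/-! ### Hamiltonian vector fields and Poisson brackets in coordinates -/

section StdForm
variable {N : ℕ}

/-- The isomorphism `(ℝᴺ × (ℝᴺ)*)* → ℝᴺ × (ℝᴺ)*` given by the standard symplectic form: it sends
`df` to the components `(∂f/∂p, -∂f/∂q)` of the Hamiltonian vector field. -/
def stdHam : (PhaseModel N →L[ℝ] ℝ) →L[ℝ] PhaseModel N :=
  ((EuclideanSpace.equiv (Fin N) ℝ).symm.toContinuousLinearMap.comp
    (ContinuousLinearMap.pi fun i => ContinuousLinearMap.apply ℝ ℝ
      ((0, EuclideanSpace.proj i) : PhaseModel N))).prod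
    (-((ContinuousLinearMap.compL ℝ (Rn N) (PhaseModel N) ℝ).flip
      (ContinuousLinearMap.inl ℝ (Rn N) (Rn N →L[ℝ] ℝ))))

lemma stdHam_snd_apply (α : PhaseModel N →L[ℝ] ℝ) (x : Rn N) : (stdHam α).2 x = -α (x, 0) := by
  simp [stdHam]
  rfl

lemma apply_stdHam_fst (α : PhaseModel N →L[ℝ] ℝ) (l : Rn N →L[ℝ] ℝ) :
    l (stdHam α).1 = α (0, l) := by
  have h1 : (stdHam α).1 = ∑ i, α (0, EuclideanSpace.proj i) • EuclideanSpace.single i (1 : ℝ) := by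
    ext j
    simp [stdHam, Pi.single_apply]
  have h2 : l = ∑ i,
      l (EuclideanSpace.single i (1 : ℝ)) • (EuclideanSpace.proj i : Rn N →L[ℝ] ℝ) := by
    ext x
    conv_lhs => rw [← (EuclideanSpace.basisFun (Fin N) ℝ).sum_repr x]
    simp [mul_comm]
  have h3 : ((0 : Rn N), l) = ∑ i, l (EuclideanSpace.single i (1 : ℝ)) •
      (((0 : Rn N), (EuclideanSpace.proj i : Rn N →L[ℝ] ℝ))) := by
    ext1
    · simp [Prod.fst_sum]
    · rw [Prod.snd_sum]; simpa using h2
  rw [h1, h3, map_sum, map_sum]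
  refine Finset.sum_congr rfl fun i _ => ?_
  rw [map_smul, map_smul, smul_eq_mul, smul_eq_mul, mul_comm]

lemma stdForm_stdHam (α : PhaseModel N →L[ℝ] ℝ) (w : PhaseModel N) :
    stdForm (stdHam α) w = α w := by
  rw [stdForm, apply_stdHam_fst, stdHam_snd_apply, sub_neg_eq_add, ← map_add]
  simp

lemma stdForm_antisymm (v w : PhaseModel N) : stdForm v w = -stdForm w v := by
  simp [stdForm]

lemma stdForm_sub_left (u v w : PhaseModel N) :
    stdForm (u - v) w = stdForm u w - stdForm v w := by
  simp [stdForm]; ring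

lemma eq_zero_of_stdForm {v : PhaseModel N} (h : ∀ w, stdForm v w = 0) : v = 0 := by
  ext1
  · ext i
    simpa [stdForm] using h (0, EuclideanSpace.proj i)
  · ext x
    simpa [stdForm] using h (x, 0)

lemma eq_stdHam {v : PhaseModel N} {α : PhaseModel N →L[ℝ] ℝ} (h : ∀ w, stdForm v w = α w) :
    v = stdHam α :=
  sub_eq_zero.1 (eq_zero_of_stdForm fun w => by rw [stdForm_sub_left, h, stdForm_stdHam, sub_self])

/-- An isotropic subspace of dimension `N` is its own symplectic complement. -/
lemma mem_range_of_isotropic (A : Rn N →L[ℝ] PhaseModel N) (hA : Function.Injective A)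
    (hiso : ∀ v w, stdForm (A v) (A w) = 0) {v : PhaseModel N} (hv : ∀ w, stdForm v (A w) = 0) :
    ∃ y, A y = v := by
  let B : PhaseModel N →ₗ[ℝ] (Rn N →ₗ[ℝ] ℝ) := LinearMap.mk₂ ℝ (fun v w => stdForm v (A w))
    (fun a b c => by simp [stdForm]; ring) (fun a b c => by simp [stdForm]; ring)
    (fun a b c => by simp [stdForm]; ring) (fun a b c => by simp [stdForm]; ring)
  have hsurj : LinearMap.range B = ⊤ := by
    rw [LinearMap.range_eq_top]
    intro l
    obtain ⟨A', hA'⟩ := (A : Rn N →ₗ[ℝ] PhaseModel N).exists_leftInverse_of_injective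
      (LinearMap.ker_eq_bot.2 hA)
    refine ⟨stdHam (LinearMap.toContinuousLinearMap (l ∘ₗ A')), ?_⟩
    ext1 w
    have : A' (A w) = w := congrArg (fun T => T w) hA'
    simp only [B, LinearMap.mk₂_apply, stdForm_stdHam]
    simp [this]
  have hle : LinearMap.range (A : Rn N →ₗ[ℝ] PhaseModel N) ≤ LinearMap.ker B := by
    rintro _ ⟨y, rfl⟩
    rw [LinearMap.mem_ker]
    ext1 w
    exact hiso y w
  have h1 := LinearMap.finrank_range_add_finrank_ker B
  rw [hsurj, finrank_top] at h1
  have h2 : Module.finrank ℝ (LinearMap.range (A : Rn N →ₗ[ℝ] PhaseModel N)) = N := by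
    rw [LinearMap.finrank_range_of_inj hA]; simp
  have h3 : Module.finrank ℝ (Rn N →ₗ[ℝ] ℝ) = N := by
    rw [Module.finrank_linearMap]; simp
  have h4 : Module.finrank ℝ (PhaseModel N) = N + N := by
    rw [Module.finrank_prod, ← LinearMap.toContinuousLinearMap.finrank_eq, h3]; simp
  have h5 := Submodule.eq_of_le_of_finrank_eq hle (by rw [h2]; omega)
  have h6 : v ∈ LinearMap.ker B := by
    rw [LinearMap.mem_ker]; ext1 w; exact hv w
  rw [← h5] at h6
  exact h6
end StdForm

section HamField
variable {N : ℕ} {Q : Type*} [TopologicalSpace Q] [ChartedSpace (Rn N) Q] [IsManifold (𝓡 N) ∞ Q]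

lemma symplecticForm_antisymm (z : Cotangent N Q) (v w : TangentSpace (cot N) z) :
    symplecticForm z v w = -symplecticForm z w v := by
  rw [symplecticForm_self, symplecticForm_self]
  exact stdForm_antisymm _ _

/-- The differential `df_z` as a linear form in the components of the preferred chart at `z`. -/
def dfunLin (f : Cotangent N Q → ℝ) (z : Cotangent N Q) : PhaseModel N →L[ℝ] ℝ :=
  mfderiv (cot N) 𝓘(ℝ, ℝ) f z

lemma hamField_eq_of {f : Cotangent N Q → ℝ} {z : Cotangent N Q} {v : TangentSpace (cot N) z}
    (h : ∀ w, symplecticForm z v w = dfun f z w) : v = stdHam (dfunLin f z) := by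
  refine eq_stdHam fun w => ?_
  exact (symplecticForm_self z v w).symm.trans (h w)

lemma symplecticForm_hamField (f : Cotangent N Q → ℝ) (z : Cotangent N Q)
    (w : TangentSpace (cot N) z) : symplecticForm z (hamField f z) w = dfun f z w := by
  have hex : ∃ v : TangentSpace (cot N) z, ∀ w, symplecticForm z v w = dfun f z w :=
    ⟨(stdHam (dfunLin f z) : PhaseModel N), fun w =>
      (symplecticForm_self z _ w).trans (stdForm_stdHam _ _)⟩
  exact Classical.epsilon_spec hex w

lemma hamField_eq (f : Cotangent N Q → ℝ) (z : Cotangent N Q) :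
    hamField f z = (stdHam (dfunLin f z) : PhaseModel N) :=
  hamField_eq_of (symplecticForm_hamField f z)

lemma poisson_antisymm (f g : Cotangent N Q → ℝ) (z : Cotangent N Q) :
    poisson f g z = -poisson g f z := by
  rw [poisson, poisson, ← symplecticForm_hamField, ← symplecticForm_hamField,
    symplecticForm_antisymm]

lemma Smooth.mdifferentiableAt {f : Cotangent N Q → ℝ} (hf : Smooth f) (z : Cotangent N Q) :
    MDifferentiableAt (cot N) 𝓘(ℝ, ℝ) f z :=
  hf.mdifferentiable (by simp) z

lemma poisson_eq (f g : Cotangent N Q → ℝ) (z : Cotangent N Q) :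
    poisson f g z = dfunLin f z (stdHam (dfunLin g z)) := by
  rw [poisson, hamField_eq]; rfl

lemma dfunLin_sub {f g : Cotangent N Q → ℝ} (hf : Smooth f) (hg : Smooth g) (z : Cotangent N Q) :
    dfunLin (fun z => f z - g z) z = dfunLin f z - dfunLin g z :=
  ((hf.mdifferentiableAt z).hasMFDerivAt.sub (hg.mdifferentiableAt z).hasMFDerivAt).mfderiv

lemma dfunLin_neg (f : Cotangent N Q → ℝ) (z : Cotangent N Q) :
    dfunLin (fun z => -f z) z = -dfunLin f z :=
  mfderiv_neg

lemma dfunLin_mul {f g : Cotangent N Q → ℝ} (hf : Smooth f) (hg : Smooth g) (z : Cotangent N Q) :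
    dfunLin (fun z => f z * g z) z = f z • dfunLin g z + g z • dfunLin f z := by
  have := ((hf.mdifferentiableAt z).hasMFDerivAt.mul (hg.mdifferentiableAt z).hasMFDerivAt).mfderiv
  exact this

/-- The differential in the coordinates of an arbitrary bundle chart. -/
lemma dfun_eq_coord {f : Cotangent N Q → ℝ} {z₀ z : Cotangent N Q}
    (hz : z ∈ (extChartAt (cot N) z₀).source) (hf : ContMDiffAt (cot N) 𝓘(ℝ, ℝ) ∞ f z)
    (v : TangentSpace (cot N) z) :
    dfun f z v = fderiv ℝ (f ∘ (extChartAt (cot N) z₀).symm) (extChartAt (cot N) z₀ z)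
      (mfderiv (cot N) 𝓘(ℝ, PhaseModel N) (extChartAt (cot N) z₀) z v : PhaseModel N) := by
  have h1 : MDifferentiableAt (cot N) 𝓘(ℝ, PhaseModel N) (extChartAt (cot N) z₀) z :=
    mdifferentiableAt_extChartAt (by simpa using hz)
  have h2 : MDifferentiableAt 𝓘(ℝ, PhaseModel N) 𝓘(ℝ, ℝ) (f ∘ (extChartAt (cot N) z₀).symm)
      (extChartAt (cot N) z₀ z) := by
    have h3 : ContMDiffAt 𝓘(ℝ, PhaseModel N) (cot N) ∞ (extChartAt (cot N) z₀).symm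
        (extChartAt (cot N) z₀ z) := (contMDiffOn_extChartAt_symm z₀).contMDiffAt
        ((isOpen_extChartAt_target z₀).mem_nhds ((extChartAt (cot N) z₀).map_source hz))
    have h4 : ContMDiffAt (cot N) 𝓘(ℝ, ℝ) ∞ f
      ((extChartAt (cot N) z₀).symm (extChartAt (cot N) z₀ z)) := by
      rwa [(extChartAt (cot N) z₀).left_inv hz]
    exact (h4.comp _ h3).mdifferentiableAt (by simp)
  have e := mfderiv_comp_apply z h2 h1 v
  have e3 : (f ∘ (extChartAt (cot N) z₀).symm) ∘ (extChartAt (cot N) z₀) =ᶠ[𝓝 z] f := by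
    filter_upwards [(isOpen_extChartAt_source z₀).mem_nhds hz] with z' hz'
    simp only [Function.comp_apply]
    rw [(extChartAt (cot N) z₀).left_inv hz']
  rw [e3.mfderiv_eq, mfderiv_eq_fderiv] at e
  exact e

/-- The Hamiltonian vector field in the coordinates of an arbitrary bundle chart. -/
lemma hamField_eq_coord {f : Cotangent N Q → ℝ} {z₀ z : Cotangent N Q}
    (hz : z ∈ (extChartAt (cot N) z₀).source) (hf : ContMDiffAt (cot N) 𝓘(ℝ, ℝ) ∞ f z) :
    (mfderiv (cot N) 𝓘(ℝ, PhaseModel N) (extChartAt (cot N) z₀) z (hamField f z) : PhaseModel N)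
      = stdHam (fderiv ℝ (f ∘ (extChartAt (cot N) z₀).symm) (extChartAt (cot N) z₀ z)) := by
  refine eq_stdHam fun w => ?_
  obtain ⟨v, hv⟩ := (isInvertible_mfderiv_extChartAt (I := cot N) hz).bijective.2 w
  rw [← hv]
  exact (symplecticForm_eq_coord hz _ _).symm.trans
    ((symplecticForm_hamField f z v).trans (dfun_eq_coord hz hf v))

lemma poisson_eq_coord {f g : Cotangent N Q → ℝ} {z₀ z : Cotangent N Q}
    (hz : z ∈ (extChartAt (cot N) z₀).source) (hf : ContMDiffAt (cot N) 𝓘(ℝ, ℝ) ∞ f z)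
    (hg : ContMDiffAt (cot N) 𝓘(ℝ, ℝ) ∞ g z) :
    poisson f g z = fderiv ℝ (f ∘ (extChartAt (cot N) z₀).symm) (extChartAt (cot N) z₀ z)
      (stdHam (fderiv ℝ (g ∘ (extChartAt (cot N) z₀).symm) (extChartAt (cot N) z₀ z))) := by
  rw [poisson, dfun_eq_coord hz hf, hamField_eq_coord hz hg]

lemma Smooth.comp_extChartAt_symm {f : Cotangent N Q → ℝ} (hf : Smooth f) (z₀ : Cotangent N Q) :
    ContDiffOn ℝ ∞ (f ∘ (extChartAt (cot N) z₀).symm) (extChartAt (cot N) z₀).target :=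
  (hf.comp_contMDiffOn (contMDiffOn_extChartAt_symm z₀)).contDiffOn

lemma Smooth.poisson {f g : Cotangent N Q → ℝ} (hf : Smooth f) (hg : Smooth g) :
    Smooth (poisson f g) := by
  intro z₀
  have ho := isOpen_extChartAt_target (I := cot N) z₀
  have h1 : ContDiffOn ℝ ∞ (fun y => fderiv ℝ (f ∘ (extChartAt (cot N) z₀).symm) y
      (stdHam (fderiv ℝ (g ∘ (extChartAt (cot N) z₀).symm) y))) (extChartAt (cot N) z₀).target :=
    ((hf.comp_extChartAt_symm z₀).fderiv_of_isOpen ho (by simp)).clm_apply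
      (stdHam.contDiff.comp_contDiffOn ((hg.comp_extChartAt_symm z₀).fderiv_of_isOpen ho (by simp)))
  have h2 : ContMDiffAt (cot N) 𝓘(ℝ, ℝ) ∞ ((fun y => fderiv ℝ (f ∘ (extChartAt (cot N) z₀).symm) y
      (stdHam (fderiv ℝ (g ∘ (extChartAt (cot N) z₀).symm) y))) ∘ extChartAt (cot N) z₀) z₀ :=
    ContMDiffAt.comp z₀ ((h1.contDiffAt (ho.mem_nhds (mem_extChartAt_target z₀))).contMDiffAt)
      contMDiffAt_extChartAt
  refine h2.congr_of_eventuallyEq ?_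
  filter_upwards [extChartAt_source_mem_nhds (I := cot N) z₀] with z hz
  exact poisson_eq_coord hz hf.contMDiffAt hg.contMDiffAt

end HamField

/-! ### Dependence on parameters, integrals and densities -/

section Parametric
variable {S : Type*} [NormedAddCommGroup S] [NormedSpace ℝ S]
  {V : Type*} [NormedAddCommGroup V] [NormedSpace ℝ V]
  {E : Type*} [NormedAddCommGroup E] [NormedSpace ℝ E] {H : Type*} [TopologicalSpace H]
  {I : ModelWithCorners ℝ E H}
  {M : Type*} [TopologicalSpace M] [ChartedSpace H M] [IsManifold I ∞ M]

lemma contMDiff_fderiv_param {f : S → M → V}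
    (hf : ContMDiff (𝓘(ℝ, S).prod I) 𝓘(ℝ, V) ∞ (fun q : S × M => f q.1 q.2)) :
    ContMDiff (𝓘(ℝ, S).prod I) 𝓘(ℝ, S →L[ℝ] V) ∞
      (fun q : S × M => fderiv ℝ (fun s => f s q.2) q.1) := by
  intro q
  have : IsManifold I 1 M := IsManifold.of_le (n := ∞) (by exact_mod_cast le_top)
  have h1 : ContMDiff ((𝓘(ℝ, S).prod I).prod 𝓘(ℝ, S)) 𝓘(ℝ, V) ∞
      (Function.uncurry fun (q : S × M) (s : S) => f s q.2) :=
    hf.comp (contMDiff_snd.prodMk (contMDiff_snd.comp contMDiff_fst))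
  have h := ContMDiffAt.mfderiv (m := ∞) (n := ∞) (fun (q : S × M) (s : S) => f s q.2) Prod.fst
    h1.contMDiffAt (contMDiff_fst.contMDiffAt (x := q)) (by simp)
  refine h.congr_of_eventuallyEq (.of_forall fun q' => ?_)
  have e := congrFun (inTangentCoordinates_model_space (I := 𝓘(ℝ, S))
    (I' := 𝓘(ℝ, V)) (Prod.fst : S × M → S)
    (fun q : S × M => f q.1 q.2) (fun q : S × M => fderiv ℝ (fun s => f s q.2) q.1) q) q'
  simp only [mfderiv_eq_fderiv]
  exact e.symm

omit [IsManifold I ∞ M] in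
lemma contDiff_param {f : S → M → V}
    (hf : ContMDiff (𝓘(ℝ, S).prod I) 𝓘(ℝ, V) ∞ (fun q : S × M => f q.1 q.2)) (x : M) :
    ContDiff ℝ ∞ (fun s => f s x) :=
  (hf.comp (contMDiff_id.prodMk contMDiff_const) : ContMDiff _ _ _ (fun s : S => f s x)).contDiff

omit [IsManifold I ∞ M] in
lemma contMDiff_param {f : S → M → V}
    (hf : ContMDiff (𝓘(ℝ, S).prod I) 𝓘(ℝ, V) ∞ (fun q : S × M => f q.1 q.2)) (s : S) :
    ContMDiff I 𝓘(ℝ, V) ∞ (f s) :=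
  hf.comp (contMDiff_const.prodMk contMDiff_id)

end Parametric

section Integral
variable {X : Type*} [TopologicalSpace X] [MeasurableSpace X] [OpensMeasurableSpace X]
   {μ : Measure X} [IsFiniteMeasureOnCompacts μ]

/-- Differentiation under the integral sign for an integrand that is independent of the parameter
off a compact set. -/
lemma hasDerivAt_integral_of_compact [T2Space X] {f f' : ℝ → X → ℝ} {K : Set X}
    (hK : IsCompact K) (t₀ : ℝ)
    (hc : ∀ t, Continuous (f t)) (hf : ∀ t x, HasDerivAt (fun t => f t x) (f' t x) t)
    (hf' : Continuous fun q : ℝ × X => f' q.1 q.2) (hoff : ∀ t, ∀ x ∉ K, f t x = f t₀ x)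
    (hint : Integrable (f t₀) μ) :
    Integrable (f' t₀) μ ∧ HasDerivAt (fun t => ∫ x, f t x ∂μ) (∫ x, f' t₀ x ∂μ) t₀ := by
  obtain ⟨C, hC⟩ :=
    ((isCompact_Icc (a := t₀ - 1) (b := t₀ + 1)).prod hK).exists_bound_of_continuousOn
    hf'.continuousOn
  have hz : ∀ t, ∀ x ∉ K, f' t x = 0 := by
    intro t x hx
    have h1 : (fun t => f t x) = fun _ => f t₀ x := funext fun t => hoff t x hx
    have h2 := hf t x
    rw [h1] at h2
    exact h2.unique (hasDerivAt_const _ _)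
  have hb : Integrable (K.indicator fun _ => C) μ :=
    (integrable_indicator_iff hK.measurableSet).2 (integrableOn_const hK.measure_lt_top.ne)
  refine hasDerivAt_integral_of_dominated_loc_of_deriv_le (Icc_mem_nhds (by linarith : t₀ - 1 < t₀)
    (by linarith : t₀ < t₀ + 1)) (.of_forall fun t => (hc t).aestronglyMeasurable) hint
    ((hf'.comp (Continuous.prodMk_right t₀)).aestronglyMeasurable)
    (.of_forall fun x t ht => ?_) hb (.of_forall fun x t _ => hf t x)
  by_cases hx : x ∈ K
  · rw [indicator_of_mem hx]
    exact hC (t, x) ⟨ht, hx⟩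
  · rw [indicator_of_notMem hx, hz t x hx, norm_zero]

lemma integrable_of_continuous_of_compact [T2Space X] {f : X → ℝ} {K : Set X}
    (hK : IsCompact K) (hc : Continuous f)
    (hoff : ∀ x ∉ K, f x = 0) : Integrable f μ :=
  hc.integrable_of_hasCompactSupport (HasCompactSupport.intro hK hoff)
end Integral

section Density
variable {N : ℕ} {L : Type*} [TopologicalSpace L] [ChartedSpace (Rn N) L]
  [MeasurableSpace L] [BorelSpace L]

/-- A positive smooth density charges every non-empty open set. -/
lemma IsPositiveDensity.isOpenPosMeasure {μ : Measure L} (h : IsPositiveDensity N μ) :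
    μ.IsOpenPosMeasure := by
  refine ⟨fun U hU ⟨x, hx⟩ h0 => ?_⟩
  obtain ⟨m, hm1, hm2, hm3⟩ := h x
  set e := extChartAt (𝓡 N) x
  have ho : IsOpen e.source := isOpen_extChartAt_source x
  have hto : IsOpen e.target := isOpen_extChartAt_target x
  have hV : IsOpen (e.target ∩ e.symm ⁻¹' U) :=
    (continuousOn_extChartAt_symm x).isOpen_inter_preimage hto hU
  have hxV : e x ∈ e.target ∩ e.symm ⁻¹' U :=
    ⟨mem_extChartAt_target x, by simpa [e] using hx⟩
  have hme : AEMeasurable e (μ.restrict e.source) :=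
    (continuousOn_extChartAt x).aemeasurable ho.measurableSet
  have h1 : ((μ.restrict e.source).map e) (e.target ∩ e.symm ⁻¹' U) = 0 := by
    rw [Measure.map_apply_of_aemeasurable hme hV.measurableSet]
    rw [Measure.restrict_apply' ho.measurableSet]
    refine measure_mono_null ?_ h0
    rintro y ⟨⟨-, hy⟩, hys⟩
    have : e.symm (e y) ∈ U := hy
    rwa [e.left_inv hys] at this
  rw [hm3, withDensity_apply _ hV.measurableSet, Measure.restrict_restrict hV.measurableSet,
    inter_assoc, inter_comm (e.symm ⁻¹' U), ← inter_assoc, inter_self] at h1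
  rw [setLIntegral_eq_zero_iff' hV.measurableSet] at h1
  · have h2 : volume (e.target ∩ e.symm ⁻¹' U) = 0 := by
      refine measure_mono_null ?_ (ae_iff.1 h1)
      intro y hy
      simp only [mem_ofPred_eq, not_forall]
      exact ⟨hy, by simpa using hm2 y hy.1⟩
    exact (hV.measure_pos volume ⟨_, hxV⟩).ne' h2
  · exact (ENNReal.measurable_ofReal.comp_aemeasurable
      ((hm1.continuousOn.mono inter_subset_left).aemeasurable hV.measurableSet))

variable [IsManifold (𝓡 N) ∞ L]

/-- Multiplying a positive smooth density by a positive smooth function. -/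
lemma IsPositiveDensity.withDensity {μ : Measure L} [IsFiniteMeasure μ]
    (h : IsPositiveDensity N μ) {d : L → ℝ}
    (hd : ContMDiff (𝓡 N) 𝓘(ℝ, ℝ) ∞ d) (hpos : ∀ x, 0 < d x) :
    IsPositiveDensity N (μ.withDensity fun x => ENNReal.ofReal (d x)) := by
  intro c
  obtain ⟨m, hm1, hm2, hm3⟩ := h c
  set e := extChartAt (𝓡 N) c
  have ho : IsOpen e.source := isOpen_extChartAt_source c
  have hto : IsOpen e.target := isOpen_extChartAt_target c
  have hde : ContDiffOn ℝ ∞ (d ∘ e.symm) e.target :=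
    (hd.comp_contMDiffOn (contMDiffOn_extChartAt_symm c)).contDiffOn
  have hme : AEMeasurable e (μ.restrict e.source) :=
    (continuousOn_extChartAt c).aemeasurable ho.measurableSet
  refine ⟨fun y => m y * d (e.symm y), hm1.mul hde, fun y hy => mul_pos (hm2 y hy) (hpos _), ?_⟩
  have hmm : AEMeasurable (fun y => ENNReal.ofReal (m y)) (volume.restrict e.target) :=
    ENNReal.measurable_ofReal.comp_aemeasurable (hm1.continuousOn.aemeasurable hto.measurableSet)
  have hmd : AEMeasurable (fun y => ENNReal.ofReal (d (e.symm y))) (volume.restrict e.target) :=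
    ENNReal.measurable_ofReal.comp_aemeasurable (hde.continuousOn.aemeasurable hto.measurableSet)
  have h1 : (volume.restrict e.target).withDensity (fun y => ENNReal.ofReal (m y * d (e.symm y)))
      = ((volume.restrict e.target).withDensity (fun y => ENNReal.ofReal (m y))).withDensity
        (fun y => ENNReal.ofReal (d (e.symm y))) := by
    rw [← withDensity_mul₀ hmm hmd]
    refine withDensity_congr_ae ?_
    filter_upwards [ae_restrict_mem hto.measurableSet] with y hy
    simp [ENNReal.ofReal_mul (hm2 y hy).le]
  rw [h1, ← hm3, restrict_withDensity ho.measurableSet]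
  ext A hA
  have hmd' : AEMeasurable (fun y => ENNReal.ofReal (d (e.symm y)))
      ((μ.restrict e.source).map e) := by
    rw [hm3]
    exact hmd.mono_ac (withDensity_absolutelyContinuous _ _)
  rw [Measure.map_apply_of_aemeasurable (hme.mono_ac (withDensity_absolutelyContinuous _ _)) hA,
    withDensity_apply', withDensity_apply _ hA, Measure.restrict_map_of_aemeasurable hme hA,
    lintegral_map' (hmd'.mono_measure ?_) hme.restrict]
  · refine lintegral_congr_ae (ae_restrict_of_ae ?_)
    filter_upwards [ae_restrict_mem ho.measurableSet] with x hx
    rw [e.left_inv hx]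
  · rw [← Measure.restrict_map_of_aemeasurable hme hA]
    exact Measure.restrict_le_self

end Density

/-! ### Smooth families of potentials -/

section Family
variable {N : ℕ} {Q : Type*} [TopologicalSpace Q] [ChartedSpace (Rn N) Q] [IsManifold (𝓡 N) ∞ Q]
  {L : Type*} [TopologicalSpace L] [ChartedSpace (Rn N) L] [IsManifold (𝓡 N) ∞ L]
  [MeasurableSpace L] [BorelSpace L] {ε : ℝ} {ι₀ : L → Cotangent N Q}

instance (Z : Potentials ε ι₀) : IsFiniteMeasure Z.μ := Z.finite

instance (Z : Potentials ε ι₀) : Z.μ.IsOpenPosMeasure := Z.density.isOpenPosMeasure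

namespace SmoothFamily
variable {S : Type} [NormedAddCommGroup S] [NormedSpace ℝ S] (F : SmoothFamily S ε ι₀)

lemma dens_contMDiff (s : S) : ContMDiff (𝓡 N) 𝓘(ℝ, ℝ) ∞ (F.dens s) :=
  contMDiff_param F.smooth_dens s

lemma dens_contDiff (x : L) : ContDiff ℝ ∞ (fun s => F.dens s x) :=
  contDiff_param F.smooth_dens x

lemma dens_zero (x : L) : F.dens 0 x = 1 := by
  have hm : Measurable fun x => ENNReal.ofReal (F.dens 0 x) :=
    (F.dens_contMDiff 0).continuous.measurable.ennreal_ofReal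
  have h : (F.pt 0).μ.withDensity 1
      = (F.pt 0).μ.withDensity (fun x => ENNReal.ofReal (F.dens 0 x)) := by
    rw [withDensity_one]; exact F.dens_spec 0
  have h := (withDensity_eq_iff (f := 1) aemeasurable_const hm.aemeasurable (by simp)).1 h
  have h2 : F.dens 0 =ᵐ[(F.pt 0).μ] fun _ => 1 := by
    filter_upwards [h] with x hx
    exact (ENNReal.ofReal_eq_one.1 hx.symm)
  exact congrFun (((F.dens_contMDiff 0).continuous.ae_eq_iff_eq _ continuous_const).1 h2) x

lemma integral_pt (s : S) (h : L → ℝ) :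
    ∫ x, h x ∂(F.pt s).μ = ∫ x, h x * F.dens s x ∂(F.pt 0).μ := by
  rw [F.dens_spec s, integral_withDensity_eq_integral_toReal_smul
    (F.dens_contMDiff s).continuous.measurable.ennreal_ofReal (by simp)]
  refine integral_congr_ae (.of_forall fun x => ?_)
  simp [ENNReal.toReal_ofReal (F.dens_pos s x).le, mul_comm]

lemma mdifferentiableAt_emb (s : S) (x : L) :
    MDifferentiableAt 𝓘(ℝ, S) (cot N) (fun s' => (F.pt s').ι x) s :=
  (F.smooth_emb.comp (contMDiff_id.prodMk contMDiff_const) :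
    ContMDiff 𝓘(ℝ, S) (cot N) ∞ (fun s => (F.pt s).ι x)).mdifferentiable (by simp) s

lemma emb_contMDiff (s : S) : ContMDiff (𝓡 N) (cot N) ∞ (F.pt s).ι :=
  F.smooth_emb.comp (contMDiff_const.prodMk contMDiff_id)

lemma comp_contMDiff {h : Cotangent N Q → ℝ} (hh : Smooth h) :
    ContMDiff (𝓘(ℝ, S).prod (𝓡 N)) 𝓘(ℝ, ℝ) ∞ (fun q : S × L => h ((F.pt q.1).ι q.2)) :=
  hh.comp F.smooth_emb

lemma fderiv_comp_emb {h : Cotangent N Q → ℝ} (hh : Smooth h) (s e : S) (x : L) :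
    fderiv ℝ (fun s => h ((F.pt s).ι x)) s e = dfun h ((F.pt s).ι x) (F.deltaEmb s e x) := by
  have := mfderiv_comp_apply s (hh.mdifferentiableAt ((F.pt s).ι x)) (F.mdifferentiableAt_emb s x) e
  rw [mfderiv_eq_fderiv] at this
  exact this

variable {F}

lemma Represents.fderiv_comp {p : L} {s e : S} {g : Cotangent N Q → ℝ} {r : L → ℝ}
    (hF : F.Represents p s e g r) {h : Cotangent N Q → ℝ} (hh : Smooth h) (x : L) :
    fderiv ℝ (fun s => h ((F.pt s).ι x)) s e = poisson h g ((F.pt s).ι x) := by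
  rw [F.fderiv_comp_emb hh, hF.emb x]; rfl

lemma Represents.theta_eq {p : L} {s e : S} {g : Cotangent N Q → ℝ} {r : L → ℝ}
    (hF : F.Represents p s e g r) (ρ : ℝ → Cotangent N Q → ℝ) (t : ℝ) :
    F.theta ρ p t s e g
      = -∫ x, g ((F.pt s).ι x) * ρ t ((F.pt s).ι x) * F.dens s x ∂(F.pt 0).μ := by
  rw [theta, Theta, hF.phase, hF.emb p, F.integral_pt s]
  ring

lemma Represents.dens_eq {p : L} {s e : S} {g : Cotangent N Q → ℝ} {r : L → ℝ}
    (hF : F.Represents p s e g r) (x : L) :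
    r x = fderiv ℝ (fun s' => F.dens s' x) s e / F.dens s x := by
  rw [hF.dens x, mul_div_cancel_right₀ _ (F.dens_pos s x).ne']

lemma Represents.continuous_dens {p : L} {s e : S} {g : Cotangent N Q → ℝ} {r : L → ℝ}
    (hF : F.Represents p s e g r) : Continuous r := by
  have h1 := (contMDiff_fderiv_param F.smooth_dens).continuous
  have h2 : Continuous fun x => fderiv ℝ (fun s' => F.dens s' x) s e / F.dens s x :=
    (((h1.comp (Continuous.prodMk_right s)).clm_apply continuous_const)).div
      (F.dens_contMDiff s).continuous fun x => (F.dens_pos s x).ne'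
  exact h2.congr fun x => (hF.dens_eq x).symm

/-- Off the set of variation the Hamiltonian vector field of a generator vanishes. -/
lemma ConstantOff.hamField_eq_zero {K : Set L} (hK : F.ConstantOff K) {p : L} {s e : S}
    {g : Cotangent N Q → ℝ} {r : L → ℝ} (hF : F.Represents p s e g r) {x : L} (hx : x ∉ K) :
    hamField g ((F.pt s).ι x) = 0 := by
  rw [← hF.emb x, deltaEmb]
  have : (fun s' => (F.pt s').ι x) = fun _ => (F.pt s).ι x :=
    funext fun s' => ((hK s' x hx).1).trans ((hK s x hx).1).symm
  rw [this, mfderiv_const]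
  rfl

lemma ConstantOff.dens_eq_zero {K : Set L} (hK : F.ConstantOff K) {p : L} {s e : S}
    {g : Cotangent N Q → ℝ} {r : L → ℝ} (hF : F.Represents p s e g r) {x : L} (hx : x ∉ K) :
    r x = 0 := by
  rw [hF.dens_eq x]
  have : (fun s' => F.dens s' x) = fun _ => 1 := funext fun s' => (hK s' x hx).2
  rw [this]; simp

end SmoothFamily

lemma poisson_eq_zero {f g : Cotangent N Q → ℝ} {z : Cotangent N Q} (h : hamField g z = 0) :
    poisson f g z = 0 := by
  rw [poisson, h, dfun]; exact map_zero _

end Family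

/-! ### Commutation of the generators of a two-parameter family -/

section Commutation
variable {N : ℕ}

lemma hasFDerivAt_stdForm_fderiv {X : Type*} [NormedAddCommGroup X] [NormedSpace ℝ X]
    {J : X → PhaseModel N} {x : X} (hJ : ContDiffAt ℝ ∞ J x) (u v : X) :
    ∃ D : X →L[ℝ] ℝ, HasFDerivAt (fun x => stdForm (fderiv ℝ J x u) (fderiv ℝ J x v)) D x ∧
      ∀ z, D z = stdForm (fderiv ℝ (fderiv ℝ J) x z u) (fderiv ℝ J x v)
        + stdForm (fderiv ℝ J x u) (fderiv ℝ (fderiv ℝ J) x z v) := by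
  have hdd : HasFDerivAt (fderiv ℝ J) (fderiv ℝ (fderiv ℝ J) x) x :=
    ((hJ.fderiv_right (m := 1) (by norm_num; exact two_le_infty)).differentiableAt
      (by simp)).hasFDerivAt
  have hu := hdd.clm_apply (hasFDerivAt_const u x)
  have hv := hdd.clm_apply (hasFDerivAt_const v x)
  refine ⟨_, (hv.snd.clm_apply hu.fst).sub (hu.snd.clm_apply hv.fst), fun z => ?_⟩
  simp [stdForm]
  ring

/-- If `A` and `B` generate the motions of `J` in the directions `e₁` and `e₂`, then
`∂₁B - ∂₂A + ω(∂₁J, ∂₂J)` does not vary: in a chart, `ω` is constant, so this is the closedness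
of `J^*ω`. -/
lemma fderiv_curvature_eq_zero {X : Type*} [NormedAddCommGroup X] [NormedSpace ℝ X]
    {J : X → PhaseModel N} {A B : X → ℝ} {x e₁ e₂ w : X} (hJ : ContDiffAt ℝ ∞ J x)
    (hA : ContDiffAt ℝ ∞ A x) (hB : ContDiffAt ℝ ∞ B x)
    (hAw : ∀ᶠ y in 𝓝 x, fderiv ℝ A y w = stdForm (fderiv ℝ J y e₁) (fderiv ℝ J y w))
    (hBw : ∀ᶠ y in 𝓝 x, fderiv ℝ B y w = stdForm (fderiv ℝ J y e₂) (fderiv ℝ J y w)) :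
    fderiv ℝ (fun y => fderiv ℝ B y e₁ - fderiv ℝ A y e₂
      + stdForm (fderiv ℝ J y e₁) (fderiv ℝ J y e₂)) x w = 0 := by
  have hddA : HasFDerivAt (fderiv ℝ A) (fderiv ℝ (fderiv ℝ A) x) x :=
    ((hA.fderiv_right (m := 1) (by norm_num; exact two_le_infty)).differentiableAt
      (by simp)).hasFDerivAt
  have hddB : HasFDerivAt (fderiv ℝ B) (fderiv ℝ (fderiv ℝ B) x) x :=
    ((hB.fderiv_right (m := 1) (by norm_num; exact two_le_infty)).differentiableAt
      (by simp)).hasFDerivAt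
  have hsA : IsSymmSndFDerivAt ℝ A x := hA.isSymmSndFDerivAt (by simpa using two_le_infty)
  have hsB : IsSymmSndFDerivAt ℝ B x := hB.isSymmSndFDerivAt (by simpa using two_le_infty)
  have hsJ : IsSymmSndFDerivAt ℝ J x := hJ.isSymmSndFDerivAt (by simpa using two_le_infty)
  obtain ⟨D, hD, hD'⟩ := hasFDerivAt_stdForm_fderiv hJ e₁ e₂
  obtain ⟨D₁, hD₁, hD₁'⟩ := hasFDerivAt_stdForm_fderiv hJ e₁ w
  obtain ⟨D₂, hD₂, hD₂'⟩ := hasFDerivAt_stdForm_fderiv hJ e₂ w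
  have a1 : fderiv ℝ (fderiv ℝ A) x w e₂ = D₁ e₂ := by
    rw [hsA w e₂]
    have h := (hddA.clm_apply (hasFDerivAt_const w x)).congr_of_eventuallyEq
      (hAw.mono fun y hy => hy.symm)
    have := congrArg (fun T => T e₂) (h.unique hD₁)
    simpa using this
  have b1 : fderiv ℝ (fderiv ℝ B) x w e₁ = D₂ e₁ := by
    rw [hsB w e₁]
    have h := (hddB.clm_apply (hasFDerivAt_const w x)).congr_of_eventuallyEq
      (hBw.mono fun y hy => hy.symm)
    have := congrArg (fun T => T e₁) (h.unique hD₂)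
    simpa using this
  have h := ((hddB.clm_apply (hasFDerivAt_const e₁ x)).fun_sub
    (hddA.clm_apply (hasFDerivAt_const e₂ x))).fun_add hD
  have h' : fderiv ℝ (fun y => fderiv ℝ B y e₁ - fderiv ℝ A y e₂
      + stdForm (fderiv ℝ J y e₁) (fderiv ℝ J y e₂)) x w
      = fderiv ℝ (fderiv ℝ B) x w e₁ - fderiv ℝ (fderiv ℝ A) x w e₂ + D w := by
    rw [h.fderiv]; simp
  rw [h', a1, b1, hD', hD₁', hD₂', hsJ e₁ e₂, hsJ w e₁, hsJ w e₂]
  simp [stdForm]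

variable {Q : Type*} [TopologicalSpace Q] [ChartedSpace (Rn N) Q] [IsManifold (𝓡 N) ∞ Q]
  {L : Type*} [TopologicalSpace L] [ChartedSpace (Rn N) L] [IsManifold (𝓡 N) ∞ L]
  [MeasurableSpace L] [BorelSpace L] {ε : ℝ} {ι₀ : L → Cotangent N Q}
  {S : Type} [NormedAddCommGroup S] [NormedSpace ℝ S] {F : SmoothFamily S ε ι₀}

namespace SmoothFamily

/-- The family in charts: the bundle chart at `z₀` of the point `ι_s(c⁻¹(y))`, `c` the chart
at `x₀`. -/
def inCharts (F : SmoothFamily S ε ι₀) (z₀ : Cotangent N Q) (x₀ : L) (q : S × Rn N) :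
    PhaseModel N :=
  extChartAt (cot N) z₀ ((F.pt q.1).ι ((extChartAt (𝓡 N) x₀).symm q.2))

/-- The domain of `inCharts`. -/
def chartDomain (F : SmoothFamily S ε ι₀) (z₀ : Cotangent N Q) (x₀ : L) : Set (S × Rn N) :=
  {q | q.2 ∈ (extChartAt (𝓡 N) x₀).target ∧
    (F.pt q.1).ι ((extChartAt (𝓡 N) x₀).symm q.2) ∈ (extChartAt (cot N) z₀).source}

lemma contMDiffOn_comp_chart (x₀ : L) :
    ContMDiffOn (𝓘(ℝ, S).prod 𝓘(ℝ, Rn N)) (𝓘(ℝ, S).prod (𝓡 N)) ∞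
      (fun q : S × Rn N => (q.1, (extChartAt (𝓡 N) x₀).symm q.2))
      (univ ×ˢ (extChartAt (𝓡 N) x₀).target) :=
  contMDiffOn_fst.prodMk ((contMDiffOn_extChartAt_symm x₀).comp contMDiffOn_snd
    fun _ hq => hq.2)

variable (F) in
lemma isOpen_chartDomain (z₀ : Cotangent N Q) (x₀ : L) : IsOpen (F.chartDomain z₀ x₀) := by
  have h := (F.smooth_emb.continuous.comp_continuousOn
    (contMDiffOn_comp_chart (N := N) (S := S) x₀).continuousOn).isOpen_inter_preimage
    (isOpen_univ.prod (isOpen_extChartAt_target x₀)) (isOpen_extChartAt_source (I := cot N) z₀)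
  convert h using 1
  ext q
  simp [chartDomain]

variable (F) in
lemma contDiffOn_inCharts (z₀ : Cotangent N Q) (x₀ : L) :
    ContDiffOn ℝ ∞ (F.inCharts z₀ x₀) (F.chartDomain z₀ x₀) := by
  have h1 : ContMDiffOn (𝓘(ℝ, S).prod 𝓘(ℝ, Rn N)) (cot N) ∞
      (fun q : S × Rn N => (F.pt q.1).ι ((extChartAt (𝓡 N) x₀).symm q.2))
      (univ ×ˢ (extChartAt (𝓡 N) x₀).target) :=
    F.smooth_emb.comp_contMDiffOn (contMDiffOn_comp_chart (N := N) (S := S) x₀)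
  have h2 := (contMDiffOn_extChartAt (I := cot N) (n := ∞) (x := z₀)).comp
    (h1.mono (s := univ ×ˢ (extChartAt (𝓡 N) x₀).target) (t := F.chartDomain z₀ x₀)
      (fun q hq => ⟨mem_univ _, hq.1⟩)) (fun q hq => by simpa using hq.2)
  rw [← modelWithCornersSelf_prod, chartedSpaceSelf_prod] at h2
  exact h2.contDiffOn

lemma fderiv_inCharts_fst {z₀ : Cotangent N Q} {x₀ : L} {s : S} {y : Rn N}
    (h : (s, y) ∈ F.chartDomain z₀ x₀) (e : S) :
    fderiv ℝ (F.inCharts z₀ x₀) (s, y) (e, 0) =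
      (mfderiv (cot N) 𝓘(ℝ, PhaseModel N) (extChartAt (cot N) z₀)
        ((F.pt s).ι ((extChartAt (𝓡 N) x₀).symm y))
        (F.deltaEmb s e ((extChartAt (𝓡 N) x₀).symm y)) : PhaseModel N) := by
  have hJ : DifferentiableAt ℝ (F.inCharts z₀ x₀) (s, y) :=
    ((F.contDiffOn_inCharts z₀ x₀).contDiffAt
      ((F.isOpen_chartDomain z₀ x₀).mem_nhds h)).differentiableAt (by simp)
  have h1 := HasFDerivAt.comp (g := F.inCharts z₀ x₀) (f := fun s' : S => (s', y)) s
    hJ.hasFDerivAt (hasFDerivAt_prodMk_left s y)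
  have h3 : MDifferentiableAt (cot N) 𝓘(ℝ, PhaseModel N) (extChartAt (cot N) z₀)
      ((F.pt s).ι ((extChartAt (𝓡 N) x₀).symm y)) :=
    mdifferentiableAt_extChartAt (by simpa using h.2)
  have h4 := mfderiv_comp_apply s h3 (F.mdifferentiableAt_emb s ((extChartAt (𝓡 N) x₀).symm y)) e
  rw [mfderiv_eq_fderiv] at h4
  have h5 : fderiv ℝ (F.inCharts z₀ x₀) (s, y) (e, 0)
      = fderiv ℝ (F.inCharts z₀ x₀ ∘ fun s' : S => (s', y)) s e := by
    rw [h1.fderiv]; simp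
  rw [h5]
  exact h4

/-- A function `a_s ∘ ι_s` with `X_{a_s} ∘ ι_s = ∂_e ι_s` satisfies Hamilton's equations in
charts. -/
lemma fderiv_generator_snd {z₀ : Cotangent N Q} {x₀ : L} {s : S} {y w : Rn N} {e : S} {p : L}
    {a : Cotangent N Q → ℝ} {r : L → ℝ} (h : (s, y) ∈ F.chartDomain z₀ x₀)
    (ha : F.Represents p s e a r) :
    fderiv ℝ (fun y => a ((F.pt s).ι ((extChartAt (𝓡 N) x₀).symm y))) y w
      = stdForm (fderiv ℝ (F.inCharts z₀ x₀) (s, y) (e, 0))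
        (fderiv ℝ (F.inCharts z₀ x₀) (s, y) (0, w)) := by
  have hJ : DifferentiableAt ℝ (F.inCharts z₀ x₀) (s, y) :=
    ((F.contDiffOn_inCharts z₀ x₀).contDiffAt
      ((F.isOpen_chartDomain z₀ x₀).mem_nhds h)).differentiableAt (by simp)
  have h1 := HasFDerivAt.comp (g := F.inCharts z₀ x₀) (f := fun y' : Rn N => (s, y')) y
    hJ.hasFDerivAt (hasFDerivAt_prodMk_right s y)
  have hty := (extChartAt (cot N) z₀).map_source h.2
  have h2 : HasFDerivAt (a ∘ (extChartAt (cot N) z₀).symm) _ (F.inCharts z₀ x₀ (s, y)) :=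
    (((ha.smooth.comp_extChartAt_symm z₀).contDiffAt
      ((isOpen_extChartAt_target z₀).mem_nhds hty)).differentiableAt (by simp)).hasFDerivAt
  have h3 : (fun y => a ((F.pt s).ι ((extChartAt (𝓡 N) x₀).symm y))) =ᶠ[𝓝 y]
      (a ∘ (extChartAt (cot N) z₀).symm) ∘ (F.inCharts z₀ x₀ ∘ fun y' : Rn N => (s, y')) := by
    have hc : ContinuousAt (fun y' : Rn N => (s, y')) y := by fun_prop
    filter_upwards [hc.preimage_mem_nhds ((F.isOpen_chartDomain z₀ x₀).mem_nhds h)] with y' hy'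
    simp only [Function.comp_apply, inCharts]
    rw [(extChartAt (cot N) z₀).left_inv hy'.2]
  rw [h3.fderiv_eq, (h2.comp y h1).fderiv, fderiv_inCharts_fst h, ha.emb,
    hamField_eq_coord h.2 ha.smooth.contMDiffAt, stdForm_stdHam]
  simp

lemma contDiffAt_comp_chart {f : S → L → ℝ}
    (hf : ContMDiff (𝓘(ℝ, S).prod (𝓡 N)) 𝓘(ℝ, ℝ) ∞ (fun q : S × L => f q.1 q.2))
    {x₀ : L} {q : S × Rn N} (hq : q.2 ∈ (extChartAt (𝓡 N) x₀).target) :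
    ContDiffAt ℝ ∞ (fun q : S × Rn N => f q.1 ((extChartAt (𝓡 N) x₀).symm q.2)) q := by
  have h := hf.comp_contMDiffOn (contMDiffOn_comp_chart (N := N) (S := S) x₀)
  rw [← modelWithCornersSelf_prod, chartedSpaceSelf_prod] at h
  exact h.contDiffOn.contDiffAt ((isOpen_univ.prod (isOpen_extChartAt_target x₀)).mem_nhds
    ⟨mem_univ _, hq⟩)

variable {K K' : Set L} {p : L} {e₁ e₂ : S} {a b : S → Cotangent N Q → ℝ} {ra rb : S → L → ℝ}

/-- The defect of the commutation relation is locally constant along the Lagrangian submanifold. -/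
lemma isLocallyConstant_curvature (ha : F.Generates p K e₁ a ra) (hb : F.Generates p K' e₂ b rb)
    (s : S) : IsLocallyConstant (fun x => fderiv ℝ (fun s => b s ((F.pt s).ι x)) s e₁
      - fderiv ℝ (fun s => a s ((F.pt s).ι x)) s e₂ + poisson (a s) (b s) ((F.pt s).ι x)) := by
  rw [IsLocallyConstant.iff_eventually_eq]
  intro x₀
  set z₀ := (F.pt s).ι x₀
  set c := extChartAt (𝓡 N) x₀
  set A : S × Rn N → ℝ := fun q => a q.1 ((F.pt q.1).ι (c.symm q.2))
  set B : S × Rn N → ℝ := fun q => b q.1 ((F.pt q.1).ι (c.symm q.2))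
  set J := F.inCharts z₀ x₀
  set G : S × Rn N → ℝ := fun q => fderiv ℝ B q (e₁, 0) - fderiv ℝ A q (e₂, 0)
    + stdForm (fderiv ℝ J q (e₁, 0)) (fderiv ℝ J q (e₂, 0))
  have hO := F.isOpen_chartDomain z₀ x₀
  have hA : ∀ q ∈ F.chartDomain z₀ x₀, ContDiffAt ℝ ∞ A q := fun q hq =>
    contDiffAt_comp_chart (f := fun s x => a s ((F.pt s).ι x)) ha.smooth hq.1
  have hB : ∀ q ∈ F.chartDomain z₀ x₀, ContDiffAt ℝ ∞ B q := fun q hq =>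
    contDiffAt_comp_chart (f := fun s x => b s ((F.pt s).ι x)) hb.smooth hq.1
  have hJ : ∀ q ∈ F.chartDomain z₀ x₀, ContDiffAt ℝ ∞ J q := fun q hq =>
    (F.contDiffOn_inCharts z₀ x₀).contDiffAt (hO.mem_nhds hq)
  have hpart : ∀ (f : S × Rn N → ℝ) (q : S × Rn N) (w : Rn N), ContDiffAt ℝ ∞ f q →
      fderiv ℝ f q (0, w) = fderiv ℝ (fun y => f (q.1, y)) q.2 w := by
    intro f q w hf
    have h1 : HasFDerivAt (fun y' => f (q.1, y')) _ q.2 :=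
      HasFDerivAt.comp q.2 (hf.differentiableAt (by simp)).hasFDerivAt
        (hasFDerivAt_prodMk_right q.1 q.2)
    rw [h1.fderiv]; simp
  have hpart' : ∀ (f : S × Rn N → ℝ) (q : S × Rn N) (e : S), ContDiffAt ℝ ∞ f q →
      fderiv ℝ f q (e, 0) = fderiv ℝ (fun s => f (s, q.2)) q.1 e := by
    intro f q w hf
    have h1 : HasFDerivAt (fun s' => f (s', q.2)) _ q.1 :=
      HasFDerivAt.comp q.1 (hf.differentiableAt (by simp)).hasFDerivAt
        (hasFDerivAt_prodMk_left q.1 q.2)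
    rw [h1.fderiv]; simp
  have hG : ∀ q ∈ F.chartDomain z₀ x₀, DifferentiableAt ℝ G q := by
    intro q hq
    obtain ⟨D, hD, -⟩ := hasFDerivAt_stdForm_fderiv (hJ q hq) (e₁, 0) (e₂, 0)
    have hfd : ∀ (f : S × Rn N → ℝ) (e : S × Rn N), ContDiffAt ℝ ∞ f q →
        DifferentiableAt ℝ (fun q => fderiv ℝ f q e) q := fun f e hf =>
      ((hf.fderiv_right (m := 1) (by norm_num; exact two_le_infty)).differentiableAt
        (by simp)).clm_apply (differentiableAt_const e)
    exact ((hfd B _ (hB q hq)).sub (hfd A _ (hA q hq))).add hD.differentiableAt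
  have hG0 : ∀ q ∈ F.chartDomain z₀ x₀, ∀ w : Rn N, fderiv ℝ G q (0, w) = 0 := by
    intro q hq w
    refine fderiv_curvature_eq_zero (hJ q hq) (hA q hq) (hB q hq) ?_ ?_
    · filter_upwards [hO.mem_nhds hq] with q' hq'
      rw [hpart A q' w (hA q' hq')]
      exact fderiv_generator_snd hq' (ha.represents q'.1)
    · filter_upwards [hO.mem_nhds hq] with q' hq'
      rw [hpart B q' w (hB q' hq')]
      exact fderiv_generator_snd hq' (hb.represents q'.1)
  have hCG : ∀ y, (s, y) ∈ F.chartDomain z₀ x₀ →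
      fderiv ℝ (fun s' => b s' ((F.pt s').ι (c.symm y))) s e₁
      - fderiv ℝ (fun s' => a s' ((F.pt s').ι (c.symm y))) s e₂
      + poisson (a s) (b s) ((F.pt s).ι (c.symm y)) = G (s, y) := by
    intro y hy
    simp only [G]
    rw [hpart' B _ _ (hB _ hy), hpart' A _ _ (hA _ hy), fderiv_inCharts_fst hy,
      fderiv_inCharts_fst hy, poisson, ← symplecticForm_hamField, (ha.represents s).emb,
      (hb.represents s).emb, symplecticForm_eq_coord hy.2]
  have hx₀ : (s, c x₀) ∈ F.chartDomain z₀ x₀ := by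
    refine ⟨mem_extChartAt_target x₀, ?_⟩
    simp only [c, extChartAt_to_inv]
    exact mem_extChartAt_source z₀
  have hc : ContinuousAt (fun y : Rn N => (s, y)) (c x₀) := by fun_prop
  obtain ⟨δ, hδ, hball⟩ := Metric.mem_nhds_iff.1 (hc.preimage_mem_nhds (hO.mem_nhds hx₀))
  have hconst : ∀ y ∈ Metric.ball (c x₀) δ, G (s, y) = G (s, c x₀) := by
    intro y hy
    have hd : ∀ y ∈ Metric.ball (c x₀) δ, HasFDerivAt (fun y => G (s, y)) (0 : Rn N →L[ℝ] ℝ) y := by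
      intro y hy
      have h1 : HasFDerivAt (fun y' => G (s, y')) _ y :=
        HasFDerivAt.comp y (hG _ (hball hy)).hasFDerivAt (hasFDerivAt_prodMk_right s y)
      have h0 : (fderiv ℝ G (s, y)).comp (ContinuousLinearMap.inr ℝ S (Rn N)) = 0 := by
        ext1 w
        exact hG0 _ (hball hy) w
      rw [h0] at h1
      exact h1
    exact Metric.isOpen_ball.is_const_of_fderiv_eq_zero (𝕜 := ℝ)
      (convex_ball (c x₀) δ).isPreconnected
      (fun y hy => (hd y hy).differentiableAt.differentiableWithinAt) (fun y hy => (hd y hy).fderiv)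
      hy (Metric.mem_ball_self hδ)
  have hcx : ContinuousAt c x₀ := continuousAt_extChartAt x₀
  filter_upwards [hcx.preimage_mem_nhds (Metric.ball_mem_nhds _ hδ),
    extChartAt_source_mem_nhds (I := 𝓡 N) x₀] with x hx hxs
  have e1 := hCG (c x) (hball hx)
  have e2 := hCG (c x₀) (hball (Metric.mem_ball_self hδ))
  rw [hconst _ hx, ← e2, c.left_inv hxs, extChartAt_to_inv] at e1
  exact e1

/-- At the distinguished point the defect of the commutation relation vanishes: this is the symmetry
of the second derivative of the phase. -/
lemma curvature_base_eq_zero (ha : F.Generates p K e₁ a ra) (hb : F.Generates p K' e₂ b rb)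
    (s : S) : fderiv ℝ (fun s => b s ((F.pt s).ι p)) s e₁
      - fderiv ℝ (fun s => a s ((F.pt s).ι p)) s e₂ + poisson (a s) (b s) ((F.pt s).ι p) = 0 := by
  set z₀ := (F.pt s).ι p
  set j : S → PhaseModel N := fun s' => extChartAt (cot N) z₀ ((F.pt s').ι p)
  have hcurve : ContMDiff 𝓘(ℝ, S) (cot N) ∞ (fun s' => (F.pt s').ι p) :=
    F.smooth_emb.comp (contMDiff_id.prodMk contMDiff_const)
  have hev : ∀ᶠ s' in 𝓝 s, (F.pt s').ι p ∈ (extChartAt (cot N) z₀).source :=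
    hcurve.continuous.continuousAt.preimage_mem_nhds (extChartAt_source_mem_nhds z₀)
  have hj : ContDiffAt ℝ ∞ j s :=
    (ContMDiffAt.comp s (contMDiffAt_extChartAt (I := cot N) (n := ∞) (x := z₀))
      hcurve.contMDiffAt).contDiffAt
  have hdj : ∀ s', (F.pt s').ι p ∈ (extChartAt (cot N) z₀).source → ∀ e : S,
      fderiv ℝ j s' e = (mfderiv (cot N) 𝓘(ℝ, PhaseModel N) (extChartAt (cot N) z₀)
        ((F.pt s').ι p) (F.deltaEmb s' e p) : PhaseModel N) := by
    intro s' hs' e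
    have h3 : MDifferentiableAt (cot N) 𝓘(ℝ, PhaseModel N) (extChartAt (cot N) z₀)
        ((F.pt s').ι p) := mdifferentiableAt_extChartAt (by simpa using hs')
    have h4 := mfderiv_comp_apply s' h3 (F.mdifferentiableAt_emb s' p) e
    rw [mfderiv_eq_fderiv] at h4
    exact h4
  have hphase : ∀ {e : S} {c : S → Cotangent N Q → ℝ} {r : S → L → ℝ},
      (∀ s, F.Represents p s e (c s) (r s)) → ∀ᶠ s' in 𝓝 s,
      fderiv ℝ F.phase s' e = (j s').2 (fderiv ℝ j s' e).1 - c s' ((F.pt s').ι p) := by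
    intro e c r hc
    filter_upwards [hev] with s' hs'
    rw [hdj s' hs', (hc s').emb, ← liouville_eq_coord hs']
    exact (hc s').phase
  have hdd : HasFDerivAt (fderiv ℝ F.phase) (fderiv ℝ (fderiv ℝ F.phase) s) s :=
    ((F.smooth_phase.contDiffAt.fderiv_right (m := 1)
      (by norm_num; exact two_le_infty)).differentiableAt
      (by simp)).hasFDerivAt
  have hddj : DifferentiableAt ℝ (fderiv ℝ j) s :=
    (hj.fderiv_right (m := 1) (by norm_num; exact two_le_infty)).differentiableAt (by simp)
  have hlj : ∀ e : S, DifferentiableAt ℝ (fun s' => (j s').2 (fderiv ℝ j s' e).1) s := fun e =>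
    (hj.differentiableAt (by simp)).snd.clm_apply
      (hddj.clm_apply (differentiableAt_const e)).fst
  have key : ∀ {e : S} {K : Set L} {c : S → Cotangent N Q → ℝ} {r : S → L → ℝ},
      F.Generates p K e c r → ∀ e' : S, fderiv ℝ (fderiv ℝ F.phase) s e' e
        = fderiv ℝ (fun s' => (j s').2 (fderiv ℝ j s' e).1) s e'
          - fderiv ℝ (fun s' => c s' ((F.pt s').ι p)) s e' := by
    intro e K c r hc e'
    have hcd : DifferentiableAt ℝ (fun s' => c s' ((F.pt s').ι p)) s :=
      (contDiff_param (f := fun s x => c s ((F.pt s).ι x)) hc.smooth p).differentiable (by simp) s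
    have h1 := (hdd.clm_apply (hasFDerivAt_const e s)).congr_of_eventuallyEq
      ((hphase hc.represents).mono fun y hy => hy.symm)
    have h2 := h1.unique ((hlj e).hasFDerivAt.fun_sub hcd.hasFDerivAt)
    have h3 := congrArg (fun T => T e') h2
    simpa using h3
  have hs : IsSymmSndFDerivAt ℝ F.phase s :=
    F.smooth_phase.contDiffAt.isSymmSndFDerivAt (by simpa using two_le_infty)
  have h1 := key ha e₂
  have h2 := key hb e₁
  rw [hs e₂ e₁] at h1
  have h3 := fderiv_pullback_liouville_antisymm hj e₁ e₂
  have hz : z₀ ∈ (extChartAt (cot N) z₀).source := mem_extChartAt_source z₀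
  have h4 : poisson (a s) (b s) z₀ = stdForm (fderiv ℝ j s e₁) (fderiv ℝ j s e₂) := by
    rw [poisson, ← symplecticForm_hamField, symplecticForm_eq_coord hz, hdj s hz, hdj s hz,
      (ha.represents s).emb, (hb.represents s).emb]
  rw [h4]
  linarith

/-- The generators of a two-parameter family satisfy `∂₁(b ∘ ι) - ∂₂(a ∘ ι) = -{a, b} ∘ ι`. -/
theorem generator_commutation [ConnectedSpace L] (ha : F.Generates p K e₁ a ra)
    (hb : F.Generates p K' e₂ b rb) (s : S) (x : L) :
    fderiv ℝ (fun s => b s ((F.pt s).ι x)) s e₁ - fderiv ℝ (fun s => a s ((F.pt s).ι x)) s e₂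
      = -poisson (a s) (b s) ((F.pt s).ι x) := by
  have h1 := (isLocallyConstant_curvature ha hb s).apply_eq_of_preconnectedSpace x p
  have h2 := curvature_base_eq_zero ha hb s
  linarith

end SmoothFamily
end Commutation

/-! ### The defining equation as an integral identity -/

section PoissonAlgebra
variable {N : ℕ} {Q : Type*} [TopologicalSpace Q] [ChartedSpace (Rn N) Q] [IsManifold (𝓡 N) ∞ Q]
  {f g h : Cotangent N Q → ℝ}

lemma poisson_sub_left (hf : Smooth f) (hg : Smooth g) (z : Cotangent N Q) :
    poisson (fun z => f z - g z) h z = poisson f h z - poisson g h z := by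
  simp only [poisson_eq, dfunLin_sub hf hg]; rfl

lemma poisson_sub_right (hg : Smooth g) (hh : Smooth h) (z : Cotangent N Q) :
    poisson f (fun z => g z - h z) z = poisson f g z - poisson f h z := by
  simp only [poisson_eq, dfunLin_sub hg hh]
  exact (congrArg _ (map_sub stdHam _ _)).trans (map_sub (dfunLin f z) _ _)

lemma poisson_neg_left (z : Cotangent N Q) :
    poisson (fun z => -f z) g z = -poisson f g z := by
  simp only [poisson_eq, dfunLin_neg]; rfl

lemma poisson_neg_right (z : Cotangent N Q) :
    poisson f (fun z => -g z) z = -poisson f g z := by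
  simp only [poisson_eq, dfunLin_neg]
  exact (congrArg _ (map_neg stdHam _)).trans (map_neg (dfunLin f z) _)

lemma poisson_mul_left (hf : Smooth f) (hg : Smooth g) (z : Cotangent N Q) :
    poisson (fun z => f z * g z) h z = f z * poisson g h z + g z * poisson f h z := by
  simp only [poisson_eq, dfunLin_mul hf hg]; rfl

end PoissonAlgebra

section Equation
variable {N : ℕ} {Q : Type*} [TopologicalSpace Q] [ChartedSpace (Rn N) Q] [IsManifold (𝓡 N) ∞ Q]
  {L : Type*} [TopologicalSpace L] [T2Space L] [ChartedSpace (Rn N) L] [IsManifold (𝓡 N) ∞ L]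
  [MeasurableSpace L] [BorelSpace L] {ε : ℝ} {ι₀ : L → Cotangent N Q} {p : L}

/-- Differentiation of an integral along a line in the parameter space. -/
lemma hasDerivAt_integral_line {S : Type*} [NormedAddCommGroup S] [NormedSpace ℝ S]
    {μ : Measure L} [IsFiniteMeasureOnCompacts μ] {f : S → L → ℝ}
    (hf : ContMDiff (𝓘(ℝ, S).prod (𝓡 N)) 𝓘(ℝ, ℝ) ∞ (fun q : S × L => f q.1 q.2))
    {K : Set L} (hK : IsCompact K) (hoff : ∀ s, ∀ x ∉ K, f s x = f 0 x)
    (hint : Integrable (f 0) μ) (e : S) :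
    Integrable (fun x => fderiv ℝ (fun s => f s x) 0 e) μ ∧
    HasDerivAt (fun t : ℝ => ∫ x, f (t • e) x ∂μ)
      (∫ x, fderiv ℝ (fun s => f s x) 0 e ∂μ) 0 := by
  have hsm : Continuous fun t : ℝ => t • e := by fun_prop
  have h := hasDerivAt_integral_of_compact (μ := μ) (f := fun t x => f (t • e) x)
    (f' := fun t x => fderiv ℝ (fun s => f s x) (t • e) e) hK 0
    (fun t => (contMDiff_param hf _).continuous) (fun t x => ?_) ?_
    (fun t x hx => by rw [hoff _ x hx, zero_smul]) (by simpa using hint)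
  · simpa using h
  · have h1 : HasFDerivAt (fun s => f s x) (fderiv ℝ (fun s => f s x) (t • e)) (t • e) :=
      ((contDiff_param hf x).differentiable (by simp) _).hasFDerivAt
    have h2 : HasDerivAt (fun t : ℝ => t • e) e t := by
      simpa using (hasDerivAt_id t).smul_const e
    exact h1.comp_hasDerivAt t h2
  · exact ((contMDiff_fderiv_param hf).continuous.comp
      ((hsm.comp continuous_fst).prodMk continuous_snd)).clm_apply continuous_const

namespace SmoothFamily

/-- The derivative of `θ_t(∂_{e'} F)` in the direction `e`. -/
lemma hasDerivAt_theta {S : Type} [NormedAddCommGroup S] [NormedSpace ℝ S]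
    {F : SmoothFamily S ε ι₀} {K : Set L} (hK : IsCompact K) {e e' : S}
    {a : Cotangent N Q → ℝ} {r : L → ℝ} {b : S → Cotangent N Q → ℝ} {rb : S → L → ℝ}
    (ha : F.Represents p 0 e a r) (hb : F.Generates p K e' b rb)
    (ρ : ℝ → Cotangent N Q → ℝ) (t : ℝ) (hρ : Smooth (ρ t)) :
    Integrable (fun x => fderiv ℝ (fun s => b s ((F.pt s).ι x)) 0 e * ρ t ((F.pt 0).ι x)
        + b 0 ((F.pt 0).ι x) * poisson (ρ t) a ((F.pt 0).ι x)
        + b 0 ((F.pt 0).ι x) * ρ t ((F.pt 0).ι x) * r x) (F.pt 0).μ ∧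
    HasDerivAt (fun τ : ℝ => F.theta ρ p t (τ • e) e' (b (τ • e)))
      (-∫ x, (fderiv ℝ (fun s => b s ((F.pt s).ι x)) 0 e * ρ t ((F.pt 0).ι x)
        + b 0 ((F.pt 0).ι x) * poisson (ρ t) a ((F.pt 0).ι x)
        + b 0 ((F.pt 0).ι x) * ρ t ((F.pt 0).ι x) * r x) ∂(F.pt 0).μ) 0 := by
  have hsm : ContMDiff (𝓘(ℝ, S).prod (𝓡 N)) 𝓘(ℝ, ℝ) ∞
      (fun q : S × L => b q.1 ((F.pt q.1).ι q.2) * ρ t ((F.pt q.1).ι q.2) * F.dens q.1 q.2) :=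
    (hb.smooth.mul (F.comp_contMDiff hρ)).mul F.smooth_dens
  have hz : ∀ s, ∀ x ∉ K, b s ((F.pt s).ι x) * ρ t ((F.pt s).ι x) * F.dens s x = 0 :=
    fun s x hx => by
    rw [hb.supported s x hx]; ring
  have h := hasDerivAt_integral_line (μ := (F.pt 0).μ)
    (f := fun s x => b s ((F.pt s).ι x) * ρ t ((F.pt s).ι x) * F.dens s x) hsm hK
    (fun s x hx => (hz s x hx).trans (hz 0 x hx).symm)
    (integrable_of_continuous_of_compact hK (contMDiff_param
      (f := fun s x => b s ((F.pt s).ι x) * ρ t ((F.pt s).ι x) * F.dens s x)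
        hsm 0).continuous (hz 0)) e
  have hd : ∀ x, fderiv ℝ (fun s => b s ((F.pt s).ι x) * ρ t ((F.pt s).ι x) * F.dens s x) 0 e
      = fderiv ℝ (fun s => b s ((F.pt s).ι x)) 0 e * ρ t ((F.pt 0).ι x)
        + b 0 ((F.pt 0).ι x) * poisson (ρ t) a ((F.pt 0).ι x)
        + b 0 ((F.pt 0).ι x) * ρ t ((F.pt 0).ι x) * r x := by
    intro x
    have h1 : DifferentiableAt ℝ (fun s => b s ((F.pt s).ι x)) 0 :=
      (contDiff_param (f := fun s x => b s ((F.pt s).ι x)) hb.smooth x).differentiable (by simp) 0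
    have h2 : DifferentiableAt ℝ (fun s => ρ t ((F.pt s).ι x)) 0 :=
      (contDiff_param (f := fun s x => ρ t ((F.pt s).ι x)) (F.comp_contMDiff hρ) x).differentiable
        (by simp) 0
    have h3 : DifferentiableAt ℝ (fun s => F.dens s x) 0 :=
      (F.dens_contDiff x).differentiable (by simp) 0
    have h4 := (h1.hasFDerivAt.fun_mul h2.hasFDerivAt).fun_mul h3.hasFDerivAt
    rw [h4.fderiv]
    have h5 := ha.fderiv_comp hρ x
    have h6 := ha.dens x
    have h7 := F.dens_zero x
    simp only [add_apply, smul_apply, smul_eq_mul, h5, h6, h7]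
    ring
  simp only [hd] at h
  refine ⟨h.1, ?_⟩
  have h8 : (fun τ : ℝ => F.theta ρ p t (τ • e) e' (b (τ • e))) = fun τ =>
      -∫ x, b (τ • e) ((F.pt (τ • e)).ι x) * ρ t ((F.pt (τ • e)).ι x)
        * F.dens (τ • e) x ∂(F.pt 0).μ :=
    funext fun τ => (hb.represents (τ • e)).theta_eq ρ t
  rw [h8]
  exact h.2.fun_neg

/-- The curve `u ↦ F(0, u)`. -/
def slice (F : SmoothFamily (ℝ × ℝ) ε ι₀) : SmoothFamily ℝ ε ι₀ where
  pt u := F.pt (0, u)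
  phase u := F.phase (0, u)
  dens u := F.dens (0, u)
  phase_spec u := F.phase_spec (0, u)
  dens_pos u := F.dens_pos (0, u)
  dens_spec u := F.dens_spec (0, u)
  smooth_emb := F.smooth_emb.comp
    ((contMDiff_const.prodMk_space contMDiff_fst).prodMk contMDiff_snd)
  smooth_phase := F.smooth_phase.comp (contDiff_const.prodMk contDiff_id)
  smooth_dens := F.smooth_dens.comp
    ((contMDiff_const.prodMk_space contMDiff_fst).prodMk contMDiff_snd)

lemma Generates.slice {F : SmoothFamily (ℝ × ℝ) ε ι₀} {K : Set L}
    {b : ℝ × ℝ → Cotangent N Q → ℝ} {rb : ℝ × ℝ → L → ℝ} (hb : F.Generates p K (0, 1) b rb) :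
    F.slice.Generates p K 1 (fun u => b (0, u)) (fun u => rb (0, u)) := by
  have hsl : ∀ u : ℝ, HasFDerivAt (fun u : ℝ => ((0 : ℝ), u)) (ContinuousLinearMap.inr ℝ ℝ ℝ) u :=
    fun u => hasFDerivAt_prodMk_right 0 u
  refine ⟨fun u => ⟨(hb.represents (0, u)).smooth, fun x => ?_, ?_, fun x => ?_⟩,
    hb.smooth.comp ((contMDiff_const.prodMk_space contMDiff_fst).prodMk contMDiff_snd),
    fun u => hb.supported (0, u)⟩
  · rw [show (F.slice.pt u).ι x = (F.pt (0, u)).ι x from rfl, ← (hb.represents (0, u)).emb x]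
    have h := mfderiv_comp_apply (I := 𝓘(ℝ, ℝ)) (I' := 𝓘(ℝ, ℝ × ℝ)) u
      (F.mdifferentiableAt_emb (0, u) x) (hsl u).differentiableAt.mdifferentiableAt (1 : ℝ)
    rw [mfderiv_eq_fderiv (f := fun u : ℝ => ((0 : ℝ), u)), (hsl u).fderiv] at h
    exact h
  · refine Eq.trans ?_ (hb.represents (0, u)).phase
    have h := ((F.smooth_phase.differentiable (by simp) (0, u)).hasFDerivAt.comp u (hsl u)).fderiv
    exact congrArg (fun T => T 1) h
  · refine Eq.trans ?_ ((hb.represents (0, u)).dens x)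
    have h :=
      (((F.dens_contDiff x).differentiable (by simp) (0, u)).hasFDerivAt.comp u (hsl u)).fderiv
    exact congrArg (fun T => T 1) h

end SmoothFamily

/-- The integrand of the defining equation of the Hamiltonian vector field, for a tangent vector
that differs by `(f, d μ)` from the solution, tested on the variation `(b, r μ)`. -/
def defect (φ f : Cotangent N Q → ℝ) (d : L → ℝ) (b : Cotangent N Q → ℝ) (r : L → ℝ)
    (Z : Potentials ε ι₀) (x : L) : ℝ :=
  b (Z.ι x) * poisson φ f (Z.ι x) - φ (Z.ι x) * poisson f b (Z.ι x)
    - f (Z.ι x) * poisson φ b (Z.ι x) + φ (Z.ι x) * (b (Z.ι x) * d x - f (Z.ι x) * r x)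

/-- The components `(δg, δμ)` of the Hamiltonian vector field of a functional with differential
`(k μ, P)`. -/
def hamiltonianG (φ P : Cotangent N Q → ℝ) (z : Cotangent N Q) : ℝ := -(1 / φ z) * P z

/-- See `hamiltonianG`; the ratio of `δμ` to `μ`. -/
def hamiltonianR (ρ : ℝ → Cotangent N Q → ℝ) (t : ℝ) (P : Cotangent N Q → ℝ) (k : L → ℝ)
    (Z : Potentials ε ι₀) (x : L) : ℝ :=
  1 / ρ t (Z.ι x) * (k x - timeDeriv ρ t (Z.ι x)
    + poisson (ρ t) (fun z => 1 / ρ t z * P z) (Z.ι x))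

lemma smooth_hamiltonianG {φ P : Cotangent N Q → ℝ} (hφ : Smooth φ) (h0 : ∀ z, φ z ≠ 0)
    (hP : Smooth P) : Smooth (hamiltonianG φ P) := by
  have h : hamiltonianG φ P = fun z => -((φ z)⁻¹ * P z) := by
    funext z; simp [hamiltonianG]
  rw [h]
  exact ((hφ.inv₀ h0).mul hP).neg

/-- The pointwise identity behind the theorem: the integrand of the defining equation is the
defect of the tangent vector `(g, r μ)` with respect to the asserted solution. -/
lemma defect_eq {ρ : ℝ → Cotangent N Q → ℝ} {t : ℝ} (hρ : Smooth (ρ t)) (h0 : ∀ z, ρ t z ≠ 0)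
    {P g b : Cotangent N Q → ℝ} (hP : Smooth P) (hg : Smooth g) (k r rb : L → ℝ)
    (Z : Potentials ε ι₀) (x : L) :
    defect (ρ t) (fun z => g z - hamiltonianG (ρ t) P z)
      (fun x => r x - hamiltonianR ρ t P k Z x) b rb Z x
    = (-poisson g b (Z.ι x) * ρ t (Z.ι x) + b (Z.ι x) * poisson (ρ t) g (Z.ι x)
        + b (Z.ι x) * ρ t (Z.ι x) * r x - g (Z.ι x) * poisson (ρ t) b (Z.ι x)
        - g (Z.ι x) * ρ t (Z.ι x) * rb x)
      - (b (Z.ι x) * k x + poisson P b (Z.ι x) + P (Z.ι x) * rb x)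
      + b (Z.ι x) * timeDeriv ρ t (Z.ι x) := by
  set G := hamiltonianG (ρ t) P
  have hG : Smooth G := smooth_hamiltonianG hρ h0 hP
  have hGP : ∀ z, P z = -(ρ t z * G z) := fun z => by
    have := h0 z
    simp only [G, hamiltonianG]
    field_simp
  have hPb : poisson P b (Z.ι x) = -(ρ t (Z.ι x) * poisson G b (Z.ι x)
      + G (Z.ι x) * poisson (ρ t) b (Z.ι x)) := by
    rw [show P = fun z => -(ρ t z * G z) from funext hGP, poisson_neg_left, poisson_mul_left hρ hG]
  have hPρ : poisson (ρ t) (fun z => 1 / ρ t z * P z) (Z.ι x) = -poisson (ρ t) G (Z.ι x) := by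
    rw [← poisson_neg_right]
    congr 1
    funext z
    simp [G, hamiltonianG]
  simp only [defect, hamiltonianR]
  rw [poisson_sub_left hg hG, poisson_sub_right hg hG, hPb, hPρ, hGP]
  have := h0 (Z.ι x)
  field_simp
  ring

lemma integral_sub_sub_add {μ : Measure L} {T₁ T₂ U₁ U₂ U₃ V : L → ℝ} (h₁ : Integrable T₁ μ)
    (h₂ : Integrable T₂ μ) (h₃ : Integrable U₁ μ) (h₄ : Integrable U₂ μ) (h₅ : Integrable U₃ μ)
    (h₆ : Integrable V μ) :
    ∫ x, (T₁ x - T₂ x - (U₁ x + U₂ x + U₃ x) + V x) ∂μ = (∫ x, T₁ x ∂μ) - (∫ x, T₂ x ∂μ)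
      - ((∫ x, U₁ x ∂μ) + (∫ x, U₂ x ∂μ) + ∫ x, U₃ x ∂μ) + ∫ x, V x ∂μ := by
  have hT : Integrable (fun x => T₁ x - T₂ x) μ := h₁.sub h₂
  have hU : Integrable (fun x => U₁ x + U₂ x) μ := h₃.add h₄
  have hU' : Integrable (fun x => U₁ x + U₂ x + U₃ x) μ := hU.add h₅
  have hTU : Integrable (fun x => T₁ x - T₂ x - (U₁ x + U₂ x + U₃ x)) μ := hT.sub hU'
  rw [integral_add hTU h₆, integral_sub hT hU', integral_sub h₁ h₂, integral_add hU h₅,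
    integral_add h₃ h₄]

/-- For a given two-parameter family the defining equation of the Hamiltonian vector field says
that the integral of the defect vanishes. -/
theorem hamiltonian_equation_iff [ConnectedSpace L] {ρ : ℝ → Cotangent N Q → ℝ}
    (hρ : ContMDiff (𝓘(ℝ, ℝ).prod (cot N)) 𝓘(ℝ, ℝ) ∞ (fun y : ℝ × Cotangent N Q => ρ y.1 y.2))
    (h0 : ∀ t z, ρ t z ≠ 0) {H : PhaseSpace ε ι₀ p → ℝ} {t : ℝ} {Z : Potentials ε ι₀}
    {k : L → ℝ} {P : Cotangent N Q → ℝ} (hk : Continuous k) (hP : Smooth P)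
    (hH : HasDifferential p H Z k P) {g : Cotangent N Q → ℝ} {r : L → ℝ} (hg : Smooth g)
    (F : SmoothFamily (ℝ × ℝ) ε ι₀) {K : Set L} {a b : ℝ × ℝ → Cotangent N Q → ℝ}
    {ra rb : ℝ × ℝ → L → ℝ} (hFZ : F.pt 0 = Z) (hK : IsCompact K) (hoff : F.ConstantOff K)
    (ha : F.Generates p K (1, 0) a ra) (hb : F.Generates p K (0, 1) b rb)
    (hab : ∀ x, (a 0 (Z.ι x) = g (Z.ι x) ∧ hamField (a 0) (Z.ι x) = hamField g (Z.ι x) ∧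
        ra 0 x = r x) ∨ (b 0 (Z.ι x) = 0 ∧ hamField (b 0) (Z.ι x) = 0 ∧ rb 0 x = 0)) :
    (∃ dsθ duθ dH dtθ : ℝ,
      HasDerivAt (fun s : ℝ => F.theta ρ p t (s, 0) (0, 1) (b (s, 0))) dsθ 0 ∧
      HasDerivAt (fun u : ℝ => F.theta ρ p t (0, u) (1, 0) (a (0, u))) duθ 0 ∧
      HasDerivAt (fun u : ℝ => H (proj p (F.pt (0, u)))) dH 0 ∧
      HasDerivAt (fun τ : ℝ => F.theta ρ p τ 0 (0, 1) (b 0)) dtθ t ∧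
      dsθ - duθ = -dH - dtθ) ↔
    ∫ x, defect (ρ t) (fun z => g z - hamiltonianG (ρ t) P z)
      (fun x => r x - hamiltonianR ρ t P k Z x) (b 0) (rb 0) Z x ∂Z.μ = 0 := by
  subst hFZ
  have hρt : ∀ t, Smooth (ρ t) := fun t => contMDiff_param hρ t
  obtain ⟨i1, d1⟩ := SmoothFamily.hasDerivAt_theta hK (ha.represents 0) hb ρ t (hρt t)
  obtain ⟨i2, d2⟩ := SmoothFamily.hasDerivAt_theta hK (hb.represents 0) ha ρ t (hρt t)
  simp only [Prod.smul_mk, smul_eq_mul, mul_one, mul_zero] at d1 d2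
  have d3 : HasDerivAt (fun u : ℝ => H (proj p (F.pt (0, u))))
      ((∫ x, b 0 ((F.pt 0).ι x) * k x ∂(F.pt 0).μ)
        + (∫ x, poisson P (b 0) ((F.pt 0).ι x) ∂(F.pt 0).μ)
        + ∫ x, P ((F.pt 0).ι x) * rb 0 x ∂(F.pt 0).μ) 0 :=
    hH F.slice K _ _ rfl hK (fun s x hx => hoff (0, s) x hx) hb.slice
  have hιc : Continuous (F.pt 0).ι := (F.emb_contMDiff 0).continuous
  have hbs : Smooth (b 0) := (hb.represents 0).smooth
  have hbc : Continuous fun x => b 0 ((F.pt 0).ι x) := hbs.continuous.comp hιc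
  have hb0 : ∀ x ∉ K, b 0 ((F.pt 0).ι x) = 0 := hb.supported 0
  have htd : Continuous fun q : ℝ × L => timeDeriv ρ q.1 ((F.pt 0).ι q.2) :=
    ((contMDiff_fderiv_param hρ).continuous.comp
      (continuous_fst.prodMk (hιc.comp continuous_snd))).clm_apply continuous_const
  have htd' : ∀ τ z, HasDerivAt (fun τ => ρ τ z) (timeDeriv ρ τ z) τ := fun τ z =>
    ((contDiff_param hρ z).differentiable (by simp) τ).hasDerivAt
  have d4 : HasDerivAt (fun τ : ℝ => F.theta ρ p τ 0 (0, 1) (b 0))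
      (-∫ x, b 0 ((F.pt 0).ι x) * timeDeriv ρ t ((F.pt 0).ι x) ∂(F.pt 0).μ) t := by
    have h := hasDerivAt_integral_of_compact (μ := (F.pt 0).μ)
      (f := fun τ x => b 0 ((F.pt 0).ι x) * ρ τ ((F.pt 0).ι x))
      (f' := fun τ x => b 0 ((F.pt 0).ι x) * timeDeriv ρ τ ((F.pt 0).ι x)) hK t
      (fun τ => hbc.mul ((hρt τ).continuous.comp hιc)) (fun τ x => (htd' τ _).const_mul _)
      ((hbc.comp continuous_snd).mul htd) (fun τ x hx => by rw [hb0 x hx]; ring)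
      (integrable_of_continuous_of_compact hK (hbc.mul ((hρt t).continuous.comp hιc))
        (fun x hx => by rw [hb0 x hx]; ring))
    have h8 : (fun τ : ℝ => F.theta ρ p τ 0 (0, 1) (b 0)) = fun τ =>
        -∫ x, b 0 ((F.pt 0).ι x) * ρ τ ((F.pt 0).ι x) ∂(F.pt 0).μ := by
      funext τ
      rw [(hb.represents 0).theta_eq ρ τ]
      simp only [F.dens_zero, mul_one]
    rw [h8]
    exact h.2.fun_neg
  -- the integrand is the sum of the integrands of the four derivatives
  have hpt : ∀ x, defect (ρ t) (fun z => g z - hamiltonianG (ρ t) P z)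
      (fun x => r x - hamiltonianR ρ t P k (F.pt 0) x) (b 0) (rb 0) (F.pt 0) x
      = ((fderiv ℝ (fun s => b s ((F.pt s).ι x)) 0 (1, 0) * ρ t ((F.pt 0).ι x)
        + b 0 ((F.pt 0).ι x) * poisson (ρ t) (a 0) ((F.pt 0).ι x)
        + b 0 ((F.pt 0).ι x) * ρ t ((F.pt 0).ι x) * ra 0 x)
        - (fderiv ℝ (fun s => a s ((F.pt s).ι x)) 0 (0, 1) * ρ t ((F.pt 0).ι x)
        + a 0 ((F.pt 0).ι x) * poisson (ρ t) (b 0) ((F.pt 0).ι x)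
        + a 0 ((F.pt 0).ι x) * ρ t ((F.pt 0).ι x) * rb 0 x))
        - (b 0 ((F.pt 0).ι x) * k x + poisson P (b 0) ((F.pt 0).ι x)
          + P ((F.pt 0).ι x) * rb 0 x)
        + b 0 ((F.pt 0).ι x) * timeDeriv ρ t ((F.pt 0).ι x) := by
    intro x
    rw [defect_eq (hρt t) (h0 t) hP hg]
    have hc := SmoothFamily.generator_commutation ha hb 0 x
    have hc' := sub_eq_iff_eq_add.1 hc
    rw [hc']
    rcases hab x with ⟨h1, h2, h3⟩ | ⟨h1, h2, h3⟩
    · have h4 : ∀ f : Cotangent N Q → ℝ,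
          poisson f (a 0) ((F.pt 0).ι x) = poisson f g ((F.pt 0).ι x) :=
        fun f => by rw [poisson, h2]; rfl
      rw [poisson_antisymm (a 0) (b 0), h4, h4, h1, h3, poisson_antisymm g (b 0)]
      ring
    · have h4 : ∀ f : Cotangent N Q → ℝ,
          poisson f (b 0) ((F.pt 0).ι x) = 0 :=
        fun f => poisson_eq_zero h2
      simp only [h1, h3, h4]
      ring
  have iU1 : Integrable (fun x => b 0 ((F.pt 0).ι x) * k x) (F.pt 0).μ :=
    integrable_of_continuous_of_compact hK (hbc.mul hk) (fun x hx => by rw [hb0 x hx]; ring)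
  have iU2 : Integrable (fun x => poisson P (b 0) ((F.pt 0).ι x)) (F.pt 0).μ :=
    integrable_of_continuous_of_compact hK ((hP.poisson hbs).continuous.comp hιc)
      (fun x hx => poisson_eq_zero (hoff.hamField_eq_zero (hb.represents 0) hx))
  have iU3 : Integrable (fun x => P ((F.pt 0).ι x) * rb 0 x) (F.pt 0).μ :=
    integrable_of_continuous_of_compact hK
      ((hP.continuous.comp hιc).mul (hb.represents 0).continuous_dens)
      (fun x hx => by rw [hoff.dens_eq_zero (hb.represents 0) hx]; ring)
  have iV : Integrable (fun x => b 0 ((F.pt 0).ι x) * timeDeriv ρ t ((F.pt 0).ι x)) (F.pt 0).μ :=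
    integrable_of_continuous_of_compact hK (hbc.mul (htd.comp (Continuous.prodMk_right t)))
      (fun x hx => by rw [hb0 x hx]; ring)
  simp only [hpt]
  have hI := integral_sub_sub_add i1 i2 iU1 iU2 iU3 iV
  rw [hI]
  constructor
  · rintro ⟨dsθ, duθ, dH, dtθ, h1, h2, h3, h4, h5⟩
    rw [h1.unique d1, h2.unique d2, h3.unique d3, h4.unique d4] at h5
    linarith
  · intro h
    exact ⟨_, _, _, _, d1, d2, d3, d4, by linarith⟩

end Equation

/-! ### Compactly supported symplectic families of the model space -/

section Inversion

/-- A parametrized Lipschitz-small perturbation of the identity has a smooth parametrized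
inverse. -/
lemma exists_smooth_inverse {X E : Type*} [NormedAddCommGroup X] [NormedSpace ℝ X] [CompleteSpace X]
    [NormedAddCommGroup E] [NormedSpace ℝ E] [CompleteSpace E] {h : X × E → E}
    (hs : ContDiff ℝ ∞ h) {c : NNReal} (hc : c < 1) (hl : LipschitzWith c h) :
    ∃ m : X × E → E, ContDiff ℝ ∞ m ∧ (∀ x y, m (x, y) + h (x, m (x, y)) = y) ∧
      ∀ x y, m (x, y + h (x, y)) = y := by
  set f : X × E → X × E := fun q => (q.1, q.2 + h q) with hf
  have happ : ApproximatesLinearOn f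
      ((ContinuousLinearEquiv.refl ℝ (X × E) : (X × E) ≃L[ℝ] (X × E)) : (X × E) →L[ℝ] X × E)
      univ c := by
    intro q _ q' _
    have h1 : f q - f q' - (q - q') = (0, h q - h q') := by
      ext1
      · simp [f]
      · simp only [f, Prod.snd_sub]; abel
    have h2 := hl.dist_le_mul q q'
    rw [dist_eq_norm, dist_eq_norm] at h2
    simp only [ContinuousLinearEquiv.coe_refl, ContinuousLinearMap.coe_id', id_eq]
    rw [h1]
    simpa [Prod.norm_def] using h2
  have hcond : Subsingleton (X × E) ∨
      c < ‖((ContinuousLinearEquiv.refl ℝ (X × E)).symm : (X × E) →L[ℝ] (X × E))‖₊⁻¹ := by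
    rcases subsingleton_or_nontrivial (X × E) with hsub | hnt
    · exact Or.inl hsub
    · right
      simpa using hc
  set Hm := happ.toHomeomorph f hcond
  have hHm : ∀ q, Hm q = f q := fun q => rfl
  have hfs : ContDiff ℝ ∞ f := contDiff_fst.prodMk (contDiff_snd.add hs)
  have hder : ∀ q, ∃ u : (X × E) ≃L[ℝ] (X × E), HasFDerivAt f (u : (X × E) →L[ℝ] (X × E)) q := by
    intro q
    set T : (X × E) →L[ℝ] (X × E) := (0 : (X × E) →L[ℝ] X).prod (-(fderiv ℝ h q))
    have hT : ‖T‖ < 1 := by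
      have h1 : ‖fderiv ℝ h q‖ ≤ c := norm_fderiv_le_of_lipschitz ℝ hl
      refine lt_of_le_of_lt (ContinuousLinearMap.opNorm_le_bound _ (by positivity)
        (M := ‖fderiv ℝ h q‖) fun v => ?_) (lt_of_le_of_lt h1 (by exact_mod_cast hc))
      simpa [T, Prod.norm_def] using (fderiv ℝ h q).le_opNorm v
    refine ⟨ContinuousLinearEquiv.unitsEquiv ℝ (X × E) (Units.oneSub T hT), ?_⟩
    have h2 : HasFDerivAt f ((ContinuousLinearMap.fst ℝ X E).prod
        (ContinuousLinearMap.snd ℝ X E + fderiv ℝ h q)) q :=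
      hasFDerivAt_fst.prodMk (hasFDerivAt_snd.add (hs.differentiable (by simp) q).hasFDerivAt)
    convert h2 using 1
    ext v <;> simp [T, Units.oneSub]
  choose u hu using hder
  have hsymm : ContDiff ℝ ∞ Hm.symm := Hm.contDiff_symm (f₀' := u) hu hfs
  have hr : ∀ q, f (Hm.symm q) = q := fun q => Hm.apply_symm_apply q
  have hl' : ∀ q, Hm.symm (f q) = q := fun q => Hm.symm_apply_apply q
  refine ⟨fun q => (Hm.symm q).2, contDiff_snd.comp hsymm, fun x y => ?_, fun x y => ?_⟩
  · have h1 := hr (x, y)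
    have h2 : (Hm.symm (x, y)).1 = x := congrArg Prod.fst h1
    have h3 : (Hm.symm (x, y)).2 + h (Hm.symm (x, y)) = y := congrArg Prod.snd h1
    have h4 : Hm.symm (x, y) = (x, (Hm.symm (x, y)).2) := by ext1 <;> simp [h2]
    rw [h4] at h3
    exact h3
  · exact congrArg Prod.snd (hl' (x, y))

/-- The product of a bounded Lipschitz function of one variable with a bounded Lipschitz function
of the other is Lipschitz. -/
lemma exists_lipschitz_sin_smul {X E V : Type*} [NormedAddCommGroup X] [NormedAddCommGroup E]
    [NormedAddCommGroup V] [NormedSpace ℝ V] {l : X → ℝ} (hl : LipschitzWith 1 l)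
    {v : E → V} {c : NNReal} (hv : LipschitzWith c v) {B : ℝ} (hB : ∀ y, ‖v y‖ ≤ B) :
    ∃ c' : NNReal, LipschitzWith c' (fun q : X × E => Real.sin (l q.1) • v q.2) := by
  have hB0 : 0 ≤ B := (norm_nonneg _).trans (hB 0)
  refine ⟨B.toNNReal + c, LipschitzWith.of_dist_le_mul fun q q' => ?_⟩
  rw [dist_eq_norm]
  have e : Real.sin (l q.1) • v q.2 - Real.sin (l q'.1) • v q'.2
      = (Real.sin (l q.1) - Real.sin (l q'.1)) • v q.2 + Real.sin (l q'.1) • (v q.2 - v q'.2) := by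
    rw [sub_smul, smul_sub]; abel
  have h1 : |Real.sin (l q.1) - Real.sin (l q'.1)| ≤ dist q q' := by
    have h2 := Real.abs_sin_sub_sin_le (l q.1) (l q'.1)
    have h3 := hl.dist_le_mul q.1 q'.1
    rw [Real.dist_eq, NNReal.coe_one, one_mul] at h3
    exact h2.trans (h3.trans (le_max_left _ _))
  have h4 : ‖v q.2 - v q'.2‖ ≤ c * dist q q' := by
    rw [← dist_eq_norm]
    exact (hv.dist_le_mul _ _).trans (by gcongr; exact le_max_right _ _)
  rw [e]
  refine (norm_add_le _ _).trans ?_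
  rw [norm_smul, norm_smul, Real.norm_eq_abs, Real.norm_eq_abs]
  have h5 := Real.abs_sin_le_one (l q'.1)
  have h6 := hB q.2
  calc _ ≤ dist q q' * B + 1 * (c * dist q q') := by gcongr
    _ = _ := by rw [NNReal.coe_add, Real.coe_toNNReal _ hB0]; ring

end Inversion

section Generating
variable {N : ℕ}

/-- The Hamiltonian vector field of a function on `ℝᴺ × (ℝᴺ)*`. -/
def stdGrad (G : PhaseModel N → ℝ) (y : PhaseModel N) : PhaseModel N := stdHam (fderiv ℝ G y)

lemma contDiff_stdGrad {G : PhaseModel N → ℝ} (hG : ContDiff ℝ ∞ G) : ContDiff ℝ ∞ (stdGrad G) :=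
  stdHam.contDiff.comp (hG.fderiv_right (by simp))

lemma stdGrad_eq_zero {G : PhaseModel N → ℝ} {C : Set (PhaseModel N)} (hC : IsClosed C)
    (h : ∀ y ∉ C, G y = 0) {y : PhaseModel N} (hy : y ∉ C) : stdGrad G y = 0 := by
  have h1 : G =ᶠ[𝓝 y] fun _ => 0 := by
    filter_upwards [hC.isOpen_compl.mem_nhds hy] with z hz using h z hz
  rw [stdGrad, h1.fderiv_eq]
  simp

lemma exists_bound_lipschitz_stdGrad {G : PhaseModel N → ℝ} {C : Set (PhaseModel N)}
    (hC : IsCompact C) (hG : ContDiff ℝ ∞ G) (h : ∀ y ∉ C, G y = 0) :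
    (∃ B, ∀ y, ‖stdGrad G y‖ ≤ B) ∧ ∃ c, LipschitzWith c (stdGrad G) := by
  have hs : HasCompactSupport (stdGrad G) :=
    HasCompactSupport.intro hC fun y hy => stdGrad_eq_zero hC.isClosed h hy
  refine ⟨?_, (contDiff_stdGrad hG).lipschitzWith_of_hasCompactSupport hs (by simp)⟩
  obtain ⟨B, hB⟩ := hs.exists_bound_of_continuous (contDiff_stdGrad hG).continuous
  exact ⟨B, hB⟩

/-- A two-parameter family of compactly supported symplectic diffeomorphisms of `ℝᴺ × (ℝᴺ)*`.
`map` is the family, `inv` its inverse, `action` the primitive of `map^*(p dq) - p dq`, and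
`gen₁`, `gen₂` are the Hamiltonians that generate the motion in the two parameters. -/
structure SymplecticFamily (C : Set (PhaseModel N)) (G₁ G₂ : PhaseModel N → ℝ) where
  map : (ℝ × ℝ) × PhaseModel N → PhaseModel N
  inv : (ℝ × ℝ) × PhaseModel N → PhaseModel N
  action : (ℝ × ℝ) × PhaseModel N → ℝ
  gen₁ : (ℝ × ℝ) × PhaseModel N → ℝ
  gen₂ : (ℝ × ℝ) × PhaseModel N → ℝ
  smooth_map : ContDiff ℝ ∞ map
  smooth_inv : ContDiff ℝ ∞ inv
  smooth_action : ContDiff ℝ ∞ action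
  smooth_gen₁ : ContDiff ℝ ∞ gen₁
  smooth_gen₂ : ContDiff ℝ ∞ gen₂
  inv_map : ∀ l y, inv (l, map (l, y)) = y
  map_inv : ∀ l y, map (l, inv (l, y)) = y
  map_zero : ∀ y, map (0, y) = y
  action_zero : ∀ y, action (0, y) = 0
  gen₁_zero : ∀ y, gen₁ (0, y) = G₁ y
  gen₂_zero : ∀ y, gen₂ (0, y) = G₂ y
  map_off : ∀ l, ∀ y ∉ C, map (l, y) = y
  action_off : ∀ l, ∀ y ∉ C, action (l, y) = 0
  gen₁_off : ∀ l, ∀ y ∉ C, gen₁ (l, y) = 0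
  gen₂_off : ∀ l, ∀ y ∉ C, gen₂ (l, y) = 0
  fderiv_action : ∀ q W, fderiv ℝ action q W = (map q).2 (fderiv ℝ map q W).1 - q.2.2 W.2.1
    - W.1.1 * gen₁ (q.1, map q) - W.1.2 * gen₂ (q.1, map q)

set_option maxHeartbeats 1000000 in
/-- Construction from the generating function
`S = δ (sin (l₁ / δ) G₁ + sin (l₂ / δ) G₂)` of `(q, P)`: the map sends `(q, P + ∂S/∂q)` to
`(q + ∂S/∂P, P)`. For small `δ` these relations can be solved, since `sin` keeps `S` small for all
parameters; by the Hamilton-Jacobi equation the generators are `cos (lᵢ / δ) Gᵢ`, as functions of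
`(q, P)`. -/
theorem exists_symplecticFamily {G₁ G₂ : PhaseModel N → ℝ} {C : Set (PhaseModel N)}
    (hC : IsCompact C) (hG₁ : ContDiff ℝ ∞ G₁) (hG₂ : ContDiff ℝ ∞ G₂)
    (h₁ : ∀ y ∉ C, G₁ y = 0) (h₂ : ∀ y ∉ C, G₂ y = 0) :
    Nonempty (SymplecticFamily C G₁ G₂) := by
  obtain ⟨⟨B₁, hB₁⟩, c₁, hc₁⟩ := exists_bound_lipschitz_stdGrad hC hG₁ h₁
  obtain ⟨⟨B₂, hB₂⟩, c₂, hc₂⟩ := exists_bound_lipschitz_stdGrad hC hG₂ h₂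
  obtain ⟨d₁, hd₁⟩ := exists_lipschitz_sin_smul (X := ℝ × ℝ) LipschitzWith.prod_fst hc₁ hB₁
  obtain ⟨d₂, hd₂⟩ := exists_lipschitz_sin_smul (X := ℝ × ℝ) LipschitzWith.prod_snd hc₂ hB₂
  -- the field `X_S` for the rescaled parameters, without the factor `δ`
  set V : (ℝ × ℝ) × PhaseModel N → PhaseModel N := fun q =>
    Real.sin q.1.1 • stdGrad G₁ q.2 + Real.sin q.1.2 • stdGrad G₂ q.2 with hV
  have hVl : LipschitzWith (d₁ + d₂) V := hd₁.add hd₂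
  have hVs : ContDiff ℝ ∞ V :=
    ((Real.contDiff_sin.comp (contDiff_fst.comp contDiff_fst)).smul
      ((contDiff_stdGrad hG₁).comp contDiff_snd)).add
    ((Real.contDiff_sin.comp (contDiff_snd.comp contDiff_fst)).smul
      ((contDiff_stdGrad hG₂).comp contDiff_snd))
  set δ : NNReal := (2 * (d₁ + d₂ + 1))⁻¹ with hδ
  have hδ0 : 0 < δ := by positivity
  have hδ1 : δ * (d₁ + d₂) < 1 := by
    rw [hδ, inv_mul_lt_iff₀ (by positivity), mul_one]
    have : 0 ≤ d₁ + d₂ := by positivity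
    calc d₁ + d₂ < d₁ + d₂ + 1 := lt_add_one _
      _ ≤ 2 * (d₁ + d₂ + 1) := by rw [two_mul]; exact le_add_of_nonneg_left (by positivity)
  set hA : (ℝ × ℝ) × PhaseModel N → PhaseModel N :=
    fun q => ((0 : Rn N), -((δ : ℝ) • (V q).2)) with hhA
  set hB : (ℝ × ℝ) × PhaseModel N → PhaseModel N :=
    fun q => ((δ : ℝ) • (V q).1, (0 : Rn N →L[ℝ] ℝ)) with hhB
  have hAs : ContDiff ℝ ∞ hA := contDiff_const.prodMk (hVs.snd.const_smul (δ : ℝ)).neg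
  have hBs : ContDiff ℝ ∞ hB := (hVs.fst.const_smul (δ : ℝ)).prodMk contDiff_const
  have hAl : LipschitzWith (δ * (d₁ + d₂)) hA := LipschitzWith.of_dist_le_mul fun q q' => by
    have h1 := hVl.dist_le_mul q q'
    have h2 : dist (hA q) (hA q') = δ * dist (V q).2 (V q').2 := by
      change max (dist (0 : Rn N) 0) (dist (-((δ : ℝ) • (V q).2)) (-((δ : ℝ) • (V q').2))) = _
      have h3 : dist ((δ : ℝ) • (V q).2) ((δ : ℝ) • (V q').2)
          = ‖(δ : ℝ)‖ * dist (V q).2 (V q').2 := by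
        rw [dist_eq_norm, dist_eq_norm,
          show (δ : ℝ) • (V q).2 - (δ : ℝ) • (V q').2 = (δ : ℝ) • ((V q).2 - (V q').2) from
            (smul_sub _ _ _).symm]
        exact norm_smul _ _
      rw [dist_self, dist_neg_neg, h3, Real.norm_of_nonneg δ.coe_nonneg]
      exact max_eq_right (by positivity)
    rw [h2, NNReal.coe_mul, mul_assoc]
    gcongr
    exact (le_max_right _ _).trans h1
  have hBl : LipschitzWith (δ * (d₁ + d₂)) hB := LipschitzWith.of_dist_le_mul fun q q' => by
    have h1 := hVl.dist_le_mul q q'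
    have h2 : dist (hB q) (hB q') = δ * dist (V q).1 (V q').1 := by
      change max (dist ((δ : ℝ) • (V q).1) ((δ : ℝ) • (V q').1)) (dist (0 : Rn N →L[ℝ] ℝ) 0) = _
      rw [dist_self, dist_smul₀, Real.norm_of_nonneg δ.coe_nonneg]
      exact max_eq_left (by positivity)
    rw [h2, NNReal.coe_mul, mul_assoc]
    gcongr
    exact (le_max_left _ _).trans h1
  obtain ⟨m₁, m₁s, m₁r, m₁l⟩ := exists_smooth_inverse hAs hδ1 hAl
  obtain ⟨m₂, m₂s, m₂r, m₂l⟩ := exists_smooth_inverse hBs hδ1 hBl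
  have hV0 : ∀ l, ∀ y ∉ C, V (l, y) = 0 := fun l y hy => by
    simp [V, stdGrad_eq_zero hC.isClosed h₁ hy, stdGrad_eq_zero hC.isClosed h₂ hy]
  have m₁off : ∀ l, ∀ y ∉ C, m₁ (l, y) = y := fun l y hy => by
    
    have h : hA (l, y) = 0 := by ext1 <;> simp [hA, hV0 l y hy]
    simpa [h] using m₁l l y
  have m₂off : ∀ l, ∀ y ∉ C, m₂ (l, y) = y := fun l y hy => by
    
    have h : hB (l, y) = 0 := by ext1 <;> simp [hB, hV0 l y hy]
    simpa [h] using m₂l l y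
  have hVz : ∀ y, V (0, y) = 0 := fun y => by simp [V]
  have m₁z : ∀ y, m₁ (0, y) = y := fun y => by
    have h : hA (0, y) = 0 := by ext1 <;> simp [hA, hVz y]
    simpa [h] using m₁l 0 y
  have m₂z : ∀ y, m₂ (0, y) = y := fun y => by
    have h : hB (0, y) = 0 := by ext1 <;> simp [hB, hVz y]
    simpa [h] using m₂l 0 y
  -- rescaling of the parameters
  set σ : ℝ × ℝ → ℝ × ℝ := fun l => ((δ : ℝ)⁻¹) • l with hσ
  have hσs : ContDiff ℝ ∞ σ := contDiff_id.const_smul _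
  set m : (ℝ × ℝ) × PhaseModel N → PhaseModel N := fun q => m₁ (σ q.1, q.2) with hm
  have hσq : ContDiff ℝ ∞ (fun q : (ℝ × ℝ) × PhaseModel N => (σ q.1, q.2)) :=
    (hσs.comp contDiff_fst).prodMk contDiff_snd
  have hms : ContDiff ℝ ∞ m := m₁s.comp hσq
  set S : (ℝ × ℝ) × PhaseModel N → ℝ := fun q =>
    (δ : ℝ) * (Real.sin (σ q.1).1 * G₁ q.2 + Real.sin (σ q.1).2 * G₂ q.2) with hS
  set X : (ℝ × ℝ) × PhaseModel N → PhaseModel N := fun q => (δ : ℝ) • V (σ q.1, m q) with hX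
  have hXs : ContDiff ℝ ∞ X := (hVs.comp ((hσs.comp contDiff_fst).prodMk hms)).const_smul _
  have hσ1 : ContDiff ℝ ∞ fun q : (ℝ × ℝ) × PhaseModel N => (σ q.1).1 := (hσs.comp contDiff_fst).fst
  have hσ2 : ContDiff ℝ ∞ fun q : (ℝ × ℝ) × PhaseModel N => (σ q.1).2 := (hσs.comp contDiff_fst).snd
  have hSs : ContDiff ℝ ∞ S :=
    contDiff_const.mul (((Real.contDiff_sin.comp hσ1).mul (hG₁.comp contDiff_snd)).add
      ((Real.contDiff_sin.comp hσ2).mul (hG₂.comp contDiff_snd)))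
  have hmX : ∀ q, m q + ((0 : Rn N), -(X q).2) = q.2 := fun q => by
    simpa [hA, X, m] using m₁r (σ q.1) q.2
  have hq1 : ∀ q, (m q).1 = q.2.1 := fun q => by simpa using congrArg Prod.fst (hmX q)
  have hq2 : ∀ q, (m q).2 - (X q).2 = q.2.2 := fun q => by
    simpa [sub_eq_add_neg] using congrArg Prod.snd (hmX q)
  have hmB : ∀ l y, m (l, y) + ((X (l, y)).1, (0 : Rn N →L[ℝ] ℝ))
      = m (l, y) + hB (σ l, m (l, y)) := fun l y => rfl
  have hk : ∀ l y, m₂ (σ l, m (l, y) + ((X (l, y)).1, (0 : Rn N →L[ℝ] ℝ))) = m (l, y) :=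
    fun l y => by rw [hmB]; exact m₂l _ _
  have hmi : ∀ l y, m (l, m₂ (σ l, y) + hA (σ l, m₂ (σ l, y))) = m₂ (σ l, y) := fun l y => m₁l _ _
  have hσ0 : σ 0 = 0 := smul_zero _
  have hm0 : ∀ y, m (0, y) = y := fun y => by simp only [m, hσ0, m₁z]
  have hX0 : ∀ y, X (0, y) = 0 := fun y => by simp only [X, hσ0, hVz, smul_zero]
  have hmo : ∀ l, ∀ y ∉ C, m (l, y) = y := fun l y hy => m₁off _ y hy
  have hXo : ∀ l, ∀ y ∉ C, X (l, y) = 0 := fun l y hy => by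
    simp only [X, hmo l y hy, hV0 _ y hy, smul_zero]
  refine ⟨{
    map := fun q => m q + ((X q).1, (0 : Rn N →L[ℝ] ℝ))
    inv := fun q => m₂ (σ q.1, q.2) + hA (σ q.1, m₂ (σ q.1, q.2))
    action := fun q => (m q).2 (X q).1 - S (q.1, m q)
    gen₁ := fun q => Real.cos (σ q.1).1 * G₁ (m₂ (σ q.1, q.2))
    gen₂ := fun q => Real.cos (σ q.1).2 * G₂ (m₂ (σ q.1, q.2))
    smooth_map := hms.add (hXs.fst.prodMk contDiff_const)
    smooth_inv := (m₂s.comp hσq).add (hAs.comp ((hσs.comp contDiff_fst).prodMk (m₂s.comp hσq)))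
    smooth_action := (hms.snd.clm_apply hXs.fst).sub (hSs.comp (contDiff_fst.prodMk hms))
    smooth_gen₁ := (Real.contDiff_cos.comp hσ1).mul (hG₁.comp (m₂s.comp hσq))
    smooth_gen₂ := (Real.contDiff_cos.comp hσ2).mul (hG₂.comp (m₂s.comp hσq))
    inv_map := ?_
    map_inv := ?_
    map_zero := ?_
    action_zero := ?_
    gen₁_zero := ?_
    gen₂_zero := ?_
    map_off := ?_
    action_off := ?_
    gen₁_off := ?_
    gen₂_off := ?_
    fderiv_action := ?_ }⟩
  · intro l y
    dsimp only
    rw [hk]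
    exact m₁r _ _
  · intro l y
    dsimp only
    rw [hmB, hmi]
    exact m₂r _ _
  · intro y
    simp [hm0, hX0]
  · intro y
    simp [hX0, S, hσ0]
  · intro y
    simp [hσ0, m₂z]
  · intro y
    simp [hσ0, m₂z]
  · intro l y hy
    simp [hmo l y hy, hXo l y hy]
  · intro l y hy
    simp [hmo l y hy, hXo l y hy, S, h₁ y hy, h₂ y hy]
  · intro l y hy
    simp [m₂off _ y hy, h₁ y hy]
  · intro l y hy
    simp [m₂off _ y hy, h₂ y hy]
  · intro q W
    have dm : HasFDerivAt m (fderiv ℝ m q) q := (hms.differentiable (by simp) q).hasFDerivAt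
    have dX : HasFDerivAt X (fderiv ℝ X q) q := (hXs.differentiable (by simp) q).hasFDerivAt
    have dmap : HasFDerivAt (fun q => m q + ((X q).1, (0 : Rn N →L[ℝ] ℝ))) _ q :=
      dm.fun_add (dX.fst.prodMk (hasFDerivAt_const _ _))
    have dsin₁ : HasFDerivAt (fun l : ℝ × ℝ => Real.sin (σ l).1) _ q.1 :=
      ((hasFDerivAt_id q.1).const_smul ((δ : ℝ)⁻¹)).fst.sin
    have dsin₂ : HasFDerivAt (fun l : ℝ × ℝ => Real.sin (σ l).2) _ q.1 :=
      ((hasFDerivAt_id q.1).const_smul ((δ : ℝ)⁻¹)).snd.sin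
    have dG₁ := (hG₁.differentiable (by simp) (m q)).hasFDerivAt
    have dG₂ := (hG₂.differentiable (by simp) (m q)).hasFDerivAt
    have dS : HasFDerivAt (fun q => S (q.1, m q)) _ q :=
      (((dsin₁.comp q hasFDerivAt_fst).fun_mul (dG₁.comp q dm)).fun_add
        ((dsin₂.comp q hasFDerivAt_fst).fun_mul (dG₂.comp q dm))).const_mul (δ : ℝ)
    have dact : HasFDerivAt (fun q => (m q).2 (X q).1 - S (q.1, m q)) _ q :=
      (dm.snd.clm_apply dX.fst).fun_sub dS
    have e1 : (fderiv ℝ m q W).1 = W.2.1 := by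
      have h : (fun q => (m q).1) = fun q : (ℝ × ℝ) × PhaseModel N => q.2.1 := funext hq1
      have h' := dm.fst
      rw [h] at h'
      have := h'.unique (hasFDerivAt_snd (p := q)).fst
      exact congrArg (fun T => T W) this
    -- `dS` along the fibre is `ω(X_S, ·)`
    have e2 : (δ : ℝ) * (Real.sin (σ q.1).1 * fderiv ℝ G₁ (m q) (fderiv ℝ m q W)
        + Real.sin (σ q.1).2 * fderiv ℝ G₂ (m q) (fderiv ℝ m q W))
        = (fderiv ℝ m q W).2 (X q).1 - (X q).2 (fderiv ℝ m q W).1 := by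
      have a1 := stdForm_stdHam (fderiv ℝ G₁ (m q)) (fderiv ℝ m q W)
      have a2 := stdForm_stdHam (fderiv ℝ G₂ (m q)) (fderiv ℝ m q W)
      rw [← a1, ← a2]
      simp [X, V, stdForm, stdGrad]
      ring
    have hδ' : (δ : ℝ) * (δ : ℝ)⁻¹ = 1 := mul_inv_cancel₀ (by exact_mod_cast hδ0.ne')
    rw [dact.fderiv, dmap.fderiv]
    have hkq := hk q.1 q.2
    have hq2' := hq2 q
    simp only [Prod.mk.eta] at hkq
    dsimp only
    rw [hkq, ← hq2']
    simp only [sub_apply, add_apply, smul_apply, ContinuousLinearMap.comp_apply,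
      ContinuousLinearMap.flip_apply, ContinuousLinearMap.prod_apply, smul_eq_mul,
      Function.comp_apply, ContinuousLinearMap.coe_fst', ContinuousLinearMap.coe_snd', zero_apply,
      ContinuousLinearMap.coe_id', id_eq]
    simp only [Prod.snd_add, Prod.fst_add, Prod.smul_fst, Prod.smul_snd, smul_eq_mul, map_add,
      add_zero, e1] at e2 ⊢
    linear_combination -e2 - (G₁ (m q) * Real.cos (σ q.1).1 * W.1.1
      + G₂ (m q) * Real.cos (σ q.1).2 * W.1.2) * hδ'

end Generating

/-! ### Transfer to the cotangent bundle -/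

section Flat
variable {N : ℕ} {C : Set (PhaseModel N)} {G₁ G₂ : PhaseModel N → ℝ}

namespace SymplecticFamily
variable (Φ : SymplecticFamily C G₁ G₂)

/-- The Hamiltonian that generates the motion in the direction `e` of the parameter space. -/
def gen (e : ℝ × ℝ) (q : (ℝ × ℝ) × PhaseModel N) : ℝ := e.1 * Φ.gen₁ q + e.2 * Φ.gen₂ q

lemma smooth_gen (e : ℝ × ℝ) : ContDiff ℝ ∞ (Φ.gen e) :=
  (contDiff_const.mul Φ.smooth_gen₁).add (contDiff_const.mul Φ.smooth_gen₂)

lemma gen_off (e l : ℝ × ℝ) {y : PhaseModel N} (hy : y ∉ C) : Φ.gen e (l, y) = 0 := by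
  simp [gen, Φ.gen₁_off l y hy, Φ.gen₂_off l y hy]

lemma inv_off (l : ℝ × ℝ) (y : PhaseModel N) (hy : y ∉ C) : Φ.inv (l, y) = y := by
  have := Φ.inv_map l y
  rwa [Φ.map_off l y hy] at this

lemma map_mem (l : ℝ × ℝ) {y : PhaseModel N} (hy : y ∈ C) : Φ.map (l, y) ∈ C := by
  by_contra h
  have h1 := Φ.inv_off l _ h
  rw [Φ.inv_map] at h1
  exact h (h1 ▸ hy)

lemma inv_mem (l : ℝ × ℝ) {y : PhaseModel N} (hy : y ∈ C) : Φ.inv (l, y) ∈ C := by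
  by_contra h
  have h1 := Φ.map_off l _ h
  rw [Φ.map_inv] at h1
  exact h (h1 ▸ hy)

lemma hasFDerivAt_map (q : (ℝ × ℝ) × PhaseModel N) :
    HasFDerivAt Φ.map (fderiv ℝ Φ.map q) q :=
  (Φ.smooth_map.differentiable (by simp) q).hasFDerivAt

/-- The exterior derivative of the identity `fderiv_action`. -/
lemma stdForm_fderiv_map (q V W : (ℝ × ℝ) × PhaseModel N) :
    stdForm (fderiv ℝ Φ.map q V) (fderiv ℝ Φ.map q W) = stdForm V.2 W.2
      + fderiv ℝ (fun q => Φ.gen V.1 (q.1, Φ.map q)) q W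
      - fderiv ℝ (fun q => Φ.gen W.1 (q.1, Φ.map q)) q V := by
  have hA : HasFDerivAt (fderiv ℝ Φ.action) (fderiv ℝ (fderiv ℝ Φ.action) q) q :=
    ((Φ.smooth_action.fderiv_right (m := 1) (by norm_num; exact two_le_infty)).differentiable
      (by simp) q).hasFDerivAt
  have hsym : IsSymmSndFDerivAt ℝ Φ.action q :=
    Φ.smooth_action.contDiffAt.isSymmSndFDerivAt (by simpa using two_le_infty)
  have hg : ∀ e, DifferentiableAt ℝ (fun q => Φ.gen e (q.1, Φ.map q)) q := fun e =>
    ((Φ.smooth_gen e).comp (contDiff_fst.prodMk Φ.smooth_map)).differentiable (by simp) q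
  have key : ∀ U : (ℝ × ℝ) × PhaseModel N, ∀ U',
      fderiv ℝ (fun x => (Φ.map x).2 (fderiv ℝ Φ.map x U).1) q U'
      = fderiv ℝ (fderiv ℝ Φ.action) q U' U + U'.2.2 U.2.1
        + fderiv ℝ (fun q => Φ.gen U.1 (q.1, Φ.map q)) q U' := by
    intro U U'
    have e : (fun x => (Φ.map x).2 (fderiv ℝ Φ.map x U).1)
        = fun x => fderiv ℝ Φ.action x U + x.2.2 U.2.1 + Φ.gen U.1 (x.1, Φ.map x) := by
      funext x
      rw [Φ.fderiv_action x U, gen]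
      ring
    have h1 := ((hA.clm_apply (hasFDerivAt_const U q)).fun_add
      ((hasFDerivAt_snd (𝕜 := ℝ) (p := q)).snd.clm_apply (hasFDerivAt_const U.2.1 q))).fun_add
        (hg U.1).hasFDerivAt
    rw [e, h1.fderiv]
    simp
  have h := fderiv_pullback_liouville_antisymm Φ.smooth_map.contDiffAt V W (x := q)
  rw [key, key, hsym V W] at h
  simp only [stdForm] at h ⊢
  linarith

/-- The maps are symplectic. -/
lemma stdForm_fderiv_map_snd (q : (ℝ × ℝ) × PhaseModel N) (v w : PhaseModel N) :
    stdForm (fderiv ℝ Φ.map q (0, v)) (fderiv ℝ Φ.map q (0, w)) = stdForm v w := by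
  have h0 : (fun q => Φ.gen 0 (q.1, Φ.map q)) = fun _ => 0 := by funext q; simp [gen]
  rw [stdForm_fderiv_map]
  simp [h0]

/-- Hamilton's equations for the dependence on the parameters. -/
lemma fderiv_map_fst (q : (ℝ × ℝ) × PhaseModel N) (e : ℝ × ℝ) :
    fderiv ℝ Φ.map q (e, 0) = stdHam (fderiv ℝ (fun y => Φ.gen e (q.1, y)) (Φ.map q)) := by
  refine eq_stdHam fun w => ?_
  obtain ⟨w', rfl⟩ : ∃ w', fderiv ℝ Φ.map q (0, w') = w := by
    have h1 : HasFDerivAt (fun y => Φ.map (q.1, Φ.inv (q.1, y))) _ (Φ.map q) :=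
      HasFDerivAt.comp (Φ.map q) (g := Φ.map) (f := fun y => (q.1, Φ.inv (q.1, y)))
        (Φ.hasFDerivAt_map _) ((hasFDerivAt_const q.1 _).prodMk
          (Φ.smooth_inv.comp (contDiff_const.prodMk contDiff_id)
            |>.differentiable (by simp) (Φ.map q)).hasFDerivAt)
    have h2 : (fun y => Φ.map (q.1, Φ.inv (q.1, y))) = id := funext fun y => Φ.map_inv q.1 y
    rw [h2] at h1
    have h3 := congrArg (fun T => T w) (h1.unique (hasFDerivAt_id _))
    have h4 : (q.1, Φ.inv (q.1, Φ.map q)) = q := by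
      ext1
      · rfl
      · exact Φ.inv_map q.1 q.2
    rw [h4] at h3
    exact ⟨_, by simpa using h3⟩
  have h0 : (fun q => Φ.gen 0 (q.1, Φ.map q)) = fun _ => 0 := by funext q; simp [gen]
  have hg : HasFDerivAt (Φ.gen e) (fderiv ℝ (Φ.gen e) (q.1, Φ.map q)) (q.1, Φ.map q) :=
    ((Φ.smooth_gen e).differentiable (by simp) _).hasFDerivAt
  have h1 : HasFDerivAt (fun q => Φ.gen e (q.1, Φ.map q)) _ q :=
    HasFDerivAt.comp q (f := fun q : (ℝ × ℝ) × PhaseModel N => (q.1, Φ.map q)) hg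
      (hasFDerivAt_fst.prodMk (Φ.hasFDerivAt_map q))
  have h2 : HasFDerivAt (fun y => Φ.gen e (q.1, y)) _ (Φ.map q) :=
    HasFDerivAt.comp (Φ.map q) (f := fun y => (q.1, y)) hg (hasFDerivAt_prodMk_right q.1 (Φ.map q))
  rw [stdForm_fderiv_map, h1.fderiv, h2.fderiv]
  simp [h0, stdForm]

end SymplecticFamily
end Flat

section Transplant
variable {N : ℕ} {Q : Type*} [TopologicalSpace Q] [ChartedSpace (Rn N) Q] [IsManifold (𝓡 N) ∞ Q]

instance instT2SpaceCotangent [T2Space Q] : T2Space (Cotangent N Q) := by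
  have hc : Continuous (fun z : Cotangent N Q => z.1) := FiberBundle.continuous_proj _ _
  refine ⟨fun z w hzw => ?_⟩
  by_cases h : z.1 = w.1
  · set e := chartAt (ModelProd (Rn N) (Rn N →L[ℝ] ℝ)) z
    have hz : z ∈ (extChartAt (cot N) z).source := mem_extChartAt_source z
    have hw : w ∈ (extChartAt (cot N) z).source := by
      rw [mem_source_cotangent, ← h]
      exact mem_extChartAt_source z.1
    rw [extChartAt_source] at hz hw
    have hne : e z ≠ e w := fun h' => hzw (e.injOn hz hw h')
    have : T2Space (ModelProd (Rn N) (Rn N →L[ℝ] ℝ)) :=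
      inferInstanceAs (T2Space (Rn N × (Rn N →L[ℝ] ℝ)))
    obtain ⟨u, v, hu, hv, hzu, hwv, huv⟩ := t2_separation hne
    exact ⟨_, _, e.isOpen_inter_preimage hu, e.isOpen_inter_preimage hv, ⟨hz, hzu⟩, ⟨hw, hwv⟩,
      disjoint_left.2 fun x hx hx' => disjoint_left.1 huv hx.2 hx'.2⟩
  · obtain ⟨u, v, hu, hv, hzu, hwv, huv⟩ := t2_separation h
    exact ⟨_, _, hu.preimage hc, hv.preimage hc, hzu, hwv, huv.preimage _⟩

variable {X : Type*} [NormedAddCommGroup X] [NormedSpace ℝ X] (z₀ : Cotangent N Q)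
  {C : Set (PhaseModel N)}

open scoped Classical in
/-- A family of functions of the coordinates at `z₀`, extended by zero to `T*Q`. -/
def extZero (u : X × PhaseModel N → ℝ) (q : X × Cotangent N Q) : ℝ :=
  if q.2 ∈ (extChartAt (cot N) z₀).source then u (q.1, extChartAt (cot N) z₀ q.2) else 0

open scoped Classical in
/-- A family of maps of the coordinates at `z₀`, extended by the identity to `T*Q`. -/
def extId (f : X × PhaseModel N → PhaseModel N) (q : X × Cotangent N Q) : Cotangent N Q :=
  if q.2 ∈ (extChartAt (cot N) z₀).source then
    (extChartAt (cot N) z₀).symm (f (q.1, extChartAt (cot N) z₀ q.2)) else q.2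

variable {z₀} {u : X × PhaseModel N → ℝ} {f : X × PhaseModel N → PhaseModel N}

lemma extZero_of_mem {q : X × Cotangent N Q} (hq : q.2 ∈ (extChartAt (cot N) z₀).source) :
    extZero z₀ u q = u (q.1, extChartAt (cot N) z₀ q.2) := if_pos hq

lemma extId_of_mem {q : X × Cotangent N Q} (hq : q.2 ∈ (extChartAt (cot N) z₀).source) :
    extId z₀ f q = (extChartAt (cot N) z₀).symm (f (q.1, extChartAt (cot N) z₀ q.2)) := if_pos hq

/-- A function of the coordinates at `z₀`, extended by zero to `T*Q`. -/
def extFun (z₀ : Cotangent N Q) (G : PhaseModel N → ℝ) (z : Cotangent N Q) : ℝ :=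
  extZero z₀ (fun q : ℝ × PhaseModel N => G q.2) (0, z)

lemma extFun_of_mem {z : Cotangent N Q} (hz : z ∈ (extChartAt (cot N) z₀).source)
    (G : PhaseModel N → ℝ) : extFun z₀ G z = G (extChartAt (cot N) z₀ z) := extZero_of_mem hz

lemma extFun_of_notMem {z : Cotangent N Q} (hz : z ∉ (extChartAt (cot N) z₀).source)
    (G : PhaseModel N → ℝ) : extFun z₀ G z = 0 := if_neg hz

/-- The set of points of `T*Q` with coordinates in `C`. -/
abbrev liftSet (z₀ : Cotangent N Q) (C : Set (PhaseModel N)) : Set (Cotangent N Q) :=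
  (extChartAt (cot N) z₀).symm '' C

lemma isCompact_liftSet (hC : IsCompact C) (hCt : C ⊆ (extChartAt (cot N) z₀).target) :
    IsCompact (liftSet z₀ C) :=
  hC.image_of_continuousOn ((continuousOn_extChartAt_symm z₀).mono hCt)

lemma mem_liftSet (hCt : C ⊆ (extChartAt (cot N) z₀).target) {z : Cotangent N Q} :
    z ∈ liftSet z₀ C ↔ z ∈ (extChartAt (cot N) z₀).source ∧ extChartAt (cot N) z₀ z ∈ C := by
  constructor
  · rintro ⟨y, hy, rfl⟩
    exact ⟨(extChartAt (cot N) z₀).map_target (hCt hy),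
      by rwa [(extChartAt (cot N) z₀).right_inv (hCt hy)]⟩
  · rintro ⟨h1, h2⟩
    exact ⟨_, h2, (extChartAt (cot N) z₀).left_inv h1⟩

lemma extZero_off (hCt : C ⊆ (extChartAt (cot N) z₀).target) (hu : ∀ l, ∀ y ∉ C, u (l, y) = 0)
    {l : X} {z : Cotangent N Q} (hz : z ∉ liftSet z₀ C) : extZero z₀ u (l, z) = 0 := by
  unfold extZero
  split_ifs with h
  · exact hu _ _ fun h' => hz ((mem_liftSet hCt).2 ⟨h, h'⟩)
  · rfl

lemma extId_off (hCt : C ⊆ (extChartAt (cot N) z₀).target) (hf : ∀ l, ∀ y ∉ C, f (l, y) = y) {l : X}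
    {z : Cotangent N Q} (hz : z ∉ liftSet z₀ C) : extId z₀ f (l, z) = z := by
  unfold extId
  split_ifs with h
  · rw [hf _ _ fun h' => hz ((mem_liftSet hCt).2 ⟨h, h'⟩)]
    exact (extChartAt (cot N) z₀).left_inv h
  · rfl

lemma apply_mem_target (hCt : C ⊆ (extChartAt (cot N) z₀).target) (hf : ∀ l, ∀ y ∉ C, f (l, y) = y)
    (hfC : ∀ l, ∀ y ∈ C, f (l, y) ∈ C) (l : X) {y : PhaseModel N}
    (hy : y ∈ (extChartAt (cot N) z₀).target) : f (l, y) ∈ (extChartAt (cot N) z₀).target := by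
  by_cases h : y ∈ C
  · exact hCt (hfC l y h)
  · rwa [hf l y h]

lemma contMDiffAt_coord {z : Cotangent N Q} (hz : z ∈ (extChartAt (cot N) z₀).source) (l : X) :
    ContMDiffAt (𝓘(ℝ, X).prod (cot N)) 𝓘(ℝ, X × PhaseModel N) ∞
      (fun q : X × Cotangent N Q => (q.1, extChartAt (cot N) z₀ q.2)) (l, z) :=
  contMDiffAt_fst.prodMk_space
    ((contMDiffAt_extChartAt' (by simpa using hz)).comp (l, z) contMDiffAt_snd)

lemma eventually_snd_mem {z : Cotangent N Q} {O : Set (Cotangent N Q)} (hO : IsOpen O)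
    (hz : z ∈ O) (l : X) :
    ∀ᶠ q : X × Cotangent N Q in 𝓝 (l, z), q.2 ∈ O :=
  continuous_snd.continuousAt.eventually (hO.mem_nhds hz)

variable [T2Space Q]

lemma contMDiff_extZero (hC : IsCompact C) (hCt : C ⊆ (extChartAt (cot N) z₀).target)
    (hu : ContDiff ℝ ∞ u) (hu0 : ∀ l, ∀ y ∉ C, u (l, y) = 0) :
    ContMDiff (𝓘(ℝ, X).prod (cot N)) 𝓘(ℝ, ℝ) ∞ (extZero z₀ u) := by
  rintro ⟨l, z⟩
  by_cases hz : z ∈ (extChartAt (cot N) z₀).source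
  · refine (hu.contMDiff.contMDiffAt.comp (l, z) (contMDiffAt_coord hz l)).congr_of_eventuallyEq ?_
    filter_upwards [eventually_snd_mem (isOpen_extChartAt_source z₀) hz l] with q hq
    exact extZero_of_mem hq
  · have h : z ∉ liftSet z₀ C := fun h => hz ((mem_liftSet hCt).1 h).1
    refine (contMDiffAt_const (c := (0 : ℝ))).congr_of_eventuallyEq ?_
    filter_upwards [eventually_snd_mem (isCompact_liftSet hC hCt).isClosed.isOpen_compl h l]
      with q hq
    exact extZero_off hCt hu0 hq

lemma contMDiff_extId (hC : IsCompact C) (hCt : C ⊆ (extChartAt (cot N) z₀).target)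
    (hf : ContDiff ℝ ∞ f) (hf0 : ∀ l, ∀ y ∉ C, f (l, y) = y) (hfC : ∀ l, ∀ y ∈ C, f (l, y) ∈ C) :
    ContMDiff (𝓘(ℝ, X).prod (cot N)) (cot N) ∞ (extId z₀ f) := by
  rintro ⟨l, z⟩
  by_cases hz : z ∈ (extChartAt (cot N) z₀).source
  · have h1 := ((contMDiffOn_extChartAt_symm (I := cot N) (n := ∞) z₀).contMDiffAt
      ((isOpen_extChartAt_target z₀).mem_nhds (apply_mem_target hCt hf0 hfC l
        ((extChartAt (cot N) z₀).map_source hz))))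
    refine (ContMDiffAt.comp (l, z) h1
      (hf.contMDiff.contMDiffAt.comp (l, z) (contMDiffAt_coord hz l))).congr_of_eventuallyEq ?_
    filter_upwards [eventually_snd_mem (isOpen_extChartAt_source z₀) hz l] with q hq
    exact extId_of_mem hq
  · have h : z ∉ liftSet z₀ C := fun h => hz ((mem_liftSet hCt).1 h).1
    refine (contMDiffAt_snd (M := X) (N := Cotangent N Q)).congr_of_eventuallyEq ?_
    filter_upwards [eventually_snd_mem (isCompact_liftSet hC hCt).isClosed.isOpen_compl h l]
      with q hq
    exact extId_off hCt hf0 hq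

lemma smooth_extFun (hC : IsCompact C)
    (hCt : C ⊆ (extChartAt (cot N) z₀).target) {G : PhaseModel N → ℝ} (hG : ContDiff ℝ ∞ G)
    (hG0 : ∀ y ∉ C, G y = 0) : Smooth (extFun z₀ G) :=
  (contMDiff_extZero hC hCt (hG.comp contDiff_snd) fun _ y hy => hG0 y hy).comp
    (contMDiff_const.prodMk contMDiff_id)

end Transplant

/-! ### Symplectic families of the cotangent bundle -/

section Lift
variable {N : ℕ} {Q : Type*} [TopologicalSpace Q] [ChartedSpace (Rn N) Q] [IsManifold (𝓡 N) ∞ Q]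
  {C : Set (PhaseModel N)} {G₁ G₂ : PhaseModel N → ℝ}

lemma hamField_eq_zero_of_eventuallyEq {f : Cotangent N Q → ℝ} {z : Cotangent N Q} {c : ℝ}
    (h : f =ᶠ[𝓝 z] fun _ => c) : hamField f z = 0 := by
  have h0 : dfunLin f z = 0 := by
    have h1 : mfderiv (cot N) 𝓘(ℝ, ℝ) f z = 0 := h.mfderiv_eq.trans mfderiv_const
    exact h1
  rw [hamField_eq, h0, map_zero]
  rfl

namespace SymplecticFamily
variable (Φ : SymplecticFamily C G₁ G₂) (z₀ : Cotangent N Q)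

/-- The symplectic diffeomorphisms of `T*Q` given by `Φ` in the chart at `z₀`. -/
def lift : (ℝ × ℝ) × Cotangent N Q → Cotangent N Q := extId z₀ Φ.map

/-- The inverses of the diffeomorphisms `Φ.lift`. -/
def liftInv : (ℝ × ℝ) × Cotangent N Q → Cotangent N Q := extId z₀ Φ.inv

/-- The primitive of `Φ.lift^*ϑ - ϑ`. -/
def liftAction : (ℝ × ℝ) × Cotangent N Q → ℝ := extZero z₀ Φ.action

/-- The Hamiltonian generating the dependence of `Φ.lift` on the parameters, in the
direction `e`. -/
def liftGen (e : ℝ × ℝ) : (ℝ × ℝ) × Cotangent N Q → ℝ := extZero z₀ (Φ.gen e)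

variable {z₀} (hC : IsCompact C) (hCt : C ⊆ (extChartAt (cot N) z₀).target)
include hCt

lemma map_mem_target (l : ℝ × ℝ) {z : Cotangent N Q} (hz : z ∈ (extChartAt (cot N) z₀).source) :
    Φ.map (l, extChartAt (cot N) z₀ z) ∈ (extChartAt (cot N) z₀).target :=
  apply_mem_target hCt Φ.map_off (fun l _ => Φ.map_mem l) l ((extChartAt (cot N) z₀).map_source hz)

lemma inv_mem_target (l : ℝ × ℝ) {z : Cotangent N Q} (hz : z ∈ (extChartAt (cot N) z₀).source) :
    Φ.inv (l, extChartAt (cot N) z₀ z) ∈ (extChartAt (cot N) z₀).target :=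
  apply_mem_target hCt Φ.inv_off (fun l _ => Φ.inv_mem l) l ((extChartAt (cot N) z₀).map_source hz)

lemma lift_mem (l : ℝ × ℝ) {z : Cotangent N Q} (hz : z ∈ (extChartAt (cot N) z₀).source) :
    Φ.lift z₀ (l, z) ∈ (extChartAt (cot N) z₀).source := by
  rw [lift, extId_of_mem hz]
  exact (extChartAt (cot N) z₀).map_target (Φ.map_mem_target hCt l hz)

lemma coord_lift (l : ℝ × ℝ) {z : Cotangent N Q} (hz : z ∈ (extChartAt (cot N) z₀).source) :
    extChartAt (cot N) z₀ (Φ.lift z₀ (l, z)) = Φ.map (l, extChartAt (cot N) z₀ z) := by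
  rw [lift, extId_of_mem hz]
  exact (extChartAt (cot N) z₀).right_inv (Φ.map_mem_target hCt l hz)

lemma lift_off (l : ℝ × ℝ) {z : Cotangent N Q} (hz : z ∉ liftSet z₀ C) : Φ.lift z₀ (l, z) = z :=
  extId_off hCt Φ.map_off hz

lemma liftAction_off (l : ℝ × ℝ) {z : Cotangent N Q} (hz : z ∉ liftSet z₀ C) :
    Φ.liftAction z₀ (l, z) = 0 :=
  extZero_off hCt Φ.action_off hz

lemma liftGen_off (e l : ℝ × ℝ) {z : Cotangent N Q} (hz : z ∉ liftSet z₀ C) :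
    Φ.liftGen z₀ e (l, z) = 0 :=
  extZero_off hCt (fun l _ hy => Φ.gen_off e l hy) hz

lemma liftInv_lift (l : ℝ × ℝ) (z : Cotangent N Q) : Φ.liftInv z₀ (l, Φ.lift z₀ (l, z)) = z := by
  by_cases hz : z ∈ (extChartAt (cot N) z₀).source
  · rw [liftInv, extId_of_mem (Φ.lift_mem hCt l hz), Φ.coord_lift hCt l hz, Φ.inv_map,
      (extChartAt (cot N) z₀).left_inv hz]
  · have h : z ∉ liftSet z₀ C := fun h => hz ((mem_liftSet hCt).1 h).1
    rw [Φ.lift_off hCt l h]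
    exact extId_off hCt Φ.inv_off h

lemma lift_liftInv (l : ℝ × ℝ) (z : Cotangent N Q) : Φ.lift z₀ (l, Φ.liftInv z₀ (l, z)) = z := by
  by_cases hz : z ∈ (extChartAt (cot N) z₀).source
  · have h1 : Φ.liftInv z₀ (l, z) ∈ (extChartAt (cot N) z₀).source := by
      rw [liftInv, extId_of_mem hz]
      exact (extChartAt (cot N) z₀).map_target (Φ.inv_mem_target hCt l hz)
    have h2 : extChartAt (cot N) z₀ (Φ.liftInv z₀ (l, z)) = Φ.inv (l, extChartAt (cot N) z₀ z) := by
      rw [liftInv, extId_of_mem hz]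
      exact (extChartAt (cot N) z₀).right_inv (Φ.inv_mem_target hCt l hz)
    rw [lift, extId_of_mem h1, h2, Φ.map_inv, (extChartAt (cot N) z₀).left_inv hz]
  · have h : z ∉ liftSet z₀ C := fun h => hz ((mem_liftSet hCt).1 h).1
    rw [liftInv, extId_off hCt Φ.inv_off h, Φ.lift_off hCt l h]

omit hCt in
lemma lift_zero (z : Cotangent N Q) : Φ.lift z₀ (0, z) = z := by
  rw [lift, extId]
  split_ifs with hz
  · rw [Φ.map_zero]
    exact (extChartAt (cot N) z₀).left_inv hz
  · rfl

omit hCt in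
lemma liftAction_zero (z : Cotangent N Q) : Φ.liftAction z₀ (0, z) = 0 := by
  rw [liftAction, extZero]
  split_ifs with hz
  · rw [Φ.action_zero]
  · rfl

include hC
variable [T2Space Q]

lemma contMDiff_lift : ContMDiff (𝓘(ℝ, ℝ × ℝ).prod (cot N)) (cot N) ∞ (Φ.lift z₀) :=
  contMDiff_extId hC hCt Φ.smooth_map Φ.map_off fun l _ => Φ.map_mem l

lemma contMDiff_liftInv : ContMDiff (𝓘(ℝ, ℝ × ℝ).prod (cot N)) (cot N) ∞ (Φ.liftInv z₀) :=
  contMDiff_extId hC hCt Φ.smooth_inv Φ.inv_off fun l _ => Φ.inv_mem l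

lemma contMDiff_liftAction :
    ContMDiff (𝓘(ℝ, ℝ × ℝ).prod (cot N)) 𝓘(ℝ, ℝ) ∞ (Φ.liftAction z₀) :=
  contMDiff_extZero hC hCt Φ.smooth_action Φ.action_off

lemma contMDiff_liftGen (e : ℝ × ℝ) :
    ContMDiff (𝓘(ℝ, ℝ × ℝ).prod (cot N)) 𝓘(ℝ, ℝ) ∞ (Φ.liftGen z₀ e) :=
  contMDiff_extZero hC hCt (Φ.smooth_gen e) fun l _ hy => Φ.gen_off e l hy

lemma contMDiff_lift_snd (l : ℝ × ℝ) : ContMDiff (cot N) (cot N) ∞ (fun z => Φ.lift z₀ (l, z)) :=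
  (Φ.contMDiff_lift hC hCt).comp (contMDiff_const.prodMk contMDiff_id)

lemma contMDiff_lift_fst (z : Cotangent N Q) :
    ContMDiff 𝓘(ℝ, ℝ × ℝ) (cot N) ∞ (fun l => Φ.lift z₀ (l, z)) :=
  (Φ.contMDiff_lift hC hCt).comp (contMDiff_id.prodMk contMDiff_const)

lemma smooth_liftGen (e l : ℝ × ℝ) : Smooth (fun z => Φ.liftGen z₀ e (l, z)) :=
  (Φ.contMDiff_liftGen hC hCt e).comp (contMDiff_const.prodMk contMDiff_id)

lemma smooth_liftAction (l : ℝ × ℝ) : Smooth (fun z => Φ.liftAction z₀ (l, z)) :=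
  (Φ.contMDiff_liftAction hC hCt).comp (contMDiff_const.prodMk contMDiff_id)

/-- The derivative of `Φ.lift` in coordinates. -/
lemma coord_mfderiv_lift_snd (l : ℝ × ℝ) {z : Cotangent N Q}
    (hz : z ∈ (extChartAt (cot N) z₀).source) (v : TangentSpace (cot N) z) :
    (mfderiv (cot N) 𝓘(ℝ, PhaseModel N) (extChartAt (cot N) z₀) (Φ.lift z₀ (l, z))
      (mfderiv (cot N) (cot N) (fun z => Φ.lift z₀ (l, z)) z v) : PhaseModel N)
    = fderiv ℝ Φ.map (l, extChartAt (cot N) z₀ z)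
      (0, (mfderiv (cot N) 𝓘(ℝ, PhaseModel N) (extChartAt (cot N) z₀) z v : PhaseModel N)) := by
  have h1 : MDifferentiableAt (cot N) 𝓘(ℝ, PhaseModel N) (extChartAt (cot N) z₀)
      (Φ.lift z₀ (l, z)) := mdifferentiableAt_extChartAt (by simpa using Φ.lift_mem hCt l hz)
  have h2 := mfderiv_comp_apply (f := fun z => Φ.lift z₀ (l, z)) z h1
    ((Φ.contMDiff_lift_snd hC hCt l).mdifferentiable (by simp) z) v
  have h3 : HasFDerivAt (fun y => Φ.map (l, y)) _ (extChartAt (cot N) z₀ z) :=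
    (Φ.hasFDerivAt_map (l, extChartAt (cot N) z₀ z)).comp _ (hasFDerivAt_prodMk_right l _)
  have h4 := mfderiv_comp_apply z (g := fun y => Φ.map (l, y)) h3.differentiableAt.mdifferentiableAt
    (mdifferentiableAt_extChartAt (I := cot N) (by simpa using hz)) v
  rw [mfderiv_eq_fderiv, h3.fderiv] at h4
  rw [← h2]
  have h5 : extChartAt (cot N) z₀ ∘ (fun z => Φ.lift z₀ (l, z)) =ᶠ[𝓝 z]
      (fun y => Φ.map (l, y)) ∘ extChartAt (cot N) z₀ := by
    filter_upwards [(isOpen_extChartAt_source (I := cot N) z₀).mem_nhds hz] with w hw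
    exact Φ.coord_lift hCt l hw
  rw [h5.mfderiv_eq]
  exact h4

lemma coord_mfderiv_lift_fst (l e : ℝ × ℝ) {z : Cotangent N Q}
    (hz : z ∈ (extChartAt (cot N) z₀).source) :
    (mfderiv (cot N) 𝓘(ℝ, PhaseModel N) (extChartAt (cot N) z₀) (Φ.lift z₀ (l, z))
      (mfderiv 𝓘(ℝ, ℝ × ℝ) (cot N) (fun l => Φ.lift z₀ (l, z)) l e) : PhaseModel N)
    = fderiv ℝ Φ.map (l, extChartAt (cot N) z₀ z) (e, 0) := by
  have h1 : MDifferentiableAt (cot N) 𝓘(ℝ, PhaseModel N) (extChartAt (cot N) z₀)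
      (Φ.lift z₀ (l, z)) := mdifferentiableAt_extChartAt (by simpa using Φ.lift_mem hCt l hz)
  have h2 := mfderiv_comp_apply (f := fun l => Φ.lift z₀ (l, z)) l h1
    ((Φ.contMDiff_lift_fst hC hCt z).mdifferentiable (by simp) l) e
  have h3 : HasFDerivAt (fun l => Φ.map (l, extChartAt (cot N) z₀ z)) _ l :=
    (Φ.hasFDerivAt_map (l, extChartAt (cot N) z₀ z)).comp l (hasFDerivAt_prodMk_left l _)
  have h4 : extChartAt (cot N) z₀ ∘ (fun l => Φ.lift z₀ (l, z))
      = fun l => Φ.map (l, extChartAt (cot N) z₀ z) := funext fun l => Φ.coord_lift hCt l hz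
  rw [h4, mfderiv_eq_fderiv, h3.fderiv] at h2
  exact h2.symm

lemma coord_mfderiv_liftAction (l : ℝ × ℝ) {z : Cotangent N Q}
    (hz : z ∈ (extChartAt (cot N) z₀).source) (v : TangentSpace (cot N) z) :
    mfderiv (cot N) 𝓘(ℝ, ℝ) (fun z => Φ.liftAction z₀ (l, z)) z v
    = fderiv ℝ Φ.action (l, extChartAt (cot N) z₀ z)
      (0, (mfderiv (cot N) 𝓘(ℝ, PhaseModel N) (extChartAt (cot N) z₀) z v : PhaseModel N)) := by
  have h3 : HasFDerivAt (fun y => Φ.action (l, y)) _ (extChartAt (cot N) z₀ z) :=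
    ((Φ.smooth_action.differentiable (by simp) (l, extChartAt (cot N) z₀ z)).hasFDerivAt).comp _
      (hasFDerivAt_prodMk_right l _)
  have h4 := mfderiv_comp_apply z (g := fun y => Φ.action (l, y))
    h3.differentiableAt.mdifferentiableAt
    (mdifferentiableAt_extChartAt (I := cot N) (by simpa using hz)) v
  rw [mfderiv_eq_fderiv, h3.fderiv] at h4
  have h5 : (fun z => Φ.liftAction z₀ (l, z)) =ᶠ[𝓝 z]
      (fun y => Φ.action (l, y)) ∘ extChartAt (cot N) z₀ := by
    filter_upwards [(isOpen_extChartAt_source (I := cot N) z₀).mem_nhds hz] with w hw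
    exact extZero_of_mem hw
  rw [h5.mfderiv_eq]
  exact h4

lemma lift_eventuallyEq (l : ℝ × ℝ) {z : Cotangent N Q} (hz : z ∉ liftSet z₀ C) :
    (fun z => Φ.lift z₀ (l, z)) =ᶠ[𝓝 z] id := by
  filter_upwards [(isCompact_liftSet hC hCt).isClosed.isOpen_compl.mem_nhds hz] with w hw
  exact Φ.lift_off hCt l hw

/-- The pull-back of the canonical `1`-form differs from it by an exact form. -/
lemma liouville_lift (l : ℝ × ℝ) (z : Cotangent N Q) (v : TangentSpace (cot N) z) :
    liouville (Φ.lift z₀ (l, z)) (mfderiv (cot N) (cot N) (fun z => Φ.lift z₀ (l, z)) z v)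
      - liouville z v = mfderiv (cot N) 𝓘(ℝ, ℝ) (fun z => Φ.liftAction z₀ (l, z)) z v := by
  by_cases hz : z ∈ (extChartAt (cot N) z₀).source
  · rw [liouville_eq_coord (Φ.lift_mem hCt l hz), Φ.coord_mfderiv_lift_snd hC hCt l hz,
      liouville_eq_coord hz, Φ.coord_mfderiv_liftAction hC hCt l hz, Φ.fderiv_action,
      Φ.coord_lift hCt l hz]
    simp
  · have h : z ∉ liftSet z₀ C := fun h => hz ((mem_liftSet hCt).1 h).1
    have h1 : (fun z => Φ.liftAction z₀ (l, z)) =ᶠ[𝓝 z] fun _ => 0 := by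
      filter_upwards [(isCompact_liftSet hC hCt).isClosed.isOpen_compl.mem_nhds h] with w hw
      exact Φ.liftAction_off hCt l hw
    rw [h1.mfderiv_eq, (Φ.lift_eventuallyEq hC hCt l h).mfderiv_eq, Φ.lift_off hCt l h, mfderiv_id,
      mfderiv_const]
    exact sub_self _

lemma symplecticForm_lift (l : ℝ × ℝ) (z : Cotangent N Q) (v w : TangentSpace (cot N) z) :
    symplecticForm (Φ.lift z₀ (l, z)) (mfderiv (cot N) (cot N) (fun z => Φ.lift z₀ (l, z)) z v)
      (mfderiv (cot N) (cot N) (fun z => Φ.lift z₀ (l, z)) z w) = symplecticForm z v w := by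
  by_cases hz : z ∈ (extChartAt (cot N) z₀).source
  · rw [symplecticForm_eq_coord (Φ.lift_mem hCt l hz), Φ.coord_mfderiv_lift_snd hC hCt l hz,
      Φ.coord_mfderiv_lift_snd hC hCt l hz, symplecticForm_eq_coord hz]
    exact Φ.stdForm_fderiv_map_snd _ _ _
  · have h : z ∉ liftSet z₀ C := fun h => hz ((mem_liftSet hCt).1 h).1
    rw [(Φ.lift_eventuallyEq hC hCt l h).mfderiv_eq, Φ.lift_off hCt l h, mfderiv_id]
    rfl

lemma liftGen_comp_symm_eventuallyEq (e l : ℝ × ℝ) {y : PhaseModel N}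
    (hy : y ∈ (extChartAt (cot N) z₀).target) :
    (fun z => Φ.liftGen z₀ e (l, z)) ∘ (extChartAt (cot N) z₀).symm =ᶠ[𝓝 y]
      fun y => Φ.gen e (l, y) := by
  filter_upwards [(isOpen_extChartAt_target (I := cot N) z₀).mem_nhds hy] with w hw
  simp only [Function.comp_apply]
  rw [liftGen, extZero_of_mem ((extChartAt (cot N) z₀).map_target hw),
    (extChartAt (cot N) z₀).right_inv hw]

/-- Hamilton's equations for the dependence of `Φ.lift` on the parameters. -/
lemma mfderiv_lift_fst (l e : ℝ × ℝ) (z : Cotangent N Q) :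
    mfderiv 𝓘(ℝ, ℝ × ℝ) (cot N) (fun l => Φ.lift z₀ (l, z)) l e
      = hamField (fun z => Φ.liftGen z₀ e (l, z)) (Φ.lift z₀ (l, z)) := by
  by_cases hz : z ∈ (extChartAt (cot N) z₀).source
  · apply (isInvertible_mfderiv_extChartAt (I := cot N) (Φ.lift_mem hCt l hz)).bijective.1
    refine (Φ.coord_mfderiv_lift_fst hC hCt l e hz).trans ?_
    rw [Φ.fderiv_map_fst]
    refine Eq.trans ?_ (hamField_eq_coord (Φ.lift_mem hCt l hz)
      (Φ.smooth_liftGen hC hCt e l).contMDiffAt).symm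
    rw [Φ.coord_lift hCt l hz,
      (Φ.liftGen_comp_symm_eventuallyEq hC hCt e l (Φ.map_mem_target hCt l hz)).fderiv_eq]
  · have h : z ∉ liftSet z₀ C := fun h => hz ((mem_liftSet hCt).1 h).1
    have h1 : (fun l => Φ.lift z₀ (l, z)) = fun _ => z := funext fun l => Φ.lift_off hCt l h
    have h2 : (fun z => Φ.liftGen z₀ e (l, z)) =ᶠ[𝓝 z] fun _ => 0 := by
      filter_upwards [(isCompact_liftSet hC hCt).isClosed.isOpen_compl.mem_nhds h] with w hw
      exact Φ.liftGen_off hCt e l hw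
    rw [h1, Φ.lift_off hCt l h, hamField_eq_zero_of_eventuallyEq h2, mfderiv_const]
    rfl

/-- The phase velocity of the motion generated by `Φ.liftGen`. -/
lemma fderiv_liftAction_fst (l e : ℝ × ℝ) (z : Cotangent N Q) :
    fderiv ℝ (fun l => Φ.liftAction z₀ (l, z)) l e
      = liouville (Φ.lift z₀ (l, z)) (mfderiv 𝓘(ℝ, ℝ × ℝ) (cot N) (fun l => Φ.lift z₀ (l, z)) l e)
        - Φ.liftGen z₀ e (l, Φ.lift z₀ (l, z)) := by
  by_cases hz : z ∈ (extChartAt (cot N) z₀).source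
  · have h3 : HasFDerivAt (fun l => Φ.action (l, extChartAt (cot N) z₀ z)) _ l :=
      ((Φ.smooth_action.differentiable (by simp) (l, extChartAt (cot N) z₀ z)).hasFDerivAt).comp l
        (hasFDerivAt_prodMk_left l _)
    have h4 : (fun l => Φ.liftAction z₀ (l, z)) = fun l => Φ.action (l, extChartAt (cot N) z₀ z) :=
      funext fun l => extZero_of_mem hz
    rw [h4, h3.fderiv, liouville_eq_coord (Φ.lift_mem hCt l hz),
      Φ.coord_mfderiv_lift_fst hC hCt l e hz, liftGen, extZero_of_mem (Φ.lift_mem hCt l hz)]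
    dsimp only
    rw [Φ.coord_lift hCt l hz]
    refine (Φ.fderiv_action _ _).trans ?_
    simp [gen]
    ring
  · have h : z ∉ liftSet z₀ C := fun h => hz ((mem_liftSet hCt).1 h).1
    have h1 : (fun l => Φ.lift z₀ (l, z)) = fun _ => z := funext fun l => Φ.lift_off hCt l h
    have h2 : (fun l => Φ.liftAction z₀ (l, z)) = fun _ => 0 :=
      funext fun l => Φ.liftAction_off hCt l h
    rw [h1, h2, Φ.lift_off hCt l h, Φ.liftGen_off hCt e l h, mfderiv_const]
    simp only [fderiv_fun_const, Pi.zero_apply, zero_apply, sub_zero]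
    exact (_root_.map_zero (liouville z)).symm

end SymplecticFamily
end Lift

/-! ### Two-parameter families of potentials -/

section Families
variable {N : ℕ} {Q : Type*} [TopologicalSpace Q] [ChartedSpace (Rn N) Q] [IsManifold (𝓡 N) ∞ Q]
  {L : Type*} [TopologicalSpace L] [ChartedSpace (Rn N) L] [IsManifold (𝓡 N) ∞ L]
  {C : Set (PhaseModel N)} {G₁ G₂ : PhaseModel N → ℝ}

lemma InComponent.isLagrangianEmbedding {ι₀ ι : L → Cotangent N Q} (h : InComponent ι₀ ι)
    (h₀ : IsLagrangianEmbedding ι₀) : IsLagrangianEmbedding ι := by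
  induction h with
  | refl => exact h₀
  | tail _ h _ =>
    obtain ⟨j, -, hj, -, -, rfl⟩ := h
    exact hj 1

namespace SymplecticFamily
variable (Φ : SymplecticFamily C G₁ G₂) {z₀ : Cotangent N Q} (hC : IsCompact C)
  (hCt : C ⊆ (extChartAt (cot N) z₀).target) [T2Space Q] {ι : L → Cotangent N Q}
include hC hCt

lemma mfderiv_lift_comp (hι : ContMDiff (𝓡 N) (cot N) ∞ ι) (l : ℝ × ℝ) (x : L)
    (v : TangentSpace (𝓡 N) x) :
    dEmb (fun x => Φ.lift z₀ (l, ι x)) x v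
      = mfderiv (cot N) (cot N) (fun z => Φ.lift z₀ (l, z)) (ι x) (dEmb ι x v) :=
  mfderiv_comp_apply x (g := fun z => Φ.lift z₀ (l, z))
    ((Φ.contMDiff_lift_snd hC hCt l).mdifferentiable (by simp) (ι x))
    (hι.mdifferentiable (by simp) x) v

lemma isLagrangianEmbedding_lift (hι : IsLagrangianEmbedding ι) (l : ℝ × ℝ) :
    IsLagrangianEmbedding (fun x => Φ.lift z₀ (l, ι x)) where
  smooth := (Φ.contMDiff_lift_snd hC hCt l).comp hι.smooth
  immersion x v w h := by
    rw [Φ.mfderiv_lift_comp hC hCt hι.smooth, Φ.mfderiv_lift_comp hC hCt hι.smooth] at h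
    refine hι.immersion x ?_
    have hinv : ContMDiff (cot N) (cot N) ∞ (fun z => Φ.liftInv z₀ (l, z)) :=
      (Φ.contMDiff_liftInv hC hCt).comp (contMDiff_const.prodMk contMDiff_id)
    have h1 : ∀ u : TangentSpace (cot N) (ι x), mfderiv (cot N) (cot N)
        (fun z => Φ.liftInv z₀ (l, z)) (Φ.lift z₀ (l, ι x))
        (mfderiv (cot N) (cot N) (fun z => Φ.lift z₀ (l, z)) (ι x) u) = u := fun u => by
      have h2 := mfderiv_comp_apply (ι x) (g := fun z => Φ.liftInv z₀ (l, z))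
        (f := fun z => Φ.lift z₀ (l, z)) (hinv.mdifferentiable (by simp) _)
        ((Φ.contMDiff_lift_snd hC hCt l).mdifferentiable (by simp) _) u
      have h3 : (fun z => Φ.liftInv z₀ (l, z)) ∘ (fun z => Φ.lift z₀ (l, z)) = id :=
        funext fun z => Φ.liftInv_lift hCt l z
      rw [h3, mfderiv_id] at h2
      exact h2.symm
    rw [← h1 (dEmb ι x v), h, h1]
  embedding := by
    let e : Cotangent N Q ≃ₜ Cotangent N Q :=
      { toFun := fun z => Φ.lift z₀ (l, z)
        invFun := fun z => Φ.liftInv z₀ (l, z)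
        left_inv := Φ.liftInv_lift hCt l
        right_inv := Φ.lift_liftInv hCt l
        continuous_toFun := (Φ.contMDiff_lift_snd hC hCt l).continuous
        continuous_invFun := (Φ.contMDiff_liftInv hC hCt).continuous.comp
          (Continuous.prodMk_right l) }
    exact e.isEmbedding.comp hι.embedding
  isotropic x v w := by
    rw [Φ.mfderiv_lift_comp hC hCt hι.smooth, Φ.mfderiv_lift_comp hC hCt hι.smooth,
      Φ.symplecticForm_lift hC hCt]
    exact hι.isotropic x v w

lemma smoothlyJoined_lift (hι : IsLagrangianEmbedding ι) (l : ℝ × ℝ) :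
    SmoothlyJoined ι (fun x => Φ.lift z₀ (l, ι x)) := by
  refine ⟨fun s x => Φ.lift z₀ (s • l, ι x), ?_, fun s => Φ.isLagrangianEmbedding_lift hC hCt hι _,
    fun s => ⟨fun x => Φ.liftAction z₀ (s • l, ι x), (Φ.smooth_liftAction hC hCt _).comp hι.smooth,
      fun x w => ?_⟩, ?_, ?_⟩
  · have h : ContDiff ℝ ∞ (fun s : ℝ => s • l) := contDiff_id.smul contDiff_const
    exact (Φ.contMDiff_lift hC hCt).comp
      ((h.contMDiff.comp contMDiff_fst).prodMk (hι.smooth.comp contMDiff_snd))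
  · rw [Φ.mfderiv_lift_comp hC hCt hι.smooth, Φ.liouville_lift hC hCt]
    exact (mfderiv_comp_apply x (g := fun z => Φ.liftAction z₀ (s • l, z))
      ((Φ.smooth_liftAction hC hCt _).mdifferentiable (by simp) (ι x))
      (hι.smooth.mdifferentiable (by simp) x) w).symm
  · funext x
    dsimp only
    rw [zero_smul, Φ.lift_zero]
  · funext x
    dsimp only
    rw [one_smul]

end SymplecticFamily

variable [MeasurableSpace L] [BorelSpace L] {ε : ℝ} {ι₀ : L → Cotangent N Q}

lemma Potentials.ext_of {Z Z' : Potentials ε ι₀} (h₁ : Z.ι = Z'.ι) (h₂ : Z.φ = Z'.φ)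
    (h₃ : Z.μ = Z'.μ) : Z = Z' := by
  cases Z; cases Z'; simp_all

/-- The density `exp (l₁ r₁ + l₂ r₂)`, with logarithmic derivatives `r₁` and `r₂`. -/
def expDens (r₁ r₂ : L → ℝ) (l : ℝ × ℝ) (x : L) : ℝ := Real.exp (l.1 * r₁ x + l.2 * r₂ x)

lemma contMDiff_expDens {r₁ r₂ : L → ℝ} (h₁ : ContMDiff (𝓡 N) 𝓘(ℝ, ℝ) ∞ r₁)
    (h₂ : ContMDiff (𝓡 N) 𝓘(ℝ, ℝ) ∞ r₂) :
    ContMDiff (𝓘(ℝ, ℝ × ℝ).prod (𝓡 N)) 𝓘(ℝ, ℝ) ∞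
      (fun q : (ℝ × ℝ) × L => expDens r₁ r₂ q.1 q.2) :=
  Real.contDiff_exp.contMDiff.comp
    (((contDiff_fst.contMDiff.comp contMDiff_fst).mul (h₁.comp contMDiff_snd)).add
      ((contDiff_snd.contMDiff.comp contMDiff_fst).mul (h₂.comp contMDiff_snd)))

lemma isFiniteMeasure_expDens {μ : Measure L} [IsFiniteMeasure μ] {K : Set L} (hK : IsCompact K)
    {r₁ r₂ : L → ℝ} (h₁ : Continuous r₁) (h₂ : Continuous r₂)
    (h₁K : ∀ x ∉ K, r₁ x = 0) (h₂K : ∀ x ∉ K, r₂ x = 0) (l : ℝ × ℝ) :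
    IsFiniteMeasure (μ.withDensity fun x => ENNReal.ofReal (expDens r₁ r₂ l x)) := by
  have hc : Continuous (expDens r₁ r₂ l) :=
    Real.continuous_exp.comp ((continuous_const.mul h₁).add (continuous_const.mul h₂))
  obtain ⟨B, hB⟩ := hK.bddAbove_image hc.continuousOn
  have hle : ∀ x, expDens r₁ r₂ l x ≤ max B 1 := fun x => by
    by_cases hx : x ∈ K
    · exact (hB (mem_image_of_mem _ hx)).trans (le_max_left _ _)
    · simp [expDens, h₁K x hx, h₂K x hx]
  refine isFiniteMeasure_withDensity (ne_of_lt ?_)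
  calc ∫⁻ x, ENNReal.ofReal (expDens r₁ r₂ l x) ∂μ ≤ ∫⁻ _, ENNReal.ofReal (max B 1) ∂μ :=
        lintegral_mono fun x => ENNReal.ofReal_le_ofReal (hle x)
    _ < ⊤ := by
        rw [lintegral_const]
        exact ENNReal.mul_lt_top ENNReal.ofReal_lt_top (measure_lt_top _ _)

/-- The two-parameter family through `Z` given by a symplectic family in a chart of `T*Q` and by two
compactly supported variations of the density. -/
theorem SymplecticFamily.exists_smoothFamily [T2Space Q] (Φ : SymplecticFamily C G₁ G₂)
    {z₀ : Cotangent N Q} (hC : IsCompact C) (hCt : C ⊆ (extChartAt (cot N) z₀).target)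
    {Z : Potentials ε ι₀} (hZ : IsLagrangianEmbedding Z.ι) (p : L) {K : Set L} (hK : IsCompact K)
    (hKC : ∀ x, Z.ι x ∈ liftSet z₀ C → x ∈ K) {r₁ r₂ : L → ℝ}
    (h₁ : ContMDiff (𝓡 N) 𝓘(ℝ, ℝ) ∞ r₁) (h₂ : ContMDiff (𝓡 N) 𝓘(ℝ, ℝ) ∞ r₂)
    (h₁K : ∀ x ∉ K, r₁ x = 0) (h₂K : ∀ x ∉ K, r₂ x = 0) :
    ∃ F : SmoothFamily (ℝ × ℝ) ε ι₀, F.pt 0 = Z ∧ F.ConstantOff K ∧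
      F.Generates p K (1, 0) (fun l z => Φ.liftGen z₀ (1, 0) (l, z)) (fun _ => r₁) ∧
      F.Generates p K (0, 1) (fun l z => Φ.liftGen z₀ (0, 1) (l, z)) (fun _ => r₂) := by
  obtain ⟨φ₀, hφ₀⟩ := QuotientAddGroup.mk_surjective Z.φ
  have hds := contMDiff_expDens h₁ h₂
  have hpos : ∀ l x, 0 < expDens r₁ r₂ l x := fun l x => Real.exp_pos _
  let pt : ℝ × ℝ → Potentials ε ι₀ := fun l =>
    { ι := fun x => Φ.lift z₀ (l, Z.ι x)
      φ := ((φ₀ + Φ.liftAction z₀ (l, Z.ι p) : ℝ) : AddCircle (ε * Real.pi / 2))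
      μ := Z.μ.withDensity fun x => ENNReal.ofReal (expDens r₁ r₂ l x)
      mem_component := Z.mem_component.tail (Φ.smoothlyJoined_lift hC hCt hZ l)
      density := Z.density.withDensity (contMDiff_param hds l) (hpos l)
      finite := isFiniteMeasure_expDens hK h₁.continuous h₂.continuous h₁K h₂K l }
  have hpt : pt 0 = Z := by
    refine Potentials.ext_of (funext fun x => Φ.lift_zero _) ?_ ?_
    · change ((φ₀ + Φ.liftAction z₀ (0, Z.ι p) : ℝ) : AddCircle (ε * Real.pi / 2)) = Z.φ
      rw [Φ.liftAction_zero, add_zero]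
      exact hφ₀
    · have : (fun x => ENNReal.ofReal (expDens r₁ r₂ 0 x)) = 1 := by
        funext x; simp [expDens]
      change Z.μ.withDensity (fun x => ENNReal.ofReal (expDens r₁ r₂ 0 x)) = Z.μ
      rw [this, withDensity_one]
  let F : SmoothFamily (ℝ × ℝ) ε ι₀ :=
    { pt := pt
      phase := fun l => φ₀ + Φ.liftAction z₀ (l, Z.ι p)
      dens := expDens r₁ r₂
      phase_spec := fun l => rfl
      dens_pos := hpos
      dens_spec := fun l => by rw [hpt]
      smooth_emb := (Φ.contMDiff_lift hC hCt).comp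
        (contMDiff_fst.prodMk (hZ.smooth.comp contMDiff_snd))
      smooth_phase := contDiff_const.add
        ((Φ.contMDiff_liftAction hC hCt).comp (contMDiff_id.prodMk contMDiff_const)).contDiff
      smooth_dens := hds }
  have hoff : ∀ x ∉ K, Z.ι x ∉ liftSet z₀ C := fun x hx h => hx (hKC x h)
  have hrep : ∀ (e : ℝ × ℝ) (r : L → ℝ), (∀ x, r x = e.1 * r₁ x + e.2 * r₂ x) →
      F.Generates p K e (fun l z => Φ.liftGen z₀ e (l, z)) (fun _ => r) := by
    intro e r hr
    refine ⟨fun s => ⟨Φ.smooth_liftGen hC hCt e s, fun x => Φ.mfderiv_lift_fst hC hCt s e (Z.ι x),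
      ?_, fun x => ?_⟩, ?_, fun s x hx => ?_⟩
    · change fderiv ℝ (fun l => φ₀ + Φ.liftAction z₀ (l, Z.ι p)) s e = _
      rw [fderiv_const_add, Φ.fderiv_liftAction_fst hC hCt, Φ.mfderiv_lift_fst hC hCt]
    · have h := (((hasFDerivAt_fst (𝕜 := ℝ) (p := s)).mul_const (r₁ x)).add
        ((hasFDerivAt_snd (𝕜 := ℝ) (p := s)).mul_const (r₂ x))).exp
      refine (congrArg (fun T => T e) h.fderiv).trans ?_
      simp only [smul_apply, add_apply, smul_eq_mul,
        ContinuousLinearMap.coe_fst', ContinuousLinearMap.coe_snd', hr, Pi.add_apply]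
      change Real.exp (s.1 * r₁ x + s.2 * r₂ x) * _ = _ * Real.exp (s.1 * r₁ x + s.2 * r₂ x)
      ring
    · exact (Φ.contMDiff_liftGen hC hCt e).comp (contMDiff_fst.prodMk F.smooth_emb)
    · change Φ.liftGen z₀ e (s, Φ.lift z₀ (s, Z.ι x)) = 0
      rw [Φ.lift_off hCt s (hoff x hx), Φ.liftGen_off hCt e s (hoff x hx)]
  refine ⟨F, hpt, fun s x hx => ⟨?_, ?_⟩, hrep _ _ fun x => by simp, hrep _ _ fun x => by simp⟩
  · change Φ.lift z₀ (s, Z.ι x) = Φ.lift z₀ (0, Z.ι x)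
    rw [Φ.lift_zero, Φ.lift_off hCt s (hoff x hx)]
  · change expDens r₁ r₂ s x = 1
    simp [expDens, h₁K x hx, h₂K x hx]

lemma SymplecticFamily.liftGen_fst_zero (Φ : SymplecticFamily C G₁ G₂) (z₀ : Cotangent N Q) :
    (fun z => Φ.liftGen z₀ (1, 0) (0, z)) = extFun z₀ G₁ := by
  funext z
  simp [liftGen, extFun, extZero, gen, Φ.gen₁_zero]

lemma SymplecticFamily.liftGen_snd_zero (Φ : SymplecticFamily C G₁ G₂) (z₀ : Cotangent N Q) :
    (fun z => Φ.liftGen z₀ (0, 1) (0, z)) = extFun z₀ G₂ := by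
  funext z
  simp [liftGen, extFun, extZero, gen, Φ.gen₂_zero]

end Families

/-! ### Functions vanishing along a Lagrangian submanifold -/

section Tangent
variable {N : ℕ} {Q : Type*} [TopologicalSpace Q] [ChartedSpace (Rn N) Q] [IsManifold (𝓡 N) ∞ Q]
  {L : Type*} [TopologicalSpace L] [ChartedSpace (Rn N) L] [IsManifold (𝓡 N) ∞ L]

/-- The derivative `L_Y χ` of a function along a vector field. -/
def dirDeriv (χ : L → ℝ) (Y : ∀ x : L, TangentSpace (𝓡 N) x) (x : L) : ℝ :=
  mfderiv (𝓡 N) 𝓘(ℝ, ℝ) χ x (Y x)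

lemma mfderiv_comp_hamField {h f : Cotangent N Q → ℝ} (hh : Smooth h) {ι : L → Cotangent N Q}
    (hι : ContMDiff (𝓡 N) (cot N) ∞ ι) {x : L} {y : TangentSpace (𝓡 N) x}
    (hy : dEmb ι x y = hamField f (ι x)) :
    mfderiv (𝓡 N) 𝓘(ℝ, ℝ) (fun x => h (ι x)) x y = poisson h f (ι x) := by
  have h1 := mfderiv_comp_apply x (g := h) (hh.mdifferentiable (by simp) (ι x))
    (hι.mdifferentiable (by simp) x) y
  rw [hy] at h1
  exact h1

lemma dirDeriv_sum {κ : Type*} (s : Finset κ) {χ : κ → L → ℝ}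
    (hχ : ∀ i, ContMDiff (𝓡 N) 𝓘(ℝ, ℝ) ∞ (χ i)) (Y : ∀ x : L, TangentSpace (𝓡 N) x) (x : L) :
    dirDeriv (fun x => ∑ i ∈ s, χ i x) Y x = ∑ i ∈ s, dirDeriv (χ i) Y x := by
  classical
  induction s using Finset.induction_on with
  | empty =>
    simp only [Finset.sum_empty, dirDeriv, mfderiv_const]
    rfl
  | insert i s hi ih =>
    rw [Finset.sum_insert hi, ← ih]
    have h1 : HasMFDerivAt (𝓡 N) 𝓘(ℝ, ℝ) (χ i) x _ :=
      ((hχ i).mdifferentiable (by simp) x).hasMFDerivAt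
    have h2 : HasMFDerivAt (𝓡 N) 𝓘(ℝ, ℝ) (fun x => ∑ i ∈ s, χ i x) x _ :=
      (((contMDiff_finsetSum fun i _ => hχ i) :
        ContMDiff (𝓡 N) 𝓘(ℝ, ℝ) ∞ _).mdifferentiable (by simp) x).hasMFDerivAt
    have h3 : (fun x => ∑ i ∈ insert i s, χ i x) = χ i + fun x => ∑ i ∈ s, χ i x :=
      funext fun x => Finset.sum_insert hi
    rw [h3]
    exact congrArg (fun T => T (Y x)) (h1.add h2).mfderiv

/-- The Hamiltonian vector field of a function that vanishes along a Lagrangian submanifold is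
tangent to it. -/
lemma IsLagrangianEmbedding.exists_tangent {ι : L → Cotangent N Q} (hι : IsLagrangianEmbedding ι)
    {f : Cotangent N Q → ℝ} (hf : Smooth f) (hf0 : ∀ x, f (ι x) = 0) (x : L) :
    ∃ y : TangentSpace (𝓡 N) x, dEmb ι x y = hamField f (ι x) := by
  refine mem_range_of_isotropic (dEmb ι x) (hι.immersion x) (fun v w => ?_) (v := hamField f (ι x))
    fun w => ?_
  · exact (symplecticForm_self _ _ _).symm.trans (hι.isotropic x v w)
  · refine (symplecticForm_self _ _ _).symm.trans ((symplecticForm_hamField f (ι x) _).trans ?_)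
    have h1 := mfderiv_comp_apply x (g := f) (hf.mdifferentiable (by simp) (ι x))
      (hι.smooth.mdifferentiable (by simp) x) w
    have h2 : f ∘ ι = fun _ => 0 := funext hf0
    rw [h2, mfderiv_const] at h1
    exact h1.symm

variable [MeasurableSpace L] [BorelSpace L] {ε : ℝ} {ι₀ : L → Cotangent N Q}
  {Z : Potentials ε ι₀} {φ f b : Cotangent N Q → ℝ} {d r : L → ℝ}
  {Y : ∀ x : L, TangentSpace (𝓡 N) x}

/-- For a function `f` vanishing along `Λ`, with Hamiltonian vector field `Y` there, the defect is
`L_Y χ + χ d`, where `χ = ι^*(b φ)`. -/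
lemma defect_eq_of_tangent (hφ : Smooth φ) (hb : Smooth b) (hι : ContMDiff (𝓡 N) (cot N) ∞ Z.ι)
    (hf0 : ∀ x, f (Z.ι x) = 0) (hY : ∀ x, dEmb Z.ι x (Y x) = hamField f (Z.ι x)) (x : L) :
    defect φ f d b r Z x
      = dirDeriv (fun x => b (Z.ι x) * φ (Z.ι x)) Y x
        + b (Z.ι x) * φ (Z.ι x) * d x := by
  have h := mfderiv_comp_hamField (h := fun z => b z * φ z) (hb.mul hφ) hι (hY x)
  refine Eq.trans ?_ (congrArg (· + b (Z.ι x) * φ (Z.ι x) * d x) h.symm)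
  rw [poisson_mul_left hb hφ, poisson_antisymm b f, defect, hf0 x]
  ring

variable [T2Space L]

lemma integral_defect_of_tangent (hφ : Smooth φ) (hf : Smooth f) (hb : Smooth b)
    (hι : ContMDiff (𝓡 N) (cot N) ∞ Z.ι) (hd : Continuous d)
    (hf0 : ∀ x, f (Z.ι x) = 0) (hY : ∀ x, dEmb Z.ι x (Y x) = hamField f (Z.ι x))
    {K : Set L} (hK : IsCompact K) (hbK : ∀ x ∉ K, b (Z.ι x) = 0)
    (hbK' : ∀ x ∉ K, hamField b (Z.ι x) = 0) :
    Integrable (fun x => b (Z.ι x) * φ (Z.ι x) * d x) Z.μ ∧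
    Integrable (fun x =>
      dirDeriv (fun x => b (Z.ι x) * φ (Z.ι x)) Y x) Z.μ ∧
    ∫ x, defect φ f d b r Z x ∂Z.μ
      = (∫ x, dirDeriv (fun x => b (Z.ι x) * φ (Z.ι x)) Y x ∂Z.μ)
        + ∫ x, b (Z.ι x) * φ (Z.ι x) * d x ∂Z.μ := by
  have hbφ : Smooth fun z => b z * φ z := hb.mul hφ
  have i1 : Integrable (fun x => b (Z.ι x) * φ (Z.ι x) * d x) Z.μ := by
    refine integrable_of_continuous_of_compact hK
      ((hbφ.continuous.comp hι.continuous).mul hd) fun x hx => ?_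
    rw [hbK x hx]; ring
  have e : (fun x => dirDeriv (fun x => b (Z.ι x) * φ (Z.ι x)) Y x)
      = fun x => poisson (fun z => b z * φ z) f (Z.ι x) :=
    funext fun x => mfderiv_comp_hamField (h := fun z => b z * φ z) hbφ hι (hY x)
  have i2 : Integrable (fun x =>
      dirDeriv (fun x => b (Z.ι x) * φ (Z.ι x)) Y x) Z.μ := by
    rw [e]
    refine integrable_of_continuous_of_compact hK
      ((Smooth.poisson hbφ hf).continuous.comp hι.continuous) fun x hx => ?_
    rw [poisson_mul_left hb hφ, poisson_antisymm b f, poisson_eq_zero (hbK' x hx), hbK x hx]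
    ring
  refine ⟨i1, i2, ?_⟩
  rw [← integral_add i2 i1]
  exact integral_congr_ae (.of_forall fun x => defect_eq_of_tangent hφ hb hι hf0 hY x)

/-- The defect of a trivial pair integrates to zero. -/
lemma TrivialPair.integral_defect_eq_zero (h : TrivialPair Z f d) (hφ : Smooth φ) (hb : Smooth b)
    (hι : ContMDiff (𝓡 N) (cot N) ∞ Z.ι) (hd : Continuous d)
    {K : Set L} (hK : IsCompact K) (hbK : ∀ x ∉ K, b (Z.ι x) = 0)
    (hbK' : ∀ x ∉ K, hamField b (Z.ι x) = 0) :
    ∫ x, defect φ f d b r Z x ∂Z.μ = 0 := by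
  obtain ⟨hf, hf0, Y, hY, hL⟩ := h
  have hbφ : Smooth fun z => b z * φ z := hb.mul hφ
  obtain ⟨-, -, h3⟩ := integral_defect_of_tangent (r := r) hφ hf hb hι hd hf0 hY hK hbK hbK'
  have h4 : ∫ x, b (Z.ι x) * φ (Z.ι x) * d x ∂Z.μ
      = -∫ x, dirDeriv (fun x => b (Z.ι x) * φ (Z.ι x)) Y x ∂Z.μ :=
    hL _ (hbφ.comp hι) (HasCompactSupport.intro hK fun x hx => by simp [hbK x hx])
  rw [h3, h4, add_neg_cancel]

/-- Lie derivatives are determined locally. -/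
lemma isLieDerivative_of_local [SecondCountableTopology L] {μ : Measure L}
    (h : ∀ x₀ : L, ∃ U : Set L, IsOpen U ∧ x₀ ∈ U ∧ ∀ χ : L → ℝ, ContMDiff (𝓡 N) 𝓘(ℝ, ℝ) ∞ χ →
      HasCompactSupport χ → (∀ x ∉ U, χ x = 0) → Integrable (fun x => χ x * d x) μ ∧
        Integrable (fun x => dirDeriv χ Y x) μ ∧
        ∫ x, χ x * d x ∂μ = -∫ x, dirDeriv χ Y x ∂μ) :
    IsLieDerivative μ Y d := by
  intro χ hχ hχc
  choose U hUo hUm hU using h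
  have : LocallyCompactSpace L := ChartedSpace.locallyCompactSpace (Rn N) L
  obtain ⟨F, hF⟩ := SmoothPartitionOfUnity.exists_isSubordinate (𝓡 N) (isClosed_univ (X := L)) U hUo
    (fun x _ => mem_iUnion.2 ⟨x, hUm x⟩)
  have hfin : {i | (Function.support (F i) ∩ tsupport χ).Nonempty}.Finite :=
    F.locallyFinite.finite_nonempty_inter_compact hχc
  set s := hfin.toFinset
  have hpart : ∀ x, χ x = ∑ i ∈ s, F i x * χ x := fun x => by
    rw [← Finset.sum_mul]
    by_cases hx : χ x = 0
    · simp [hx]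
    · have h1 : ∑ i ∈ s, F i x = 1 := by
        rw [← F.sum_eq_one (mem_univ x)]
        refine (finsum_eq_sum_of_support_subset _ fun i hi => ?_).symm
        simp only [s, Set.Finite.coe_toFinset]
        exact ⟨x, hi, subset_tsupport _ hx⟩
      rw [h1, one_mul]
  have hsm : ∀ i, ContMDiff (𝓡 N) 𝓘(ℝ, ℝ) ∞ (fun x => F i x * χ x) := fun i =>
    (F i).contMDiff.mul hχ
  have hloc := fun i => hU i _ (hsm i) (hχc.mul_left (f := F i)) (fun x hx => by
    rw [image_eq_zero_of_notMem_tsupport (fun h => hx (hF i h)), zero_mul])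
  have e1 : (fun x => χ x * d x) = fun x => ∑ i ∈ s, F i x * χ x * d x := funext fun x => by
    rw [← Finset.sum_mul, ← hpart]
  have e2 : (fun x => dirDeriv χ Y x)
      = fun x => ∑ i ∈ s, dirDeriv (fun x => F i x * χ x) Y x :=
    funext fun x => by
      rw [← dirDeriv_sum s hsm]
      exact congrArg (fun χ => dirDeriv χ Y x) (funext hpart)
  change _ = -∫ x, dirDeriv χ Y x ∂μ
  rw [e1, e2, integral_finsetSum _ fun i _ => (hloc i).1,
    integral_finsetSum _ fun i _ => (hloc i).2.1, ← Finset.sum_neg_distrib]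
  exact Finset.sum_congr rfl fun i _ => (hloc i).2.2

end Tangent

/-! ### Extension of functions from a Lagrangian submanifold -/

section Extension
variable {N : ℕ} {Q : Type*} [TopologicalSpace Q] [ChartedSpace (Rn N) Q] [IsManifold (𝓡 N) ∞ Q]
  {L : Type*} [TopologicalSpace L] [ChartedSpace (Rn N) L] [IsManifold (𝓡 N) ∞ L]

lemma hamField_congr_of_eventuallyEq {f g : Cotangent N Q → ℝ} {z : Cotangent N Q}
    (h : f =ᶠ[𝓝 z] g) : hamField f z = hamField g z := by
  rw [hamField_eq, hamField_eq]
  have h0 : dfunLin f z = dfunLin g z := h.mfderiv_eq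
  rw [h0]

/-- Small balls around a point of `Λ` meet `Λ` only near this point. -/
lemma exists_closedBall {ι : L → Cotangent N Q} (hι : Topology.IsEmbedding ι) {x₀ : L} {V : Set L}
    (hV : IsOpen V) (hx : x₀ ∈ V) {W : Set (PhaseModel N)}
    (hW : W ∈ 𝓝 (extChartAt (cot N) (ι x₀) (ι x₀))) :
    ∃ R > 0, Metric.closedBall (extChartAt (cot N) (ι x₀) (ι x₀)) R
        ⊆ (extChartAt (cot N) (ι x₀)).target ∩ W ∧
      ∀ x, ι x ∈ liftSet (ι x₀) (Metric.closedBall (extChartAt (cot N) (ι x₀) (ι x₀)) R) →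
        x ∈ V := by
  obtain ⟨O, hO, rfl⟩ := hι.isInducing.isOpen_iff.1 hV
  have h1 : (extChartAt (cot N) (ι x₀)).symm ⁻¹' O ∈ 𝓝 (extChartAt (cot N) (ι x₀) (ι x₀)) := by
    refine (continuousAt_extChartAt_symm (I := cot N) (ι x₀)).preimage_mem_nhds (hO.mem_nhds ?_)
    rw [extChartAt_to_inv]
    exact hx
  obtain ⟨R, hR, hRs⟩ := Metric.nhds_basis_closedBall.mem_iff.1
    (Filter.inter_mem (Filter.inter_mem (extChartAt_target_mem_nhds (I := cot N) (ι x₀)) hW) h1)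
  refine ⟨R, hR, fun y hy => (hRs hy).1, ?_⟩
  rintro x ⟨y, hy, hyx⟩
  rw [mem_preimage, ← hyx]
  exact (hRs hy).2

/-- A Lagrangian embedding has smooth left inverses locally. -/
lemma IsLagrangianEmbedding.exists_leftInverse {ι : L → Cotangent N Q}
    (hι : IsLagrangianEmbedding ι) (x₀ : L) :
    ∃ (U : Set L) (W : Set (PhaseModel N)) (s : PhaseModel N → Rn N), IsOpen U ∧ x₀ ∈ U ∧
      IsOpen W ∧ extChartAt (cot N) (ι x₀) (ι x₀) ∈ W ∧ ContDiffOn ℝ ∞ s W ∧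
      MapsTo s W (extChartAt (𝓡 N) x₀).target ∧
      ∀ x ∈ U, x ∈ (extChartAt (𝓡 N) x₀).source ∧
        s (extChartAt (cot N) (ι x₀) (ι x)) = extChartAt (𝓡 N) x₀ x := by
  set c := extChartAt (𝓡 N) x₀ with hc
  set e := extChartAt (cot N) (ι x₀) with he
  set J : Rn N → PhaseModel N := fun η => e (ι (c.symm η)) with hJ
  set D : Set (Rn N) := c.target ∩ (fun η => ι (c.symm η)) ⁻¹' e.source
  have hcx : x₀ ∈ c.source := mem_extChartAt_source x₀
  have h1 : ContMDiffOn 𝓘(ℝ, Rn N) (cot N) ∞ (fun η => ι (c.symm η)) c.target :=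
    hι.smooth.comp_contMDiffOn (contMDiffOn_extChartAt_symm x₀)
  have hDo : IsOpen D := h1.continuousOn.isOpen_inter_preimage (isOpen_extChartAt_target x₀)
    (isOpen_extChartAt_source (I := cot N) (ι x₀))
  have hJD : ContDiffOn ℝ ∞ J D := by
    have h2 := (contMDiffOn_extChartAt (I := cot N) (n := ∞) (x := ι x₀)).comp
      (h1.mono (s := c.target) (t := D) inter_subset_left) (fun q hq => by
        have := hq.2
        rwa [mem_preimage, he, extChartAt_source] at this)
    exact h2.contDiffOn
  set η₀ := c x₀
  have hη₀ : η₀ ∈ D := ⟨c.map_source hcx, by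
    simp only [mem_preimage, η₀, c.left_inv hcx]
    exact mem_extChartAt_source (I := cot N) (ι x₀)⟩
  have hJη : J η₀ = e (ι x₀) := by simp only [J, η₀, c.left_inv hcx]
  have hJd : HasFDerivAt J (fderiv ℝ J η₀) η₀ :=
    ((hJD.contDiffAt (hDo.mem_nhds hη₀)).differentiableAt (by simp)).hasFDerivAt
  have hinj : Function.Injective (fderiv ℝ J η₀) := by
    rw [injective_iff_map_eq_zero]
    intro w hw
    obtain ⟨v, hv⟩ := (isInvertible_mfderiv_extChartAt (I := 𝓡 N) hcx).bijective.2 w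
    have h2 := mfderiv_comp_apply x₀ (g := J) (f := c) hJd.differentiableAt.mdifferentiableAt
      (mdifferentiableAt_extChartAt (I := 𝓡 N) (mem_chart_source _ x₀)) v
    have h3 := mfderiv_comp_apply x₀ (g := e) (f := ι)
      (mdifferentiableAt_extChartAt (I := cot N) (mem_chart_source _ (ι x₀)))
      (hι.smooth.mdifferentiable (by simp) x₀) v
    have h4 : J ∘ c =ᶠ[𝓝 x₀] e ∘ ι := by
      filter_upwards [extChartAt_source_mem_nhds (I := 𝓡 N) x₀] with x hx
      simp only [Function.comp_apply, J, c.left_inv hx]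
    rw [h4.mfderiv_eq] at h2
    have h5 : mfderiv (cot N) 𝓘(ℝ, PhaseModel N) e (ι x₀) (dEmb ι x₀ v) = 0 := by
      refine (h3.symm.trans h2).trans ?_
      rw [mfderiv_eq_fderiv]
      exact (congrArg (fderiv ℝ J η₀) hv).trans hw
    have h6 : dEmb ι x₀ v = 0 := by
      refine (isInvertible_mfderiv_extChartAt (I := cot N)
        (mem_extChartAt_source (I := cot N) (ι x₀))).bijective.1 (h5.trans (map_zero _).symm)
    have h7 : v = 0 := hι.immersion x₀ (h6.trans (map_zero _).symm)
    rw [← hv, h7]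
    exact map_zero _
  obtain ⟨A', hA'⟩ := (fderiv ℝ J η₀ : Rn N →ₗ[ℝ] PhaseModel N).exists_leftInverse_of_injective
    (LinearMap.ker_eq_bot.2 hinj)
  set A : PhaseModel N →L[ℝ] Rn N := LinearMap.toContinuousLinearMap A' with hA
  set T : Rn N → Rn N := fun η => A (J η) with hT
  have hTD : ContDiffOn ℝ ∞ T D := A.contDiff.comp_contDiffOn hJD
  have hTd : HasFDerivAt T ((ContinuousLinearEquiv.refl ℝ (Rn N) : Rn N ≃L[ℝ] Rn N) :
      Rn N →L[ℝ] Rn N) η₀ := by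
    refine (A.hasFDerivAt.comp η₀ hJd).congr_fderiv ?_
    ext1 w
    exact congrArg (fun T => T w) hA'
  have hTc := hTD.contDiffAt (hDo.mem_nhds hη₀)
  set h := hTc.toOpenPartialHomeomorph T hTd (by simp) with hh
  have hhs : η₀ ∈ h.source := hTc.mem_toOpenPartialHomeomorph_source hTd (by simp)
  have hev : ∀ᶠ η in 𝓝 η₀, fderiv ℝ T η ∈ range ((↑) : (Rn N ≃L[ℝ] Rn N) → Rn N →L[ℝ] Rn N) := by
    have hcont : ContinuousAt (fderiv ℝ T) η₀ :=
      (hTc.fderiv_right (m := 0) (by norm_num)).continuousAt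
    refine hcont.eventually ?_
    rw [hTd.fderiv]
    exact ContinuousLinearEquiv.nhds _
  obtain ⟨D₁, hD₁, hD₁o, hηD₁⟩ := eventually_nhds_iff.1 (hev.and (hDo.mem_nhds hη₀))
  set h' := h.restrOpen D₁ hD₁o
  have hsrc : ∀ η ∈ h'.source, η ∈ h.source ∧ η ∈ D₁ := fun η hη => hη
  have hη' : η₀ ∈ h'.source := ⟨hhs, hηD₁⟩
  have hT' : ∀ η, h' η = T η := fun η => rfl
  refine ⟨c.source ∩ c ⁻¹' h'.source, A ⁻¹' h'.target, fun y => h'.symm (A y),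
    (continuousOn_extChartAt x₀).isOpen_inter_preimage (isOpen_extChartAt_source x₀) h'.open_source,
    ⟨hcx, hη'⟩, h'.open_target.preimage A.continuous, ?_, ?_, ?_, ?_⟩
  · have := h'.map_source hη'
    rw [mem_preimage, ← hJη]
    exact this
  · intro y hy
    refine (ContDiffAt.comp y ?_ A.contDiff.contDiffAt).contDiffWithinAt
    have h1 := h'.map_target hy
    obtain ⟨⟨u, hu⟩, hD₂⟩ := hD₁ _ (hsrc _ h1).2
    refine h'.contDiffAt_symm hy (f₀' := u) ?_ (hTD.contDiffAt (hDo.mem_nhds hD₂))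
    rw [hu]
    exact ((hTD.contDiffAt (hDo.mem_nhds hD₂)).differentiableAt (by simp)).hasFDerivAt
  · intro y hy
    exact (hD₁ _ (hsrc _ (h'.map_target hy)).2).2.1
  · rintro x ⟨hx, hx'⟩
    refine ⟨hx, ?_⟩
    have h1 := h'.left_inv hx'
    rw [hT'] at h1
    simpa only [T, J, c.left_inv hx] using h1

lemma contDiff_bump_mul {y₀ : PhaseModel N} (θ : ContDiffBump y₀) {W : Set (PhaseModel N)}
    (hW : IsOpen W) (hθ : Metric.closedBall y₀ θ.rOut ⊆ W) {u : PhaseModel N → ℝ}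
    (hu : ContDiffOn ℝ ∞ u W) : ContDiff ℝ ∞ (fun y => θ y * u y) := by
  rw [contDiff_iff_contDiffAt]
  intro y
  by_cases hy : y ∈ Metric.closedBall y₀ θ.rOut
  · exact θ.contDiff.contDiffAt.mul (hu.contDiffAt (hW.mem_nhds (hθ hy)))
  · refine (contDiffAt_const (c := (0 : ℝ))).congr_of_eventuallyEq ?_
    filter_upwards [Metric.isClosed_closedBall.isOpen_compl.mem_nhds hy] with w hw
    rw [θ.zero_of_le_dist (le_of_not_ge fun h => hw (Metric.mem_closedBall.2 h)), zero_mul]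

lemma bump_eq_zero {y₀ : PhaseModel N} (θ : ContDiffBump y₀) {y : PhaseModel N}
    (hy : y ∉ Metric.closedBall y₀ θ.rOut) : θ y = 0 :=
  θ.zero_of_le_dist (le_of_not_ge fun h => hy (Metric.mem_closedBall.2 h))

/-- Functions on `L` supported near a point extend to functions of the coordinates supported in a
given ball. -/
lemma IsLagrangianEmbedding.exists_extension {ι : L → Cotangent N Q}
    (hι : IsLagrangianEmbedding ι) (x₀ : L) {R : ℝ} (hR : 0 < R) :
    ∃ U : Set L, IsOpen U ∧ x₀ ∈ U ∧ ∀ χ : L → ℝ, ContMDiff (𝓡 N) 𝓘(ℝ, ℝ) ∞ χ →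
      (∀ x ∉ U, χ x = 0) → ∃ G : PhaseModel N → ℝ, ContDiff ℝ ∞ G ∧
        (∀ y ∉ Metric.closedBall (extChartAt (cot N) (ι x₀) (ι x₀)) R, G y = 0) ∧
        ∀ x, extFun (ι x₀) G (ι x) = χ x := by
  obtain ⟨U₁, W, s, hU₁, hxU₁, hW, hyW, hs, hst, hinv⟩ := hι.exists_leftInverse x₀
  set y₀ := extChartAt (cot N) (ι x₀) (ι x₀)
  obtain ⟨R₁, hR₁, hR₁W, hR₁U⟩ := exists_closedBall hι.embedding hU₁ hxU₁ (hW.mem_nhds hyW)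
  set R₂ := min R R₁
  have hR₂ : 0 < R₂ := lt_min hR hR₁
  have hsub : Metric.closedBall y₀ R₂ ⊆ Metric.closedBall y₀ R₁ :=
    Metric.closedBall_subset_closedBall (min_le_right _ _)
  let θ : ContDiffBump y₀ := ⟨R₂ / 2, R₂, half_pos hR₂, half_lt_self hR₂⟩
  have hset : IsOpen {x | ι x ∈ (extChartAt (cot N) (ι x₀)).source ∧
      extChartAt (cot N) (ι x₀) (ι x) ∈ Metric.ball y₀ (R₂ / 2)} :=
    ((continuousOn_extChartAt (I := cot N) (ι x₀)).isOpen_inter_preimage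
      (isOpen_extChartAt_source (ι x₀)) Metric.isOpen_ball).preimage hι.smooth.continuous
  refine ⟨_, hset, ⟨mem_extChartAt_source (I := cot N) (ι x₀),
    Metric.mem_ball_self (half_pos hR₂)⟩, fun χ hχ hχU => ?_⟩
  refine ⟨fun y => θ y * χ ((extChartAt (𝓡 N) x₀).symm (s y)), ?_, fun y hy => ?_, fun x => ?_⟩
  · refine contDiff_bump_mul θ hW (fun y hy => (hR₁W (hsub hy)).2) ?_
    have h1 : ContDiffOn ℝ ∞ (fun η => χ ((extChartAt (𝓡 N) x₀).symm η))
        (extChartAt (𝓡 N) x₀).target :=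
      (hχ.comp_contMDiffOn (contMDiffOn_extChartAt_symm x₀)).contDiffOn
    exact h1.comp hs hst
  · dsimp only
    rw [bump_eq_zero θ fun h => hy (Metric.closedBall_subset_closedBall (min_le_left _ _) h),
      zero_mul]
  · by_cases hx : ι x ∈ (extChartAt (cot N) (ι x₀)).source
    · rw [extFun_of_mem hx]
      by_cases hy : extChartAt (cot N) (ι x₀) (ι x) ∈ Metric.closedBall y₀ R₂
      · obtain ⟨h1, h2⟩ := hinv x (hR₁U x ⟨_, hsub hy, (extChartAt (cot N) (ι x₀)).left_inv hx⟩)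
        rw [h2, (extChartAt (𝓡 N) x₀).left_inv h1]
        by_cases h3 : χ x = 0
        · rw [h3, mul_zero]
        · have h4 := not_imp_comm.1 (hχU x) h3
          rw [θ.one_of_mem_closedBall (Metric.ball_subset_closedBall h4.2), one_mul]
      · rw [bump_eq_zero θ hy, zero_mul, hχU x fun h => hy
          (Metric.closedBall_subset_closedBall (half_le_self hR₂.le)
            (Metric.ball_subset_closedBall h.2))]
    · rw [extFun_of_notMem hx, hχU x fun h => hx h.1]

end Extension

/-! ### Solutions of the defining equation -/

section Equivalence
variable {N : ℕ} {Q : Type*} [TopologicalSpace Q] [T2Space Q] [ChartedSpace (Rn N) Q]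
  [IsManifold (𝓡 N) ∞ Q]
  {L : Type*} [TopologicalSpace L] [T2Space L] [ConnectedSpace L] [ChartedSpace (Rn N) L]
  [IsManifold (𝓡 N) ∞ L]
  [MeasurableSpace L] [BorelSpace L] {ε : ℝ} {ι₀ : L → Cotangent N Q} {p : L}
  {ρ : ℝ → Cotangent N Q → ℝ}

lemma continuous_hamiltonianR
    (hρ : ContMDiff (𝓘(ℝ, ℝ).prod (cot N)) 𝓘(ℝ, ℝ) ∞ (fun y : ℝ × Cotangent N Q => ρ y.1 y.2))
    (h0 : ∀ t z, ρ t z ≠ 0) {Z : Potentials ε ι₀} (hι : Continuous Z.ι) (t : ℝ) {k : L → ℝ}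
    (hk : Continuous k) {P : Cotangent N Q → ℝ} (hP : Smooth P) :
    Continuous (hamiltonianR ρ t P k Z) := by
  have hρt : Smooth (ρ t) := contMDiff_param hρ t
  have htd : Continuous (timeDeriv ρ t) :=
    ((contMDiff_fderiv_param hρ).continuous.comp (Continuous.prodMk_right t)).clm_apply
      continuous_const
  have hs : Smooth fun z => 1 / ρ t z * P z := by
    have h : (fun z => 1 / ρ t z * P z) = fun z => (ρ t z)⁻¹ * P z := by funext z; simp
    rw [h]
    exact (hρt.inv₀ (h0 t)).mul hP
  have hpo : Continuous (poisson (ρ t) fun z => 1 / ρ t z * P z) :=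
    (Smooth.poisson hρt hs).continuous
  exact ((continuous_const.div hρt.continuous (h0 t)).comp hι).mul
    ((hk.sub (htd.comp hι)).add (hpo.comp hι))

/-- Near every point of `Λ` the defining equation is tested by arbitrary variations of small
support. -/
lemma IsHamiltonianVector.exists_test (hι₀ : IsLagrangianEmbedding ι₀)
    (hρ : ContMDiff (𝓘(ℝ, ℝ).prod (cot N)) 𝓘(ℝ, ℝ) ∞ (fun y : ℝ × Cotangent N Q => ρ y.1 y.2))
    (h0 : ∀ t z, ρ t z ≠ 0) {H : ℝ → PhaseSpace ε ι₀ p → ℝ} {t : ℝ} {Z : Potentials ε ι₀}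
    {k : L → ℝ} {P : Cotangent N Q → ℝ} (hk : Continuous k) (hP : Smooth P)
    (hH : HasDifferential p (H t) Z k P) {g : Cotangent N Q → ℝ} {r : L → ℝ} (hg : Smooth g)
    (hr : ContMDiff (𝓡 N) 𝓘(ℝ, ℝ) ∞ r) (h : IsHamiltonianVector ρ p H t Z g r) (x₀ : L) :
    ∃ R > 0, Metric.closedBall (extChartAt (cot N) (Z.ι x₀) (Z.ι x₀)) R
        ⊆ (extChartAt (cot N) (Z.ι x₀)).target ∧
      IsCompact (Z.ι ⁻¹' liftSet (Z.ι x₀)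
        (Metric.closedBall (extChartAt (cot N) (Z.ι x₀) (Z.ι x₀)) R)) ∧
      ∀ G : PhaseModel N → ℝ, ContDiff ℝ ∞ G →
        (∀ y ∉ Metric.closedBall (extChartAt (cot N) (Z.ι x₀) (Z.ι x₀)) R, G y = 0) →
        ∀ rb : L → ℝ, ContMDiff (𝓡 N) 𝓘(ℝ, ℝ) ∞ rb →
        (∀ x, Z.ι x ∉ liftSet (Z.ι x₀)
          (Metric.closedBall (extChartAt (cot N) (Z.ι x₀) (Z.ι x₀)) R) → rb x = 0) →
        ∫ x, defect (ρ t) (fun z => g z - hamiltonianG (ρ t) P z)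
          (fun x => r x - hamiltonianR ρ t P k Z x) (extFun (Z.ι x₀) G) rb Z x ∂Z.μ = 0 := by
  have hZ : IsLagrangianEmbedding Z.ι := Z.mem_component.isLagrangianEmbedding hι₀
  have : LocallyCompactSpace L := ChartedSpace.locallyCompactSpace (Rn N) L
  obtain ⟨K, hK, hxK⟩ := exists_compact_mem_nhds x₀
  set z₀ := Z.ι x₀
  set y₀ := extChartAt (cot N) z₀ z₀
  obtain ⟨R, hR, hRt, hRK⟩ := exists_closedBall hZ.embedding isOpen_interior
    (mem_interior_iff_mem_nhds.2 hxK) (W := univ) Filter.univ_mem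
  have hCt : Metric.closedBall y₀ R ⊆ (extChartAt (cot N) z₀).target := fun y hy => (hRt hy).1
  have hC : IsCompact (Metric.closedBall y₀ R) := isCompact_closedBall _ _
  have hsub : Metric.closedBall y₀ (R / 4) ⊆ Metric.closedBall y₀ R :=
    Metric.closedBall_subset_closedBall (by linarith)
  have hC' : IsCompact (Metric.closedBall y₀ (R / 4)) := isCompact_closedBall _ _
  have hKl : ∀ x, Z.ι x ∈ liftSet z₀ (Metric.closedBall y₀ R) → x ∈ K := fun x hx =>
    interior_subset (hRK x hx)
  have hcl := (isCompact_liftSet hC' (hsub.trans hCt)).isClosed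
  refine ⟨R / 4, by linarith, hsub.trans hCt, ?_, fun G hG hG0 rb hrb hrb0 => ?_⟩
  · exact hK.of_isClosed_subset (hcl.preimage hZ.smooth.continuous)
      fun x hx => hKl x (image_mono hsub hx)
  -- the vector is cut off away from the support of the variation
  let θ : ContDiffBump y₀ := ⟨R / 2, R, half_pos hR, half_lt_self hR⟩
  set G₁ : PhaseModel N → ℝ := fun y => θ y * g ((extChartAt (cot N) z₀).symm y) with hG₁
  have hG₁s : ContDiff ℝ ∞ G₁ := by
    refine contDiff_bump_mul θ (isOpen_extChartAt_target z₀) hCt ?_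
    exact (hg.comp_contMDiffOn (contMDiffOn_extChartAt_symm z₀)).contDiffOn
  have hG₁0 : ∀ y ∉ Metric.closedBall y₀ R, G₁ y = 0 := fun y hy => by
    simp only [G₁]
    rw [bump_eq_zero θ hy, zero_mul]
  have hG0' : ∀ y ∉ Metric.closedBall y₀ R, G y = 0 := fun y hy => hG0 y fun h => hy (hsub h)
  obtain ⟨Φ⟩ := exists_symplecticFamily hC hG₁s hG hG₁0 hG0'
  have hθs : Smooth (extFun z₀ θ) := smooth_extFun hC hCt θ.contDiff fun y hy => bump_eq_zero θ hy
  set r₁ : L → ℝ := fun x => extFun z₀ θ (Z.ι x) * r x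
  have hr₁ : ContMDiff (𝓡 N) 𝓘(ℝ, ℝ) ∞ r₁ := (hθs.comp hZ.smooth).mul hr
  have hoff : ∀ x ∉ K, Z.ι x ∉ liftSet z₀ (Metric.closedBall y₀ R) := fun x hx h => hx (hKl x h)
  obtain ⟨F, hFZ, hFK, ha, hb⟩ := Φ.exists_smoothFamily hC hCt hZ p hK hKl hr₁ hrb
    (fun x hx => by
      have : extFun z₀ θ (Z.ι x) = 0 :=
        extZero_off hCt (fun _ y hy => bump_eq_zero θ hy) (hoff x hx)
      simp only [r₁]
      rw [this, zero_mul])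
    (fun x hx => hrb0 x fun h => hoff x hx (image_mono hsub h))
  have ea : (fun z => Φ.liftGen z₀ (1, 0) (0, z)) = extFun z₀ G₁ := Φ.liftGen_fst_zero z₀
  have eb : (fun z => Φ.liftGen z₀ (0, 1) (0, z)) = extFun z₀ G := Φ.liftGen_snd_zero z₀
  have hab : ∀ x, ((fun z => Φ.liftGen z₀ (1, 0) (0, z)) (Z.ι x) = g (Z.ι x) ∧
      hamField (fun z => Φ.liftGen z₀ (1, 0) (0, z)) (Z.ι x) = hamField g (Z.ι x) ∧ r₁ x = r x) ∨
      ((fun z => Φ.liftGen z₀ (0, 1) (0, z)) (Z.ι x) = 0 ∧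
        hamField (fun z => Φ.liftGen z₀ (0, 1) (0, z)) (Z.ι x) = 0 ∧ rb x = 0) := by
    intro x
    rw [ea, eb]
    by_cases hx : Z.ι x ∈ liftSet z₀ (Metric.closedBall y₀ (R / 4))
    · left
      obtain ⟨hxs, hxb⟩ := (mem_liftSet (hsub.trans hCt)).1 hx
      have hball : extChartAt (cot N) z₀ (Z.ι x) ∈ Metric.ball y₀ (R / 2) :=
        Metric.closedBall_subset_ball (by linarith) hxb
      have hev : extFun z₀ G₁ =ᶠ[𝓝 (Z.ι x)] g := by
        filter_upwards [((continuousOn_extChartAt (I := cot N) z₀).isOpen_inter_preimage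
          (isOpen_extChartAt_source z₀) Metric.isOpen_ball).mem_nhds ⟨hxs, hball⟩] with w hw
        rw [extFun_of_mem hw.1]
        simp only [G₁]
        rw [θ.one_of_mem_closedBall (Metric.ball_subset_closedBall hw.2), one_mul,
          (extChartAt (cot N) z₀).left_inv hw.1]
      refine ⟨hev.eq_of_nhds, hamField_congr_of_eventuallyEq hev, ?_⟩
      simp only [r₁]
      rw [extFun_of_mem hxs, θ.one_of_mem_closedBall (Metric.ball_subset_closedBall hball), one_mul]
    · right
      have hev : extFun z₀ G =ᶠ[𝓝 (Z.ι x)] fun _ => 0 := by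
        filter_upwards [hcl.isOpen_compl.mem_nhds hx] with w hw
        exact extZero_off (hsub.trans hCt) (fun _ y hy => hG0 y hy) hw
      exact ⟨hev.eq_of_nhds, hamField_eq_zero_of_eventuallyEq hev, hrb0 x hx⟩
  have key := (hamiltonian_equation_iff hρ h0 hk hP hH hg F hFZ hK hFK ha hb hab).1
    (h F K _ _ _ _ hFZ hK hFK ha hb hab)
  rw [eb] at key
  exact key

/-- The tangent vectors satisfying the defining equation are those equal to
`(hamiltonianG, hamiltonianR μ)`, as elements of the quotient by the trivial pairs. -/
theorem isHamiltonianVector_iff [SecondCountableTopology L] (hι₀ : IsLagrangianEmbedding ι₀)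
    (hρ : ContMDiff (𝓘(ℝ, ℝ).prod (cot N)) 𝓘(ℝ, ℝ) ∞ (fun y : ℝ × Cotangent N Q => ρ y.1 y.2))
    (h0 : ∀ t z, ρ t z ≠ 0) {H : ℝ → PhaseSpace ε ι₀ p → ℝ} {t : ℝ} {Z : Potentials ε ι₀}
    {k : L → ℝ} {P : Cotangent N Q → ℝ} (hk : Continuous k) (hP : Smooth P)
    (hH : HasDifferential p (H t) Z k P) {g : Cotangent N Q → ℝ} {r : L → ℝ} (hg : Smooth g)
    (hr : ContMDiff (𝓡 N) 𝓘(ℝ, ℝ) ∞ r) :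
    IsHamiltonianVector ρ p H t Z g r ↔
      SameTangent Z g r (hamiltonianG (ρ t) P) (hamiltonianR ρ t P k Z) := by
  have hZ : IsLagrangianEmbedding Z.ι := Z.mem_component.isLagrangianEmbedding hι₀
  have hρt : Smooth (ρ t) := contMDiff_param hρ t
  have hf : Smooth fun z => g z - hamiltonianG (ρ t) P z :=
    hg.sub (smooth_hamiltonianG hρt (h0 t) hP)
  have hd : Continuous fun x => r x - hamiltonianR ρ t P k Z x :=
    hr.continuous.sub (continuous_hamiltonianR hρ h0 hZ.smooth.continuous t hk hP)
  constructor
  · intro h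
    -- variations of the density alone show that the difference of the generators vanishes on `Λ`
    have hf0 : ∀ x, g (Z.ι x) - hamiltonianG (ρ t) P (Z.ι x) = 0 := by
      intro x₀
      obtain ⟨R, hR, hRt, hRK, htest⟩ := h.exists_test hι₀ hρ h0 hk hP hH hg hr x₀
      set z₀ := Z.ι x₀
      set y₀ := extChartAt (cot N) z₀ z₀
      let θ : ContDiffBump y₀ := ⟨R / 2, R, half_pos hR, half_lt_self hR⟩
      have hθs : Smooth (extFun z₀ θ) :=
        smooth_extFun (isCompact_closedBall _ _) hRt θ.contDiff fun y hy => bump_eq_zero θ hy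
      have hθ0 : ∀ z ∉ liftSet z₀ (Metric.closedBall y₀ R), extFun z₀ θ z = 0 := fun z hz =>
        extZero_off hRt (fun _ y hy => bump_eq_zero θ hy) hz
      set u : Cotangent N Q → ℝ := fun z => ρ t z * (g z - hamiltonianG (ρ t) P z)
      have hu : Smooth u := hρt.mul hf
      have hI := htest (fun _ => 0) contDiff_const (fun _ _ => rfl)
        (fun x => extFun z₀ θ (Z.ι x) * u (Z.ι x)) ((hθs.mul hu).comp hZ.smooth)
        (fun x hx => by rw [hθ0 _ hx, zero_mul])
      have hz : extFun z₀ (fun _ => 0) = fun _ => (0 : ℝ) := by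
        funext z; exact ite_self (0 : ℝ)
      have hI' : ∫ x, extFun z₀ θ (Z.ι x) * u (Z.ι x) ^ 2 ∂Z.μ = 0 := by
        rw [← neg_eq_zero, ← integral_neg, ← hI]
        refine integral_congr_ae (.of_forall fun x => ?_)
        have hh : hamField (fun _ : Cotangent N Q => (0 : ℝ)) (Z.ι x) = 0 :=
          hamField_eq_zero_of_eventuallyEq (c := 0) Filter.EventuallyEq.rfl
        simp only [defect, hz, poisson_eq_zero hh, u]
        ring
      by_contra hne
      have hpos : 0 < ∫ x, extFun z₀ θ (Z.ι x) * u (Z.ι x) ^ 2 ∂Z.μ := by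
        refine Continuous.integral_pos_of_hasCompactSupport_nonneg_nonzero (x := x₀) ?_ ?_ ?_ ?_
        · exact (hθs.continuous.comp hZ.smooth.continuous).mul
            ((hu.continuous.comp hZ.smooth.continuous).pow 2)
        · refine HasCompactSupport.intro hRK fun x hx => ?_
          rw [hθ0 _ hx, zero_mul]
        · intro x
          refine mul_nonneg ?_ (sq_nonneg _)
          unfold extFun extZero
          split_ifs
          · exact θ.nonneg
          · exact le_rfl
        · rw [extFun_of_mem (mem_extChartAt_source (I := cot N) z₀),
            θ.one_of_mem_closedBall (Metric.mem_closedBall_self (half_pos hR).le), one_mul]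
          exact pow_ne_zero 2 (mul_ne_zero (h0 t z₀) hne)
      exact hpos.ne' hI'
    choose Y hY using hZ.exists_tangent hf hf0
    refine ⟨hf, hf0, Y, hY, isLieDerivative_of_local fun x₀ => ?_⟩
    obtain ⟨R, hR, hRt, hRK, htest⟩ := h.exists_test hι₀ hρ h0 hk hP hH hg hr x₀
    obtain ⟨U, hU, hxU, hext⟩ := hZ.exists_extension x₀ hR
    refine ⟨U, hU, hxU, fun χ hχ _ hχU => ?_⟩
    -- the test function is of the form `ι^*(b ρ)`
    obtain ⟨G, hG, hG0, hGχ⟩ := hext (fun x => χ x * (ρ t (Z.ι x))⁻¹)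
      (hχ.mul ((hρt.inv₀ (h0 t)).comp hZ.smooth)) (fun x hx => by rw [hχU x hx, zero_mul])
    have hI := htest G hG hG0 (fun _ => 0) contMDiff_const fun _ _ => rfl
    have hb : Smooth (extFun (Z.ι x₀) G) := smooth_extFun (isCompact_closedBall _ _) hRt hG hG0
    have hb0 : ∀ z ∉ liftSet (Z.ι x₀) (Metric.closedBall (extChartAt (cot N) (Z.ι x₀) (Z.ι x₀)) R),
        extFun (Z.ι x₀) G z = 0 := fun z hz => extZero_off hRt (fun _ y hy => hG0 y hy) hz
    obtain ⟨i1, i2, e⟩ := integral_defect_of_tangent (r := fun _ => 0) hρt hf hb hZ.smooth hd hf0 hY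
      hRK (fun x hx => hb0 _ hx) (fun x hx => hamField_eq_zero_of_eventuallyEq (c := 0) (by
        filter_upwards [(isCompact_liftSet (isCompact_closedBall _ _)
          hRt).isClosed.isOpen_compl.mem_nhds hx] with w hw using hb0 w hw))
    have hχe : (fun x => extFun (Z.ι x₀) G (Z.ι x) * ρ t (Z.ι x)) = χ := by
      funext x
      rw [hGχ x, mul_assoc, inv_mul_cancel₀ (h0 t _), mul_one]
    have hχe' : ∀ x, extFun (Z.ι x₀) G (Z.ι x) * ρ t (Z.ι x) = χ x := congrFun hχe
    rw [hχe] at i2 e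
    simp only [hχe'] at i1 e
    refine ⟨i1, i2, ?_⟩
    rw [hI] at e
    linarith
  · intro h F K a b ra rb hFZ hK hoff ha hb hab
    refine (hamiltonian_equation_iff hρ h0 hk hP hH hg F hFZ hK hoff ha hb hab).2 ?_
    have hF0 := hb.represents 0
    refine TrivialPair.integral_defect_eq_zero h hρt hF0.smooth hZ.smooth hd hK (fun x hx => ?_)
      fun x hx => ?_
    · rw [← hFZ]
      exact hb.supported 0 x hx
    · rw [← hFZ]
      exact hoff.hamField_eq_zero hF0 hx

end Equivalence

/-! ### The energy functional and the equations of motion -/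

section Dynamics
variable {N : ℕ} {Q : Type*} [TopologicalSpace Q] [ChartedSpace (Rn N) Q]
  [IsManifold (𝓡 N) ∞ Q]
  {L : Type*} [TopologicalSpace L] [T2Space L] [ChartedSpace (Rn N) L]
  [IsManifold (𝓡 N) ∞ L]
  [MeasurableSpace L] [BorelSpace L] {ε : ℝ} {ι₀ : L → Cotangent N Q} {p : L}
  {E ρ : ℝ → Cotangent N Q → ℝ}

lemma contMDiff_rho {D : Cotangent N Q → ℝ → ℝ → ℝ}
    (hD : ContMDiff ((cot N).prod (𝓘(ℝ, ℝ).prod 𝓘(ℝ, ℝ))) 𝓘(ℝ, ℝ) ∞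
      (fun y : Cotangent N Q × ℝ × ℝ => D y.1 y.2.1 y.2.2))
    (hE : ContMDiff (𝓘(ℝ, ℝ).prod (cot N)) 𝓘(ℝ, ℝ) ∞ (fun y : ℝ × Cotangent N Q => E y.1 y.2)) :
    ContMDiff (𝓘(ℝ, ℝ).prod (cot N)) 𝓘(ℝ, ℝ) ∞
      (fun y : ℝ × Cotangent N Q => rho D E y.1 y.2) := by
  have h1 : ContMDiff (𝓘(ℝ, ℝ).prod ((cot N).prod 𝓘(ℝ, ℝ))) 𝓘(ℝ, ℝ) ∞
      (fun q : ℝ × (Cotangent N Q × ℝ) => D q.2.1 q.2.2 q.1) :=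
    hD.comp (((contMDiff_fst.comp contMDiff_snd).prodMk
      ((contMDiff_snd.comp contMDiff_snd).prodMk contMDiff_fst)))
  have h2 := contMDiff_fderiv_param (f := fun (U : ℝ) (q : Cotangent N Q × ℝ) => D q.1 q.2 U) h1
  have h3 : ContMDiff (𝓘(ℝ, ℝ).prod (cot N)) (𝓘(ℝ, ℝ).prod ((cot N).prod 𝓘(ℝ, ℝ))) ∞
      (fun y : ℝ × Cotangent N Q => (-E y.1 y.2, (y.2, y.1))) :=
    hE.neg.prodMk (contMDiff_snd.prodMk contMDiff_fst)
  have h4 := (h2.comp h3).clm_apply (contMDiff_const (c := (1 : ℝ)))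
  exact h4

/-- The differential of the energy, by differentiation under the integral sign. -/
lemma hasDifferential_energy {t : ℝ} (hE : Smooth (E t)) (hρ : Smooth (ρ t))
    {Z : Potentials ε ι₀} (hint : Integrable (fun x => E t (Z.ι x) * ρ t (Z.ι x)) Z.μ) :
    HasDifferential p (energy E ρ p t) Z (fun _ => 0) (fun z => -(E t z * ρ t z)) := by
  intro F K g r hFZ hK hoff hg
  subst hFZ
  have he : Smooth fun z => E t z * ρ t z := hE.mul hρ
  have hrep := hg.represents 0
  have hιc : Continuous (F.pt 0).ι := (F.emb_contMDiff 0).continuous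
  obtain ⟨-, d1⟩ := hasDerivAt_integral_line (μ := (F.pt 0).μ)
    (f := fun s x => E t ((F.pt s).ι x) * ρ t ((F.pt s).ι x) * F.dens s x)
    ((F.comp_contMDiff he).mul F.smooth_dens) hK
    (fun s x hx => by rw [(hoff s x hx).1, (hoff s x hx).2, (hoff 0 x hx).2])
    (by simpa only [F.dens_zero, mul_one] using hint) 1
  have hval : ∀ x, fderiv ℝ (fun s => E t ((F.pt s).ι x) * ρ t ((F.pt s).ι x) * F.dens s x) 0 1
      = poisson (fun z => E t z * ρ t z) (g 0) ((F.pt 0).ι x)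
        + E t ((F.pt 0).ι x) * ρ t ((F.pt 0).ι x) * r 0 x := fun x => by
    have a1 : DifferentiableAt ℝ (fun s => E t ((F.pt s).ι x) * ρ t ((F.pt s).ι x)) 0 :=
      (contDiff_param (f := fun s x => E t ((F.pt s).ι x) * ρ t ((F.pt s).ι x))
        (F.comp_contMDiff he) x).differentiable (by simp) 0
    have a2 : DifferentiableAt ℝ (fun s => F.dens s x) 0 :=
      (F.dens_contDiff x).differentiable (by simp) 0
    have a3 := hrep.fderiv_comp he x
    have a4 := hrep.dens x
    rw [(a1.hasFDerivAt.fun_mul a2.hasFDerivAt).fderiv]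
    simp only [add_apply, smul_apply, smul_eq_mul]
    rw [a3, a4, F.dens_zero]
    ring
  have i1 : Integrable (fun x => poisson (fun z => E t z * ρ t z) (g 0) ((F.pt 0).ι x))
      (F.pt 0).μ :=
    integrable_of_continuous_of_compact hK
      ((Smooth.poisson he hrep.smooth).continuous.comp hιc)
      fun x hx => poisson_eq_zero (hoff.hamField_eq_zero hrep hx)
  have i2 : Integrable (fun x => E t ((F.pt 0).ι x) * ρ t ((F.pt 0).ι x) * r 0 x) (F.pt 0).μ :=
    integrable_of_continuous_of_compact hK ((he.continuous.comp hιc).mul hrep.continuous_dens)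
      fun x hx => by rw [hoff.dens_eq_zero hrep hx, mul_zero]
  simp only [hval, smul_eq_mul, mul_one] at d1
  rw [integral_add i1 i2] at d1
  have hen : (fun u => energy E ρ p t (proj p (F.pt u))) = fun u =>
      -∫ x, E t ((F.pt u).ι x) * ρ t ((F.pt u).ι x) * F.dens u x ∂(F.pt 0).μ := by
    funext u
    exact congrArg Neg.neg (F.integral_pt u fun x => E t ((F.pt u).ι x) * ρ t ((F.pt u).ι x))
  rw [hen]
  refine d1.fun_neg.congr_deriv ?_
  simp only [poisson_neg_left, neg_mul, mul_zero, integral_zero, integral_neg]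
  ring

/-- The product rule for the conservation law of the action density. -/
lemma SatisfiesEquationsAt.represents
    (hE : ContMDiff (𝓘(ℝ, ℝ).prod (cot N)) 𝓘(ℝ, ℝ) ∞ (fun y : ℝ × Cotangent N Q => E y.1 y.2))
    (hρ : ContMDiff (𝓘(ℝ, ℝ).prod (cot N)) 𝓘(ℝ, ℝ) ∞ (fun y : ℝ × Cotangent N Q => ρ y.1 y.2))
    (h0 : ∀ t z, ρ t z ≠ 0) {F : SmoothFamily ℝ ε ι₀} {t : ℝ}
    (h : SatisfiesEquationsAt E ρ p F t) :
    F.Represents p t 1 (E t)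
        (fun x => -(timeDeriv ρ t ((F.pt t).ι x) / ρ t ((F.pt t).ι x)
          + 1 / ρ t ((F.pt t).ι x) * poisson (ρ t) (E t) ((F.pt t).ι x))) := by
  obtain ⟨h1, h2, h3⟩ := h
  refine ⟨contMDiff_param hE t, h1, h2, fun x => ?_⟩
  have hs : ContDiff ℝ ∞ (fun q : ℝ × ℝ => ρ q.1 ((F.pt q.2).ι x)) := by
    have hc : ContMDiff 𝓘(ℝ, ℝ × ℝ) (𝓘(ℝ, ℝ).prod (cot N)) ∞
        (fun q : ℝ × ℝ => (q.1, (F.pt q.2).ι x)) :=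
      contDiff_fst.contMDiff.prodMk
        (F.smooth_emb.comp (contDiff_snd.contMDiff.prodMk contMDiff_const))
    exact (hρ.comp hc).contDiff
  have hd := (hs.differentiable (by simp) (t, t)).hasFDerivAt
  set T := fderiv ℝ (fun q : ℝ × ℝ => ρ q.1 ((F.pt q.2).ι x)) (t, t)
  have e1 : T (1, 0) = timeDeriv ρ t ((F.pt t).ι x) := by
    have := (HasFDerivAt.comp t (f := fun s : ℝ => (s, t)) hd (hasFDerivAt_prodMk_left t t)).fderiv
    exact (congrArg (fun T => T (1 : ℝ)) this).symm
  have e2 : T (0, 1) = poisson (ρ t) (E t) ((F.pt t).ι x) := by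
    have a :=
      (HasFDerivAt.comp t (f := fun s : ℝ => (t, s)) hd (hasFDerivAt_prodMk_right t t)).fderiv
    have b := F.fderiv_comp_emb (contMDiff_param hρ t) t 1 x
    rw [h1 x] at b
    exact (congrArg (fun T => T (1 : ℝ)) a).symm.trans b
  have d1 : HasDerivAt (fun τ => ρ τ ((F.pt τ).ι x))
      (timeDeriv ρ t ((F.pt t).ι x) + poisson (ρ t) (E t) ((F.pt t).ι x)) t := by
    have := hd.comp_hasDerivAt (f := fun τ : ℝ => (τ, τ)) t
      ((hasDerivAt_id t).prodMk (hasDerivAt_id t))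
    rw [← e1, ← e2, ← map_add, Prod.mk_add_mk, add_zero, zero_add]
    exact this
  have d2 : HasDerivAt (fun τ => F.dens τ x) (fderiv ℝ (fun τ => F.dens τ x) t 1) t :=
    ((F.dens_contDiff x).differentiable (by simp) t).hasFDerivAt.hasDerivAt
  have d3 := (d1.mul d2).unique (h3 x)
  have := h0 t ((F.pt t).ι x)
  field_simp
  linarith

end Dynamics

end KMW

end

theorem theorem8 {N : ℕ}
    {Q : Type*} [TopologicalSpace Q] [T2Space Q] [SecondCountableTopology Q]
    [ChartedSpace (KMW.Rn N) Q] [IsManifold (𝓡 N) ∞ Q]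
    {L : Type*} [TopologicalSpace L] [T2Space L] [SecondCountableTopology L] [ConnectedSpace L]
    [ChartedSpace (KMW.Rn N) L] [IsManifold (𝓡 N) ∞ L] [MeasurableSpace L] [BorelSpace L]
    (p : L) (ε : ℝ) (hε : 0 < ε)
    (a : FundamentalGroup L p →* Multiplicative ℤ)
    (ι₀ : L → KMW.Cotangent N Q) (hι₀ : KMW.IsLagrangianEmbedding ι₀)
    (hBS : KMW.CorrectedBohrSommerfeld ε p a ι₀)
    (D : KMW.Cotangent N Q → ℝ → ℝ → ℝ)
    (hD : ContMDiff ((KMW.cot N).prod (𝓘(ℝ, ℝ).prod 𝓘(ℝ, ℝ))) 𝓘(ℝ, ℝ) ∞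
      (fun y : KMW.Cotangent N Q × ℝ × ℝ => D y.1 y.2.1 y.2.2))
    (E : ℝ → KMW.Cotangent N Q → ℝ)
    (hE : ContMDiff (𝓘(ℝ, ℝ).prod (KMW.cot N)) 𝓘(ℝ, ℝ) ∞
      (fun y : ℝ × KMW.Cotangent N Q => E y.1 y.2))
    (hDE : ∀ t z, D z t (-E t z) = 0)
    (ρ : ℝ → KMW.Cotangent N Q → ℝ) (hρ : ρ = KMW.rho D E) (hρ0 : ∀ t z, ρ t z ≠ 0) :
    (∀ (H : ℝ → KMW.PhaseSpace ε ι₀ p → ℝ) (t : ℝ) (Z : KMW.Potentials ε ι₀)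
      (k : L → ℝ) (P : KMW.Cotangent N Q → ℝ),
      ContMDiff (𝓡 N) 𝓘(ℝ, ℝ) ∞ k → KMW.Smooth P → KMW.HasDifferential p (H t) Z k P →
      ∀ (g : KMW.Cotangent N Q → ℝ) (r : L → ℝ),
        KMW.Smooth g → ContMDiff (𝓡 N) 𝓘(ℝ, ℝ) ∞ r →
        (KMW.IsHamiltonianVector ρ p H t Z g r ↔
          KMW.SameTangent Z g r
            (fun z => -(1 / ρ t z) * P z)
            (fun x => 1 / ρ t (Z.ι x) *
              (k x - KMW.timeDeriv ρ t (Z.ι x)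
                + KMW.poisson (ρ t) (fun z => 1 / ρ t z * P z) (Z.ι x))))) ∧
    (∀ (t : ℝ) (Z : KMW.Potentials ε ι₀),
      Integrable (fun x => E t (Z.ι x) * ρ t (Z.ι x)) Z.μ →
      KMW.HasDifferential p (KMW.energy E ρ p t) Z (fun _ => 0) (fun z => -(E t z * ρ t z)) ∧
      ∀ (g : KMW.Cotangent N Q → ℝ) (r : L → ℝ),
        KMW.Smooth g → ContMDiff (𝓡 N) 𝓘(ℝ, ℝ) ∞ r →
        (KMW.IsHamiltonianVector ρ p (fun t' => KMW.energy E ρ p t') t Z g r ↔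
          KMW.SameTangent Z g r (E t)
            (fun x => -(KMW.timeDeriv ρ t (Z.ι x) / ρ t (Z.ι x)
              + 1 / ρ t (Z.ι x) * KMW.poisson (ρ t) (E t) (Z.ι x))))) ∧
    (∀ (F : KMW.SmoothFamily ℝ ε ι₀) (t : ℝ), KMW.SatisfiesEquationsAt E ρ p F t →
      F.Represents p t 1 (E t)
        (fun x => -(KMW.timeDeriv ρ t ((F.pt t).ι x) / ρ t ((F.pt t).ι x)
          + 1 / ρ t ((F.pt t).ι x) * KMW.poisson (ρ t) (E t) ((F.pt t).ι x)))) := by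
  have hρs : ContMDiff (𝓘(ℝ, ℝ).prod (KMW.cot N)) 𝓘(ℝ, ℝ) ∞
      (fun y : ℝ × KMW.Cotangent N Q => ρ y.1 y.2) := hρ ▸ KMW.contMDiff_rho hD hE
  refine ⟨fun H t Z k P hk hP hH g r hg hr => ?_, fun t Z hint => ?_, fun F t h =>
    h.represents hE hρs hρ0⟩
  · exact KMW.isHamiltonianVector_iff hι₀ hρs hρ0 hk.continuous hP hH hg hr
  · have hEt : KMW.Smooth (E t) := KMW.contMDiff_param hE t
    have hρt : KMW.Smooth (ρ t) := KMW.contMDiff_param hρs t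
    have hP : KMW.Smooth fun z => -(E t z * ρ t z) := (hEt.mul hρt).neg
    have hH := KMW.hasDifferential_energy (p := p) hEt hρt hint
    refine ⟨hH, fun g r hg hr => ?_⟩
    refine (KMW.isHamiltonianVector_iff (H := fun t' => KMW.energy E ρ p t') hι₀ hρs hρ0
      continuous_const hP hH hg hr).trans (iff_of_eq ?_)
    have eG : KMW.hamiltonianG (ρ t) (fun z => -(E t z * ρ t z)) = E t := by
      funext z
      have := hρ0 t z
      simp only [KMW.hamiltonianG]
      field_simp
    have eP : (fun z => 1 / ρ t z * -(E t z * ρ t z)) = fun z => -E t z := by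
      funext z
      have := hρ0 t z
      field_simp
    have eR : KMW.hamiltonianR ρ t (fun z => -(E t z * ρ t z)) (fun _ => 0) Z
        = fun x => -(KMW.timeDeriv ρ t (Z.ι x) / ρ t (Z.ι x)
          + 1 / ρ t (Z.ι x) * KMW.poisson (ρ t) (E t) (Z.ι x)) := by
      funext x
      simp only [KMW.hamiltonianR]
      rw [eP, KMW.poisson_neg_right]
      ring
    rw [eG, eR]
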